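/- Let $\langle v\rangle=\sqrt{1+|v|^2}$ for $v\in\mathbb R^3$ and $r=|x|$ for $x\in\mathbb R^3$. For $f=f(t,x,v)$ put $$\rho=\int\langle v\rangle f\,dv,\quad p=\int\Bigl(\frac{x\cdot v}{r}\Bigr)^2 f\,\frac{dv}{\langle v\rangle},\quad j=\int\frac{x\cdot v}{r}\,f\,dv,$$ which for spherically symmetric $f$ (i.e. $f(t,Ox,Ov)=f(t,x,v)$ for $O\in\mathrm{SO}(3)$) are functions of $(t,r)$, extended continuously to $r=0$, and for $a,\beta$ depending on $(t,r)$ put $$A(t,r)=1-\frac{8\pi}{r}\int_0^r(\rho-a\beta j)(t,s)\,s^2\,ds ,\qquad A(t,0)=1.$$ Let $0<T\le\infty$, $I=[0,T[$, and let $(f,a,\beta)$ be regular on $I$, that is: $f\colon I\times\mathbb R^6\to[0,\infty[$ is $C^1$, spherically symmetric, and $\mathrm{supp}\,f(t)$ is compact, locally uniformly in $t\in I$; $a\colon I\times[0,\infty[\,\to\,]0,\infty[$ is $C^1$ with $a(t,0)=1$, $\partial_ra(t,0)=0$; $\beta\colon I\times[0,\infty[\,\to\mathbb R$ and $\partial_r\beta$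 are $C^1$ with $\beta(t,0)=\partial_r^2\beta(t,0)=0$. Assume that the data at $t=0$, $\mathring f=f(0)$, $\mathring a=a(0)$, $\mathring\beta=\beta(0)$, are admissible: $\mathring f\in C^1_c(\mathbb R^6)$ is non-negative and spherically symmetric; $\mathring a\in C^1([0,\infty[)$ is positive with $\mathring a(0)=1=\lim_{r\to\infty}\mathring a(r)$ and $\mathring a'(0)=0$; $\mathring\beta\in C^2([0,\infty[)$ with $\mathring\beta(0)=\mathring\beta''(0)=0=\lim_{r\to\infty}\mathring\beta(r)$; and $A(0,r)=\mathring a(r)^{-2}-\mathring\beta(r)^2$ for $r\ge0$. Assume that $(f,a,\beta)$ solves the reduced system $$\partial_tf+\Bigl(\frac{v}{a\langle v\rangle}-\beta\frac xr\Bigr)\cdot\partial_xf+\Bigl[4\pi r\,a\,j\,\frac{x\cdot v}{r}\frac xr+\Bigl(\partial_r\beta-\frac\beta r\Bigr)\frac{x\cdot v}{r}\frac xr+\frac\beta r\,v\Bigr]\cdot\partial_vf=0\quad(x\ne0),$$ $$\partial_t\beta-\beta\,\partial_r\beta=\frac1{2r}(1-A)+4\pi rp,\qquad \partial_ta-\beta\,\partial_ra=-4\pi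 ra^2j$$ on $I$, where $\frac1{2r}(1-A)$ is read as its limit $0$ at $r=0$. Then for all $t\in I$ and $r\ge0$: 1. $A=\dfrac1{a^2}-\beta^2$; 2. $\partial_t\bigl(r(1-A)\bigr)=8\pi r^2\bigl(\beta(\rho+p)-(a\beta^2+a^{-1})j\bigr)$; 3. for $x\neq0$ and $v\in\mathbb R^3$ the original Vlasov equation holds: $$\partial_tf+\Bigl(\frac{v}{a\langle v\rangle}-\beta\frac xr\Bigr)\cdot\partial_xf+\Bigl[\Bigl(\beta\frac{\partial_ra}{a}-\frac{\partial_ta}{a}+\partial_r\beta\Bigr)\frac{x\cdot v}{r}\frac xr+\frac\beta r\Bigl(v-\frac{x\cdot v}{r}\frac xr\Bigr)\Bigr]\cdot\partial_vf=0 .$$ 4. If in addition $\mathring a\in C^2([0,\infty[)$, then $a,\beta\in C^2(I\times[0,\infty[)$, and all components of the Einstein equations $G_{\mu\nu}=8\pi T_{\mu\nu}$ hold for the Painlevé–Gullstrand metric $$ds^2=-dt^2+a^2(dr+\beta\,dt)^2+r^2(d\theta^2+\sin^2\theta\,d\phi^2)$$ in the coordinates $(t,r,\theta,\phi)$, $t\in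 I$, $r>0$, $0<\theta<\pi$, $\phi\in\mathbb R$. Here $G_{\mu\nu}$ is the Einstein tensor of the metric, and $$T_{\mu\nu}=|g|^{-1/2}\int p_\mu p_\nu\,f\,\frac{dp_1\,dp_2\,dp_3}{p^0},$$ where $p_0$ is determined by $g^{\mu\nu}p_\mu p_\nu=-1$, $p^0>0$, and $f$ is evaluated at $(t,x,v)$ with $x$ the point with polar coordinates $(r,\theta,\phi)$ and $v=p+\bigl(\frac1a-1\bigr)\frac{x\cdot p}{r}\frac xr$, where $p\in\mathbb R^3$ are the Cartesian components of the covector $p_1\,dr+p_2\,d\theta+p_3\,d\phi$. (Time derivatives at $t=0$ and radial derivatives at $r=0$ are one-sided.) -/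

import Mathlib

noncomputable section

namespace PainleveGullstrand

/-! ### Domains, derivatives, symmetry -/

/-- Euclidean three-space. -/
abbrev E3 : Type := EuclideanSpace ℝ (Fin 3)

/-- The time interval `[0, T[`, where `T = ∞` is allowed. -/
def timeInterval (T : EReal) : Set ℝ := {t | 0 ≤ t ∧ (t : EReal) < T}

/-- `∂_t u (t, r)` for a function on `I × [0, ∞[` (one-sided at boundary points of `I`). -/
def dt (I : Set ℝ) (u : ℝ → ℝ → ℝ) (t r : ℝ) : ℝ := derivWithin (fun s => u s r) I t

/-- `∂_r u (t, r)` for a function on `I × [0, ∞[` (one-sided at `r = 0`). -/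
def dr (u : ℝ → ℝ → ℝ) (t r : ℝ) : ℝ := derivWithin (fun s => u t s) (Set.Ici 0) r

/-- `u ∈ C^n (I × [0, ∞[)`, up to and including the boundary. -/
def IsCn (n : ℕ) (I : Set ℝ) (u : ℝ → ℝ → ℝ) : Prop :=
  ContDiffOn ℝ n (fun q : ℝ × ℝ => u q.1 q.2) (I ×ˢ Set.Ici 0)

/-- Invariance of a function of `(x, v)` under the diagonal action of `SO(3)`. -/
def SphericallySymmetric (h : E3 → E3 → ℝ) : Prop :=
  ∀ O : E3 ≃ₗᵢ[ℝ] E3, LinearMap.det (O.toLinearEquiv : E3 →ₗ[ℝ] E3) = 1 →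
    ∀ x v, h (O x) (O v) = h x v

/-! ### Matter terms -/

/-- `⟨v⟩ = (1 + |v|²)^{1/2}`. -/
def jap (v : E3) : ℝ := Real.sqrt (1 + ‖v‖ ^ 2)

/-- A fixed unit vector. For spherically symmetric `f` the matter terms at `x` depend on `x` only
through `r = |x|`, and they are evaluated at the point `x = r e`, where `x / r = e`. At `r = 0` this
yields their continuous extension. -/
def e : E3 := EuclideanSpace.single 0 1

/-- `ρ = ∫ ⟨v⟩ f dv`. -/
def rho (f : ℝ → E3 → E3 → ℝ) (t r : ℝ) : ℝ := ∫ v : E3, jap v * f t (r • e) v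

/-- `p = ∫ (x·v/r)² f dv/⟨v⟩`. -/
def pres (f : ℝ → E3 → E3 → ℝ) (t r : ℝ) : ℝ :=
  ∫ v : E3, (inner ℝ e v) ^ 2 * f t (r • e) v / jap v

/-- `j = ∫ (x·v/r) f dv`. -/
def curr (f : ℝ → E3 → E3 → ℝ) (t r : ℝ) : ℝ :=
  ∫ v : E3, inner ℝ e v * f t (r • e) v

/-- `A(t,r) = 1 - (8π/r) ∫_0^r (ρ - a β j)(t,s) s² ds`. At `r = 0` the convention `x / 0 = 0` gives
the continuous extension `A(t,0) = 1`. -/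
def Afun (f : ℝ → E3 → E3 → ℝ) (a β : ℝ → ℝ → ℝ) (t r : ℝ) : ℝ :=
  1 - 8 * Real.pi / r * ∫ s in (0 : ℝ)..r, (rho f t s - a t s * β t s * curr f t s) * s ^ 2

/-! ### Regularity -/

/-- Regular phase space density on the time interval `I`. -/
structure RegularDensity (I : Set ℝ) (f : ℝ → E3 → E3 → ℝ) : Prop where
  nonneg : ∀ t ∈ I, ∀ x v, 0 ≤ f t x v
  contDiff : ContDiffOn ℝ 1 (fun q : ℝ × E3 × E3 => f q.1 q.2.1 q.2.2) (I ×ˢ Set.univ)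
  symmetric : ∀ t ∈ I, SphericallySymmetric (f t)
  support : ∀ J : Set ℝ, J ⊆ I → IsCompact J →
    ∃ C : ℝ, ∀ t ∈ J, ∀ x v, f t x v ≠ 0 → ‖x‖ ≤ C ∧ ‖v‖ ≤ C

/-- Regular metric coefficient `a` on the time interval `I`. -/
structure RegularA (I : Set ℝ) (a : ℝ → ℝ → ℝ) : Prop where
  pos : ∀ t ∈ I, ∀ r, 0 ≤ r → 0 < a t r
  contDiff : IsCn 1 I a
  dr_zero : ∀ t ∈ I, dr a t 0 = 0
  at_zero : ∀ t ∈ I, a t 0 = 1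

/-- Regular metric coefficient `β` on the time interval `I`. -/
structure RegularBeta (I : Set ℝ) (β : ℝ → ℝ → ℝ) : Prop where
  contDiff : IsCn 1 I β
  contDiff_dr : IsCn 1 I (dr β)
  at_zero : ∀ t ∈ I, β t 0 = 0
  drr_zero : ∀ t ∈ I, dr (dr β) t 0 = 0

/-! ### Initial data and the reduced system -/

/-- Admissible initial data. -/
structure AdmissibleData (f₀ : E3 → E3 → ℝ) (a₀ β₀ : ℝ → ℝ) : Prop where
  f_contDiff : ContDiff ℝ 1 (fun q : E3 × E3 => f₀ q.1 q.2)
  f_support : HasCompactSupport (fun q : E3 × E3 => f₀ q.1 q.2)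
  f_symmetric : SphericallySymmetric f₀
  f_nonneg : ∀ x v, 0 ≤ f₀ x v
  a_contDiff : ContDiffOn ℝ 1 a₀ (Set.Ici 0)
  a_pos : ∀ r, 0 ≤ r → 0 < a₀ r
  a_zero : a₀ 0 = 1
  a_infty : Filter.Tendsto a₀ Filter.atTop (nhds 1)
  a_deriv_zero : derivWithin a₀ (Set.Ici 0) 0 = 0
  β_contDiff : ContDiffOn ℝ 2 β₀ (Set.Ici 0)
  β_zero : β₀ 0 = 0
  β_infty : Filter.Tendsto β₀ Filter.atTop (nhds 0)
  β_deriv2_zero : iteratedDerivWithin 2 β₀ (Set.Ici 0) 0 = 0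
  constraint : ∀ r, 0 ≤ r →
    Afun (fun _ => f₀) (fun _ => a₀) (fun _ => β₀) 0 r = 1 / a₀ r ^ 2 - β₀ r ^ 2

/-- `∂_t f + X·∂_x f + V·∂_v f` at `(t, x, v)`. -/
def transport (I : Set ℝ) (f : ℝ → E3 → E3 → ℝ) (X V : E3) (t : ℝ) (x v : E3) : ℝ :=
  derivWithin (fun s => f s x v) I t + fderiv ℝ (fun y => f t y v) x X
    + fderiv ℝ (fun w => f t x w) v V

/-- The Vlasov equation of the reduced system, in which `4π r a j` replaces a combination of
derivatives of `a`. -/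
def ReducedVlasov (I : Set ℝ) (f : ℝ → E3 → E3 → ℝ) (a β : ℝ → ℝ → ℝ) : Prop :=
  ∀ t ∈ I, ∀ x v : E3, x ≠ 0 →
    let r := ‖x‖
    let w := inner ℝ x v / r
    transport I f
      ((1 / (a t r * jap v)) • v - (β t r / r) • x)
      ((4 * Real.pi * r * a t r * curr f t r * w / r) • x
        + ((dr β t r - β t r / r) * w / r) • x + (β t r / r) • v)
      t x v = 0

/-- The Vlasov equation in Painlevé-Gullstrand coordinates. -/
def Vlasov (I : Set ℝ) (f : ℝ → E3 → E3 → ℝ) (a β : ℝ → ℝ → ℝ) : Prop :=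
  ∀ t ∈ I, ∀ x v : E3, x ≠ 0 →
    let r := ‖x‖
    let w := inner ℝ x v / r
    transport I f
      ((1 / (a t r * jap v)) • v - (β t r / r) • x)
      (((β t r * (dr a t r / a t r) - dt I a t r / a t r + dr β t r) * w / r) • x
        + (β t r / r) • (v - (w / r) • x))
      t x v = 0

/-- `(f, a, β)` is a regular solution of the reduced system on `[0, T[`, launched by admissible
initial data. -/
structure IsReducedSolution (T : EReal) (f : ℝ → E3 → E3 → ℝ) (a β : ℝ → ℝ → ℝ) : Prop where
  data : AdmissibleData (f 0) (a 0) (β 0)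
  regular_f : RegularDensity (timeInterval T) f
  regular_a : RegularA (timeInterval T) a
  regular_β : RegularBeta (timeInterval T) β
  vlasov : ReducedVlasov (timeInterval T) f a β
  β_eq : ∀ t ∈ timeInterval T, ∀ r, 0 ≤ r →
    dt (timeInterval T) β t r - β t r * dr β t r
      = 1 / (2 * r) * (1 - Afun f a β t r) + 4 * Real.pi * r * pres f t r
  a_eq : ∀ t ∈ timeInterval T, ∀ r, 0 ≤ r →
    dt (timeInterval T) a t r - β t r * dr a t r
      = -4 * Real.pi * r * a t r ^ 2 * curr f t r

/-! ### The Einstein tensor of a metric in a coordinate domain -/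

/-- Partial derivative `∂_μ h` at `X` of a function on the coordinate domain `D`. -/
def partialD (D : Set (Fin 4 → ℝ)) (μ : Fin 4) (h : (Fin 4 → ℝ) → ℝ) (X : Fin 4 → ℝ) : ℝ :=
  derivWithin (fun s => h (Function.update X μ s)) {s | Function.update X μ s ∈ D} (X μ)

/-- Christoffel symbols `Γ^l_{μν}`. -/
def christoffel (D : Set (Fin 4 → ℝ)) (g : (Fin 4 → ℝ) → Matrix (Fin 4) (Fin 4) ℝ)
    (l μ ν : Fin 4) (X : Fin 4 → ℝ) : ℝ :=
  1 / 2 * ∑ σ, (g X)⁻¹ l σ *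
    (partialD D μ (fun Y => g Y σ ν) X + partialD D ν (fun Y => g Y σ μ) X
      - partialD D σ (fun Y => g Y μ ν) X)

/-- Ricci tensor
`R_{μν} = ∂_l Γ^l_{μν} - ∂_ν Γ^l_{μl} + Γ^l_{lσ} Γ^σ_{μν} - Γ^l_{νσ} Γ^σ_{μl}`. -/
def ricci (D : Set (Fin 4 → ℝ)) (g : (Fin 4 → ℝ) → Matrix (Fin 4) (Fin 4) ℝ)
    (μ ν : Fin 4) (X : Fin 4 → ℝ) : ℝ :=
  ∑ l, (partialD D l (christoffel D g l μ ν) X - partialD D ν (christoffel D g l μ l) X)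
    + ∑ l, ∑ σ, (christoffel D g l l σ X * christoffel D g σ μ ν X
      - christoffel D g l ν σ X * christoffel D g σ μ l X)

/-- Scalar curvature. -/
def scalarCurvature (D : Set (Fin 4 → ℝ)) (g : (Fin 4 → ℝ) → Matrix (Fin 4) (Fin 4) ℝ)
    (X : Fin 4 → ℝ) : ℝ :=
  ∑ μ, ∑ ν, (g X)⁻¹ μ ν * ricci D g μ ν X

/-- Einstein tensor `G_{μν} = R_{μν} - (1/2) R g_{μν}`. -/
def einstein (D : Set (Fin 4 → ℝ)) (g : (Fin 4 → ℝ) → Matrix (Fin 4) (Fin 4) ℝ)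
    (μ ν : Fin 4) (X : Fin 4 → ℝ) : ℝ :=
  ricci D g μ ν X - 1 / 2 * scalarCurvature D g X * g X μ ν

/-! ### The energy momentum tensor of a collisionless gas -/

/-- `p^0 > 0` on the mass shell `g^{μν} p_μ p_ν = -1`, as a function of `(p_1, p_2, p_3)`. -/
def pUpZero (g : Matrix (Fin 4) (Fin 4) ℝ) (p : Fin 3 → ℝ) : ℝ :=
  Real.sqrt ((∑ i, g⁻¹ 0 (Fin.succ i) * p i) ^ 2
    - g⁻¹ 0 0 * (1 + ∑ i, ∑ k, g⁻¹ (Fin.succ i) (Fin.succ k) * p i * p k))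

/-- The covector `(p_0, p_1, p_2, p_3)` on the mass shell; `p_0` is determined by
`p^0 = g^{00} p_0 + g^{0i} p_i`. -/
def pLow (g : Matrix (Fin 4) (Fin 4) ℝ) (p : Fin 3 → ℝ) : Fin 4 → ℝ :=
  Fin.cons ((pUpZero g p - ∑ i, g⁻¹ 0 (Fin.succ i) * p i) / g⁻¹ 0 0) p

/-- `T_{μν} = |g|^{-1/2} ∫ p_μ p_ν F dp_1 dp_2 dp_3 / p^0`, for a density `F` as a function of the
canonical momenta `(p_1, p_2, p_3)` at a point with metric `g`. -/
def energyMomentum (g : Matrix (Fin 4) (Fin 4) ℝ) (F : (Fin 3 → ℝ) → ℝ) (μ ν : Fin 4) : ℝ :=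
  (Real.sqrt |g.det|)⁻¹ * ∫ p : Fin 3 → ℝ, pLow g p μ * pLow g p ν * F p / pUpZero g p

/-! ### The Painlevé-Gullstrand metric, in the coordinates `(t, r, θ, φ)` -/

/-- The coordinate domain `t ∈ I`, `r > 0`, `0 < θ < π`, `φ ∈ ℝ`. -/
def chart (I : Set ℝ) : Set (Fin 4 → ℝ) :=
  {X | X 0 ∈ I ∧ 0 < X 1 ∧ 0 < X 2 ∧ X 2 < Real.pi}

/-- `ds² = -dt² + a² (dr + β dt)² + r² (dθ² + sin²θ dφ²)`. -/
def pgMetric (a β : ℝ → ℝ → ℝ) (X : Fin 4 → ℝ) : Matrix (Fin 4) (Fin 4) ℝ :=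
  let α := a (X 0) (X 1)
  let b := β (X 0) (X 1)
  !![-1 + α ^ 2 * b ^ 2, α ^ 2 * b, 0, 0;
     α ^ 2 * b, α ^ 2, 0, 0;
     0, 0, X 1 ^ 2, 0;
     0, 0, 0, X 1 ^ 2 * Real.sin (X 2) ^ 2]

/-- The Cartesian position `x` with polar coordinates `(r, θ, φ)`. -/
def cartPos (X : Fin 4 → ℝ) : E3 :=
  X 1 • !₂[Real.sin (X 2) * Real.cos (X 3), Real.sin (X 2) * Real.sin (X 3), Real.cos (X 2)]

/-- The Cartesian components of the spatial covector `p_r dr + p_θ dθ + p_φ dφ`. -/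
def cartMom (X : Fin 4 → ℝ) (p : Fin 3 → ℝ) : E3 :=
  p 0 • !₂[Real.sin (X 2) * Real.cos (X 3), Real.sin (X 2) * Real.sin (X 3), Real.cos (X 2)]
    + (p 1 / X 1) •
      !₂[Real.cos (X 2) * Real.cos (X 3), Real.cos (X 2) * Real.sin (X 3), -Real.sin (X 2)]
    + (p 2 / (X 1 * Real.sin (X 2))) • !₂[-Real.sin (X 3), Real.cos (X 3), 0]

/-- The non-canonical momentum `v = p + (1/a - 1) (x·p/r) x/r`, where `r = |x|`. -/
def noncanonical (α : ℝ) (x p : E3) : E3 :=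
  p + ((1 / α - 1) * (inner ℝ x p / ‖x‖) / ‖x‖) • x

/-- The density as a function of the canonical momenta `(p_r, p_θ, p_φ)` at the point `X`. -/
def canonicalDensity (f : ℝ → E3 → E3 → ℝ) (a : ℝ → ℝ → ℝ) (X : Fin 4 → ℝ)
    (p : Fin 3 → ℝ) : ℝ :=
  f (X 0) (cartPos X) (noncanonical (a (X 0) (X 1)) (cartPos X) (cartMom X p))

/-- All components of the Einstein equations `G_{μν} = 8π T_{μν}` hold for the
Painlevé-Gullstrand metric. -/
def EinsteinEquations (I : Set ℝ) (f : ℝ → E3 → E3 → ℝ) (a β : ℝ → ℝ → ℝ) : Prop :=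
  ∀ X ∈ chart I, ∀ μ ν : Fin 4,
    einstein (chart I) (pgMetric a β) μ ν X
      = 8 * Real.pi * energyMomentum (pgMetric a β X) (canonicalDensity f a X) μ ν

end PainleveGullstrand

end

noncomputable section

namespace PainleveGullstrand

open MeasureTheory Set Filter Topology

/-! ### Parametric integrals over compact sets -/

section Parametric

/-! The reduced system evolves `a` and `β` without imposing `A = 1/a² - β²`, so everything rests on
the propagation of this constraint from the data. Let `D = 1/a² - β² - A` be the constraint defect
(`defect`).

Integrating the reduced Vlasov equation against `⟨v⟩` and `x·v/r` gives equations for `∂_t ρ` and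
`∂_t j` (`dt_rho`, `dt_curr`). Spherical symmetry trades the tangential position derivatives for
momentum derivatives, and these are integrated by parts. The outcome is a balance law for the mass
density `(ρ - a β j) r²` that is exact up to `(1/2) a j r² ∂_r D` (`mass_balance`). Integrated over
`[0, r]` and combined with the equations for `a` and `β`, it yields `∂_t D - β ∂_r D = (4π/r) ∫_0^r
a j s² ∂_r D ds` (`defect_transport`): a linear homogeneous nonlocal equation with vanishing data.

An integration by parts removes `∂_r D` from the right side, which is then bounded by `K max_{[0,r]}
|D|` (`exists_defect_source_le` states this at radii where the maximum is attained). The domain of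
dependence of a point is the region below its backward characteristic `R' = -β`. That characteristic
reaches time `0` because `β` changes at a bounded rate along it (`exists_characteristic`). On this
compact region `exp(-c t) D²` with `c > 2K` cannot have a positive maximum, hence `D = 0`
(`defect_eq_zero`).

With `D = 0` the mass balance is exact, which is the second assertion, and the equation for `a`
turns the reduced Vlasov equation into the original one. For regularity, `∂_t A` and `∂_r A` are
expressed through `a`, `β`, matter terms and a radial average, with no derivative of them. Thus `A`
is `C²`, and so is `a = (A + β²)^(-1/2)`.

For the Einstein equations, the metric is a warped product of the `(t, r)`-plane with the sphere.
The `(t, r)`-block of the Einstein tensor contains only first derivatives of `a` and `β`, which are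
known from the equations and the constraint. The angular components contain the Gauss curvature of
the plane, computed by differentiating the evolution equations and inserting `dt_curr`
(`gaussCurv_eq`). On the matter side, orthonormal frame components of the momentum turn `T_{μν}`
into velocity moments at `r e` (`energyMomentum_eq_moment`). -/

theorem continuousOn_section {P V G : Type*} [TopologicalSpace P] [TopologicalSpace V]
    [TopologicalSpace G] {S : Set P} {k : Set V} {F : P → V → G}
    (hF : ContinuousOn F.uncurry (S ×ˢ k)) {q : P} (hq : q ∈ S) : ContinuousOn (F q) k :=
  hF.comp (f := fun v => (q, v)) (by fun_prop) (fun _ hv => ⟨hq, hv⟩)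

variable {P V G : Type*} [NormedAddCommGroup P]
  [NormedAddCommGroup V] [MeasurableSpace V] [BorelSpace V]
  [NormedAddCommGroup G] [NormedSpace ℝ G]
  {μ : Measure V} [IsFiniteMeasureOnCompacts μ] {S : Set P} {k : Set V}

/-- Compactness of `k` makes `F p` uniformly close to `F q` on `k` as `p → q` in `S`, so no
dominating function is needed. The set `S` is arbitrary, since the parameter sets used later contain
boundary points. -/
theorem continuousOn_setIntegral_of_isCompact (hk : IsCompact k) {F : P → V → G}
    (hF : ContinuousOn F.uncurry (S ×ˢ k)) :
    ContinuousOn (fun q => ∫ v in k, F q v ∂μ) S := by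
  intro q hq
  rw [ContinuousWithinAt, Metric.tendsto_nhds]
  intro ε hε
  obtain ⟨δ, hδ, hδε⟩ : ∃ δ : ℝ, 0 < δ ∧ δ * μ.real k < ε := by
    -- The `+ 1` covers the case that `k` has measure zero.
    refine ⟨ε / (μ.real k + 1), by positivity, ?_⟩
    have h0 : 0 ≤ μ.real k := measureReal_nonneg
    rw [div_mul_eq_mul_div, div_lt_iff₀ (by positivity)]
    nlinarith
  obtain ⟨w, hw, hwF⟩ := hk.mem_uniformity_of_prod hF hq (Metric.dist_mem_uniformity hδ)
  filter_upwards [hw, self_mem_nhdsWithin] with p hp hpS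
  rw [dist_eq_norm, ← integral_sub ((continuousOn_section hF hpS).integrableOn_compact hk)
    ((continuousOn_section hF hq).integrableOn_compact hk)]
  refine lt_of_le_of_lt (norm_setIntegral_le_of_norm_le_const hk.measure_lt_top ?_) hδε
  intro v hv
  rw [← dist_eq_norm]
  exact (hwF p hp v hv).le

variable [NormedSpace ℝ P]

/-- Near `q` the derivatives differ from `F' q v` by at most `δ`, uniformly in `v ∈ k`. The mean
value inequality on the convex set `ball ∩ S` then bounds the Taylor remainder by `δ ‖p - q‖`, which
is integrated over `k`. Convexity of `S` replaces openness, so one-sided derivatives are included.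
-/
theorem hasFDerivWithinAt_setIntegral_of_isCompact (hS : Convex ℝ S) (hk : IsCompact k)
    {F : P → V → ℝ} {F' : P → V → P →L[ℝ] ℝ} (hF : ContinuousOn F.uncurry (S ×ˢ k))
    (hF' : ContinuousOn F'.uncurry (S ×ˢ k))
    (hd : ∀ q ∈ S, ∀ v ∈ k, HasFDerivWithinAt (fun p => F p v) (F' q v) S q) {q : P}
    (hq : q ∈ S) :
    HasFDerivWithinAt (fun p => ∫ v in k, F p v ∂μ) (∫ v in k, F' q v ∂μ) S q := by
  rw [hasFDerivWithinAt_iff_isLittleO, Asymptotics.isLittleO_iff]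
  intro ε hε
  obtain ⟨δ, hδ, hδε⟩ : ∃ δ : ℝ, 0 < δ ∧ δ * μ.real k < ε := by
    refine ⟨ε / (μ.real k + 1), by positivity, ?_⟩
    have h0 : 0 ≤ μ.real k := measureReal_nonneg
    rw [div_mul_eq_mul_div, div_lt_iff₀ (by positivity)]
    nlinarith
  obtain ⟨w, hw, hwF⟩ := hk.mem_uniformity_of_prod hF' hq (Metric.dist_mem_uniformity hδ)
  obtain ⟨η, hη, hηw⟩ := Metric.mem_nhdsWithin_iff.1 hw
  have hconv : Convex ℝ (Metric.ball q η ∩ S) := (convex_ball q η).inter hS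
  have hI' := (continuousOn_section hF' hq).integrableOn_compact (μ := μ) hk
  filter_upwards [self_mem_nhdsWithin, mem_nhdsWithin_of_mem_nhds (Metric.ball_mem_nhds q hη)]
    with p hpS hpη
  have hIp := (continuousOn_section hF hpS).integrableOn_compact (μ := μ) hk
  have hIq := (continuousOn_section hF hq).integrableOn_compact (μ := μ) hk
  have hbound : ∀ v ∈ k, ‖F p v - F q v - F' q v (p - q)‖ ≤ δ * ‖p - q‖ := by
    intro v hv
    refine Convex.norm_image_sub_le_of_norm_hasFDerivWithin_le' (f := fun z => F z v)
      (f' := fun z => F' z v) (s := Metric.ball q η ∩ S)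
      (fun z hz => (hd z hz.2 v hv).mono inter_subset_right) ?_ hconv
      ⟨Metric.mem_ball_self hη, hq⟩ ⟨hpη, hpS⟩
    intro z hz
    rw [← dist_eq_norm]
    exact (hwF z (hηw hz) v hv).le
  have hIa : Integrable (fun v => F' q v (p - q)) (μ.restrict k) :=
    hI'.apply_continuousLinearMap (p - q)
  rw [ContinuousLinearMap.integral_apply hI', ← integral_sub hIp hIq,
    ← integral_sub (f := fun v => F p v - F q v) (hIp.sub hIq) hIa]
  refine (norm_setIntegral_le_of_norm_le_const hk.measure_lt_top hbound).trans ?_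
  have := norm_nonneg (p - q)
  nlinarith

end Parametric

/-! ### Functions of `(t, r)` on `I × [0, ∞[` -/

section TimeRadius

variable {I : Set ℝ} {u w : ℝ → ℝ → ℝ} {t r : ℝ}

/-- The domain `I × [0, ∞[`. -/
def halfStrip (I : Set ℝ) : Set (ℝ × ℝ) := I ×ˢ Ici 0

theorem halfStrip_convex (hI : Convex ℝ I) : Convex ℝ (halfStrip I) := hI.prod (convex_Ici 0)

theorem halfStrip_uniqueDiffOn (hI : UniqueDiffOn ℝ I) : UniqueDiffOn ℝ (halfStrip I) :=
  hI.prod (uniqueDiffOn_Ici 0)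

theorem hasDerivWithinAt_time_of_hasFDerivWithinAt {L : ℝ × ℝ →L[ℝ] ℝ}
    (h : HasFDerivWithinAt (fun q : ℝ × ℝ => u q.1 q.2) L (halfStrip I) (t, r)) (hr : 0 ≤ r) :
    HasDerivWithinAt (fun s => u s r) (L (1, 0)) I t := by
  have := h.comp_hasDerivWithinAt (f := fun s : ℝ => (s, r)) (f' := (1, 0)) (s := I) t
    ((hasDerivWithinAt_id t I).prodMk (hasDerivWithinAt_const t I r)) (fun s hs => ⟨hs, hr⟩)
  exact this

theorem hasDerivWithinAt_radius_of_hasFDerivWithinAt {L : ℝ × ℝ →L[ℝ] ℝ}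
    (h : HasFDerivWithinAt (fun q : ℝ × ℝ => u q.1 q.2) L (halfStrip I) (t, r)) (ht : t ∈ I) :
    HasDerivWithinAt (fun s => u t s) (L (0, 1)) (Ici 0) r := by
  have := h.comp_hasDerivWithinAt (f := fun s : ℝ => (t, s)) (f' := (0, 1)) (s := Ici 0) r
    ((hasDerivWithinAt_const r (Ici 0) t).prodMk (hasDerivWithinAt_id r (Ici 0)))
    (fun s hs => ⟨ht, hs⟩)
  exact this

theorem dt_eq (hI : UniqueDiffOn ℝ I) (ht : t ∈ I) {d : ℝ}
    (h : HasDerivWithinAt (fun s => u s r) d I t) : dt I u t r = d :=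
  h.derivWithin (hI t ht)

theorem dr_eq (hr : 0 ≤ r) {d : ℝ}
    (h : HasDerivWithinAt (fun s => u t s) d (Ici 0) r) : dr u t r = d :=
  h.derivWithin (uniqueDiffOn_Ici 0 r hr)

theorem IsCn.continuousOn {n : ℕ} (h : IsCn n I u) :
    ContinuousOn (fun q : ℝ × ℝ => u q.1 q.2) (halfStrip I) := ContDiffOn.continuousOn h

theorem IsCn.differentiableOn {n : ℕ} (h : IsCn n I u) (hn : n ≠ 0) :
    DifferentiableOn ℝ (fun q : ℝ × ℝ => u q.1 q.2) (halfStrip I) :=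
  ContDiffOn.differentiableOn h (by exact_mod_cast hn)

theorem IsCn.hasDerivWithinAt_dt {n : ℕ} (h : IsCn n I u) (hn : n ≠ 0)
    (ht : t ∈ I) (hr : 0 ≤ r) : HasDerivWithinAt (fun s => u s r) (dt I u t r) I t :=
  (hasDerivWithinAt_time_of_hasFDerivWithinAt
    (h.differentiableOn hn (t, r) ⟨ht, hr⟩).hasFDerivWithinAt hr).differentiableWithinAt
    |>.hasDerivWithinAt

theorem IsCn.hasDerivWithinAt_dr {n : ℕ} (h : IsCn n I u) (hn : n ≠ 0)
    (ht : t ∈ I) (hr : 0 ≤ r) : HasDerivWithinAt (fun s => u t s) (dr u t r) (Ici 0) r :=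
  (hasDerivWithinAt_radius_of_hasFDerivWithinAt
    (h.differentiableOn hn (t, r) ⟨ht, hr⟩).hasFDerivWithinAt ht).differentiableWithinAt
    |>.hasDerivWithinAt

theorem IsCn.hasDerivAt_dr {n : ℕ} (h : IsCn n I u) (hn : n ≠ 0)
    (ht : t ∈ I) (hr : 0 < r) : HasDerivAt (fun s => u t s) (dr u t r) r :=
  (h.hasDerivWithinAt_dr hn ht hr.le).hasDerivAt (Ici_mem_nhds hr)

/-- The linear form with components `(p, q)`. -/
def lin2 (p q : ℝ) : ℝ × ℝ →L[ℝ] ℝ :=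
  p • ContinuousLinearMap.fst ℝ ℝ ℝ + q • ContinuousLinearMap.snd ℝ ℝ ℝ

theorem lin2_apply (p q : ℝ) (z : ℝ × ℝ) : lin2 p q z = p * z.1 + q * z.2 := by simp [lin2]

theorem eq_lin2 (L : ℝ × ℝ →L[ℝ] ℝ) : L = lin2 (L (1, 0)) (L (0, 1)) := by
  ext <;> simp [lin2]

theorem IsCn.fderivWithin_eq {n : ℕ} (h : IsCn n I u) (hn : n ≠ 0) (hI : UniqueDiffOn ℝ I)
    (ht : t ∈ I) (hr : 0 ≤ r) :
    fderivWithin ℝ (fun q : ℝ × ℝ => u q.1 q.2) (halfStrip I) (t, r)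
      = lin2 (dt I u t r) (dr u t r) := by
  have hd := (h.differentiableOn hn (t, r) ⟨ht, hr⟩).hasFDerivWithinAt
  rw [dt_eq hI ht (hasDerivWithinAt_time_of_hasFDerivWithinAt hd hr),
    dr_eq hr (hasDerivWithinAt_radius_of_hasFDerivWithinAt hd ht)]
  exact eq_lin2 _

theorem IsCn.hasFDerivWithinAt {n : ℕ} (h : IsCn n I u) (hn : n ≠ 0) (hI : UniqueDiffOn ℝ I)
    (ht : t ∈ I) (hr : 0 ≤ r) :
    HasFDerivWithinAt (fun q : ℝ × ℝ => u q.1 q.2) (lin2 (dt I u t r) (dr u t r))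
      (halfStrip I) (t, r) := by
  rw [← h.fderivWithin_eq hn hI ht hr]
  exact (h.differentiableOn hn (t, r) ⟨ht, hr⟩).hasFDerivWithinAt

/-- The source of the `C^1` statements for parametric integrals and of the later gain of a
derivative: it suffices to exhibit the two partial derivatives and their regularity. -/
theorem isCn_succ_of_hasFDerivWithinAt {n : ℕ} (hI : UniqueDiffOn ℝ I) {p q : ℝ → ℝ → ℝ}
    (hp : IsCn n I p) (hq : IsCn n I q)
    (h : ∀ t ∈ I, ∀ r, 0 ≤ r → HasFDerivWithinAt (fun q : ℝ × ℝ => u q.1 q.2)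
      (lin2 (p t r) (q t r)) (halfStrip I) (t, r)) : IsCn (n + 1) I u := by
  have : ContDiffOn ℝ ((n : WithTop ℕ∞) + 1) (fun q : ℝ × ℝ => u q.1 q.2) (halfStrip I) := by
    rw [contDiffOn_succ_iff_hasFDerivWithinAt_of_uniqueDiffOn (halfStrip_uniqueDiffOn hI)]
    refine ⟨by simp, fun z => lin2 (p z.1 z.2) (q z.1 z.2), ?_, fun z hz => h z.1 hz.1 z.2 hz.2⟩
    exact (ContDiffOn.smul hp contDiffOn_const).add (ContDiffOn.smul hq contDiffOn_const)
  exact_mod_cast this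

theorem IsCn.succ_of_partials {n : ℕ} (h : IsCn 1 I u) (hI : UniqueDiffOn ℝ I)
    (ht : IsCn n I (dt I u)) (hr : IsCn n I (dr u)) : IsCn (n + 1) I u :=
  isCn_succ_of_hasFDerivWithinAt hI ht hr
    fun _ h1 _ h2 => h.hasFDerivWithinAt one_ne_zero hI h1 h2

theorem IsCn.partials {n : ℕ} (h : IsCn (n + 1) I u) (hI : UniqueDiffOn ℝ I) :
    IsCn n I (dt I u) ∧ IsCn n I (dr u) := by
  have hd : ContDiffOn ℝ n (fderivWithin ℝ (fun q : ℝ × ℝ => u q.1 q.2) (halfStrip I))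
      (halfStrip I) :=
    ContDiffOn.fderivWithin h (halfStrip_uniqueDiffOn hI) (by norm_cast)
  constructor
  · have := hd.clm_apply (contDiffOn_const (c := ((1 : ℝ), (0 : ℝ))))
    refine ContDiffOn.congr this ?_
    intro z hz
    rw [h.fderivWithin_eq (by omega) hI hz.1 hz.2, lin2_apply]
    simp
  · have := hd.clm_apply (contDiffOn_const (c := ((0 : ℝ), (1 : ℝ))))
    refine ContDiffOn.congr this ?_
    intro z hz
    rw [h.fderivWithin_eq (by omega) hI hz.1 hz.2, lin2_apply]
    simp

theorem IsCn.dt_continuousOn (h : IsCn 1 I u) (hI : UniqueDiffOn ℝ I) :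
    ContinuousOn (fun q : ℝ × ℝ => dt I u q.1 q.2) (halfStrip I) :=
  (IsCn.partials (n := 0) h hI).1.continuousOn

theorem IsCn.dr_continuousOn (h : IsCn 1 I u) (hI : UniqueDiffOn ℝ I) :
    ContinuousOn (fun q : ℝ × ℝ => dr u q.1 q.2) (halfStrip I) :=
  (IsCn.partials (n := 0) h hI).2.continuousOn

theorem IsCn.congr {n : ℕ} (h : IsCn n I u) (hw : ∀ t ∈ I, ∀ r, 0 ≤ r → w t r = u t r) :
    IsCn n I w :=
  ContDiffOn.congr h fun z hz => hw z.1 hz.1 z.2 hz.2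

theorem IsCn.of_le {m n : ℕ} (h : IsCn n I u) (hmn : m ≤ n) : IsCn m I u :=
  ContDiffOn.of_le h (by exact_mod_cast hmn)

theorem isCn_zero_of_continuousOn (h : ContinuousOn (fun q : ℝ × ℝ => u q.1 q.2) (halfStrip I)) :
    IsCn 0 I u := contDiffOn_zero.2 h

theorem IsCn.add {n : ℕ} (h : IsCn n I u) (h' : IsCn n I w) :
    IsCn n I (fun t r => u t r + w t r) := ContDiffOn.add h h'

theorem IsCn.sub {n : ℕ} (h : IsCn n I u) (h' : IsCn n I w) :
    IsCn n I (fun t r => u t r - w t r) := ContDiffOn.sub h h'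

theorem IsCn.mul {n : ℕ} (h : IsCn n I u) (h' : IsCn n I w) :
    IsCn n I (fun t r => u t r * w t r) := ContDiffOn.mul h h'

theorem IsCn.pow {n : ℕ} (h : IsCn n I u) (m : ℕ) :
    IsCn n I (fun t r => u t r ^ m) := ContDiffOn.pow h m

theorem IsCn.inv {n : ℕ} (h : IsCn n I u) (h0 : ∀ t ∈ I, ∀ r, 0 ≤ r → u t r ≠ 0) :
    IsCn n I (fun t r => (u t r)⁻¹) := ContDiffOn.inv h fun z hz => h0 z.1 hz.1 z.2 hz.2

theorem IsCn.sqrt {n : ℕ} (h : IsCn n I u) (h0 : ∀ t ∈ I, ∀ r, 0 ≤ r → u t r ≠ 0) :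
    IsCn n I (fun t r => Real.sqrt (u t r)) := ContDiffOn.sqrt h fun z hz => h0 z.1 hz.1 z.2 hz.2

theorem isCn_const {n : ℕ} (c : ℝ) : IsCn n I (fun _ _ => c) := contDiffOn_const

theorem isCn_radius {n : ℕ} : IsCn n I (fun _ r => r) := contDiffOn_snd

/-- The mixed second derivatives of a `C²` function agree. -/
theorem IsCn.dt_dr_comm (h : IsCn 2 I u) (hI : UniqueDiffOn ℝ I)
    (hcl : I ⊆ closure (interior I)) (ht : t ∈ I) (hr : 0 ≤ r) :
    dt I (dr u) t r = dr (dt I u) t r := by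
  have hU := halfStrip_uniqueDiffOn hI
  obtain ⟨h1, h2⟩ := IsCn.partials (n := 1) h hI
  have hmem : ((t, r) : ℝ × ℝ) ∈ halfStrip I := ⟨ht, hr⟩
  have hsymm : IsSymmSndFDerivWithinAt ℝ (fun q : ℝ × ℝ => u q.1 q.2) (halfStrip I) (t, r) := by
    -- At a boundary point the symmetry is a limit from the interior, so the point has to lie in the
    -- closure of the interior of the domain.
    refine ContDiffWithinAt.isSymmSndFDerivWithinAt (n := 2) (h (t, r) hmem) (by simp) hU ?_ hmem
    rw [halfStrip, interior_prod_eq, closure_prod_eq, interior_Ici, closure_Ioi]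
    exact ⟨hcl ht, hr⟩
  have hd2 : HasFDerivWithinAt (fderivWithin ℝ (fun q : ℝ × ℝ => u q.1 q.2) (halfStrip I))
      (fderivWithin ℝ (fderivWithin ℝ (fun q : ℝ × ℝ => u q.1 q.2) (halfStrip I)) (halfStrip I)
        (t, r)) (halfStrip I) (t, r) := by
    have : ContDiffOn ℝ 1 (fderivWithin ℝ (fun q : ℝ × ℝ => u q.1 q.2) (halfStrip I))
      (halfStrip I) := ContDiffOn.fderivWithin h hU (by norm_num)
    exact (this.differentiableOn one_ne_zero (t, r) hmem).hasFDerivWithinAt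
  set M := fderivWithin ℝ (fderivWithin ℝ (fun q : ℝ × ℝ => u q.1 q.2) (halfStrip I))
    (halfStrip I) (t, r) with hM
  have e1 : dt I (dr u) t r = M (1, 0) (0, 1) := by
    refine dt_eq hI ht ?_
    have := (hd2.clm_apply (hasFDerivWithinAt_const ((0 : ℝ), (1 : ℝ)) _ _))
    have h3 : HasFDerivWithinAt (fun q : ℝ × ℝ => dr u q.1 q.2) _ (halfStrip I) (t, r) :=
      this.congr (fun z hz => by
        show _ = fderivWithin ℝ _ _ (z.1, z.2) _
        rw [h.fderivWithin_eq two_ne_zero hI hz.1 hz.2, lin2_apply]; simp)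
        (by rw [h.fderivWithin_eq two_ne_zero hI ht hr, lin2_apply]; simp)
    convert hasDerivWithinAt_time_of_hasFDerivWithinAt h3 hr using 1
    simp
  have e2 : dr (dt I u) t r = M (0, 1) (1, 0) := by
    refine dr_eq hr ?_
    have := (hd2.clm_apply (hasFDerivWithinAt_const ((1 : ℝ), (0 : ℝ)) _ _))
    have h3 : HasFDerivWithinAt (fun q : ℝ × ℝ => dt I u q.1 q.2) _ (halfStrip I) (t, r) :=
      this.congr (fun z hz => by
        show _ = fderivWithin ℝ _ _ (z.1, z.2) _
        rw [h.fderivWithin_eq two_ne_zero hI hz.1 hz.2, lin2_apply]; simp)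
        (by rw [h.fderivWithin_eq two_ne_zero hI ht hr, lin2_apply]; simp)
    convert hasDerivWithinAt_radius_of_hasFDerivWithinAt h3 ht using 1
    simp
  rw [e1, e2]
  exact hsymm (1, 0) (0, 1)

end TimeRadius

/-! ### The time interval -/

section TimeInterval

variable {T : EReal} {t : ℝ}

theorem timeInterval_ordConnected (T : EReal) : (timeInterval T).OrdConnected := by
  refine ⟨fun x hx y hy z hz => ⟨hx.1.trans hz.1, lt_of_le_of_lt ?_ hy.2⟩⟩
  exact_mod_cast hz.2

theorem timeInterval_convex (T : EReal) : Convex ℝ (timeInterval T) :=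
  (timeInterval_ordConnected T).convex

theorem Icc_subset_timeInterval (ht : t ∈ timeInterval T) : Icc 0 t ⊆ timeInterval T := by
  intro s hs
  refine ⟨hs.1, lt_of_le_of_lt ?_ ht.2⟩
  exact_mod_cast hs.2

/-- Since `T` itself is excluded, there is always room to the right. The compact set `Icc 0 t'` is
then a neighbourhood of `t` within the time interval. -/
theorem exists_lt_mem_timeInterval (ht : t ∈ timeInterval T) : ∃ t' ∈ timeInterval T, t < t' := by
  obtain ⟨s, hs1, hs2⟩ := EReal.lt_iff_exists_real_btwn.1 ht.2
  have : t < s := by exact_mod_cast hs1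
  exact ⟨s, ⟨ht.1.trans this.le, hs2⟩, this⟩

theorem timeInterval_subset_closure_interior (T : EReal) :
    timeInterval T ⊆ closure (interior (timeInterval T)) := by
  intro t ht
  obtain ⟨t', ht', hlt⟩ := exists_lt_mem_timeInterval ht
  have h1 : Ioo t t' ⊆ interior (timeInterval T) := by
    refine interior_maximal ?_ isOpen_Ioo
    intro s hs
    exact Icc_subset_timeInterval ht' ⟨ht.1.trans hs.1.le, hs.2.le⟩
  refine closure_mono h1 ?_
  rw [closure_Ioo hlt.ne]
  exact ⟨le_rfl, hlt.le⟩

theorem timeInterval_uniqueDiffOn (T : EReal) : UniqueDiffOn ℝ (timeInterval T) := by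
  intro t ht
  obtain ⟨t', ht', hlt⟩ := exists_lt_mem_timeInterval ht
  exact uniqueDiffWithinAt_convex (timeInterval_convex T) (by
    refine (nonempty_Ioo.2 hlt).mono (interior_maximal ?_ isOpen_Ioo)
    intro s hs
    exact Icc_subset_timeInterval ht' ⟨ht.1.trans hs.1.le, hs.2.le⟩) (subset_closure ht)

end TimeInterval

/-! ### Rotations -/

section Rotations

theorem exists_isometry_of_matrix (M : Matrix (Fin 3) (Fin 3) ℝ) (hM : M.transpose * M = 1)
    (hdet : M.det = 1) :
    ∃ O : E3 ≃ₗᵢ[ℝ] E3, LinearMap.det (O.toLinearEquiv : E3 →ₗ[ℝ] E3) = 1 ∧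
      ∀ x : E3, O x = WithLp.toLp 2 (M.mulVec x.ofLp) := by
  have hnorm : ∀ x : E3, ‖Matrix.toLpLin 2 2 M x‖ = ‖x‖ := by
    intro x
    have h : ‖Matrix.toLpLin 2 2 M x‖ ^ 2 = ‖x‖ ^ 2 := by
      rw [← real_inner_self_eq_norm_sq, ← real_inner_self_eq_norm_sq,
        EuclideanSpace.inner_eq_star_dotProduct, EuclideanSpace.inner_eq_star_dotProduct]
      simp only [Matrix.ofLp_toLpLin, Matrix.toLin'_apply, star_trivial]
      rw [Matrix.dotProduct_mulVec, Matrix.vecMul_mulVec, hM, Matrix.vecMul_one]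
    exact (pow_left_inj₀ (norm_nonneg _) (norm_nonneg _) two_ne_zero).1 h
  let O₁ : E3 →ₗᵢ[ℝ] E3 := ⟨Matrix.toLpLin 2 2 M, hnorm⟩
  refine ⟨O₁.toLinearIsometryEquiv rfl, ?_, fun x => rfl⟩
  have : (((O₁.toLinearIsometryEquiv rfl).toLinearEquiv : E3 ≃ₗ[ℝ] E3) : E3 →ₗ[ℝ] E3)
      = Matrix.toLpLin 2 2 M := by
    ext x i; rfl
  rw [this, Matrix.toLpLin_eq_toLin, LinearMap.det_toLin, hdet]

/-- The standard basis of `ℝ³`; the unit vector `e` is `bas 0`. -/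
def bas (i : Fin 3) : E3 := EuclideanSpace.single i 1

theorem bas_apply (i k : Fin 3) : bas i k = if k = i then 1 else 0 := by
  simp [bas]

theorem e_eq_bas : e = bas 0 := rfl

theorem norm_e : ‖e‖ = 1 := by simp [e]

theorem inner_e (v : E3) : inner ℝ e v = v 0 := by simp [e, EuclideanSpace.inner_single_left]

theorem norm_smul_e {r : ℝ} (hr : 0 ≤ r) : ‖r • e‖ = r := by
  rw [norm_smul, norm_e, mul_one, Real.norm_of_nonneg hr]

theorem SphericallySymmetric.apply_matrix {h : E3 → E3 → ℝ} (hh : SphericallySymmetric h)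
    (M : Matrix (Fin 3) (Fin 3) ℝ) (hM : M.transpose * M = 1) (hdet : M.det = 1) (x v : E3) :
    h (WithLp.toLp 2 (M.mulVec x.ofLp)) (WithLp.toLp 2 (M.mulVec v.ofLp)) = h x v := by
  obtain ⟨O, hO, hOx⟩ := exists_isometry_of_matrix M hM hdet
  rw [← hOx, ← hOx]
  exact hh O hO x v

/-- The rotation by the angle `θ` from the first towards the second axis. -/
def rotA (θ : ℝ) : Matrix (Fin 3) (Fin 3) ℝ :=
  !![Real.cos θ, -Real.sin θ, 0; Real.sin θ, Real.cos θ, 0; 0, 0, 1]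

/-- The rotation by the angle `θ` from the first towards the third axis. -/
def rotB (θ : ℝ) : Matrix (Fin 3) (Fin 3) ℝ :=
  !![Real.cos θ, 0, -Real.sin θ; 0, 1, 0; Real.sin θ, 0, Real.cos θ]

theorem rotA_orthogonal (θ : ℝ) : (rotA θ).transpose * rotA θ = 1 := by
  have := Real.sin_sq_add_cos_sq θ
  ext i k
  fin_cases i <;> fin_cases k <;>
    simp [rotA, Matrix.mul_apply, Fin.sum_univ_three] <;> linarith

theorem rotB_orthogonal (θ : ℝ) : (rotB θ).transpose * rotB θ = 1 := by
  have := Real.sin_sq_add_cos_sq θ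
  ext i k
  fin_cases i <;> fin_cases k <;>
    simp [rotB, Matrix.mul_apply, Fin.sum_univ_three] <;> linarith

theorem rotA_det (θ : ℝ) : (rotA θ).det = 1 := by
  have := Real.sin_sq_add_cos_sq θ
  simp [rotA, Matrix.det_fin_three]; linarith

theorem rotB_det (θ : ℝ) : (rotB θ).det = 1 := by
  have := Real.sin_sq_add_cos_sq θ
  simp [rotB, Matrix.det_fin_three]; linarith

theorem hasDerivAt_rotA (x : E3) :
    HasDerivAt (fun θ => (WithLp.toLp 2 ((rotA θ).mulVec x.ofLp) : E3))
      (x 0 • bas 1 - x 1 • bas 0) 0 := by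
  have h : (fun θ => (WithLp.toLp 2 ((rotA θ).mulVec x.ofLp) : E3)) = fun θ =>
      Real.cos θ • (x 0 • bas 0 + x 1 • bas 1) + Real.sin θ • (x 0 • bas 1 - x 1 • bas 0)
        + x 2 • bas 2 := by
    funext θ
    ext k
    fin_cases k <;>
      (simp [rotA, Matrix.mulVec, dotProduct, Fin.sum_univ_three, bas_apply]; try ring)
  rw [h]
  simpa using (((Real.hasDerivAt_cos 0).smul_const (x 0 • bas 0 + x 1 • bas 1)).add
    ((Real.hasDerivAt_sin 0).smul_const (x 0 • bas 1 - x 1 • bas 0))).add_const (x 2 • bas 2)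

theorem hasDerivAt_rotB (x : E3) :
    HasDerivAt (fun θ => (WithLp.toLp 2 ((rotB θ).mulVec x.ofLp) : E3))
      (x 0 • bas 2 - x 2 • bas 0) 0 := by
  have h : (fun θ => (WithLp.toLp 2 ((rotB θ).mulVec x.ofLp) : E3)) = fun θ =>
      Real.cos θ • (x 0 • bas 0 + x 2 • bas 2) + Real.sin θ • (x 0 • bas 2 - x 2 • bas 0)
        + x 1 • bas 1 := by
    funext θ
    ext k
    fin_cases k <;>
      (simp [rotB, Matrix.mulVec, dotProduct, Fin.sum_univ_three, bas_apply]; try ring)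
  rw [h]
  simpa using (((Real.hasDerivAt_cos 0).smul_const (x 0 • bas 0 + x 2 • bas 2)).add
    ((Real.hasDerivAt_sin 0).smul_const (x 0 • bas 2 - x 2 • bas 0))).add_const (x 1 • bas 1)

theorem rotA_zero : rotA 0 = 1 := by
  ext i k; fin_cases i <;> fin_cases k <;> simp [rotA]

theorem rotB_zero : rotB 0 = 1 := by
  ext i k; fin_cases i <;> fin_cases k <;> simp [rotB]

end Rotations

/-! ### The derivative of the density -/

section Density

variable {T : EReal} {f : ℝ → E3 → E3 → ℝ} {t r : ℝ} {x v : E3}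

/-- The total derivative of `f` on `I × ℝ⁶`. -/
def totalD (I : Set ℝ) (f : ℝ → E3 → E3 → ℝ) (t : ℝ) (x v : E3) : ℝ × E3 × E3 →L[ℝ] ℝ :=
  fderivWithin ℝ (fun q : ℝ × E3 × E3 => f q.1 q.2.1 q.2.2) (I ×ˢ univ) (t, x, v)

theorem RegularDensity.hasFDerivWithinAt {I : Set ℝ} (hf : RegularDensity I f) (ht : t ∈ I)
    (x v : E3) :
    HasFDerivWithinAt (fun q : ℝ × E3 × E3 => f q.1 q.2.1 q.2.2) (totalD I f t x v)
      (I ×ˢ univ) (t, x, v) :=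
  (hf.contDiff.differentiableOn one_ne_zero _ ⟨ht, mem_univ _⟩).hasFDerivWithinAt

theorem RegularDensity.continuousOn_totalD {I : Set ℝ} (hI : UniqueDiffOn ℝ I)
    (hf : RegularDensity I f) :
    ContinuousOn (fun q : ℝ × E3 × E3 => totalD I f q.1 q.2.1 q.2.2) (I ×ˢ univ) :=
  hf.contDiff.continuousOn_fderivWithin (hI.prod uniqueDiffOn_univ) le_rfl

theorem RegularDensity.hasDerivWithinAt_time {I : Set ℝ} (hf : RegularDensity I f) (ht : t ∈ I)
    (x v : E3) :
    HasDerivWithinAt (fun s => f s x v) (totalD I f t x v (1, 0, 0)) I t := by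
  have := (hf.hasFDerivWithinAt ht x v).comp_hasDerivWithinAt (f := fun s : ℝ => (s, x, v))
    (f' := (1, 0, 0)) (s := I) t
    ((hasDerivWithinAt_id t I).prodMk (hasDerivWithinAt_const t I (x, v)))
    (fun s hs => ⟨hs, mem_univ _⟩)
  exact this

theorem RegularDensity.hasFDerivAt_phase {I : Set ℝ} (hf : RegularDensity I f) (ht : t ∈ I)
    (x v : E3) :
    HasFDerivAt (fun z : E3 × E3 => f t z.1 z.2)
      ((totalD I f t x v).comp (ContinuousLinearMap.inr ℝ ℝ (E3 × E3))) (x, v) := by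
  rw [← hasFDerivWithinAt_univ]
  have h1 : HasFDerivWithinAt (fun z : E3 × E3 => ((t, z) : ℝ × E3 × E3))
      (ContinuousLinearMap.inr ℝ ℝ (E3 × E3)) univ (x, v) :=
    (hasFDerivAt_prodMk_right t (x, v)).hasFDerivWithinAt
  exact (hf.hasFDerivWithinAt ht x v).comp (x, v) h1 (fun z _ => ⟨ht, mem_univ _⟩)

theorem RegularDensity.hasFDerivAt_position {I : Set ℝ} (hf : RegularDensity I f) (ht : t ∈ I)
    (x v : E3) :
    HasFDerivAt (fun y => f t y v)
      (((totalD I f t x v).comp (ContinuousLinearMap.inr ℝ ℝ (E3 × E3))).comp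
        (ContinuousLinearMap.inl ℝ E3 E3)) x :=
  HasFDerivAt.comp (f := fun y : E3 => (y, v)) (g := fun z : E3 × E3 => f t z.1 z.2) x
    (hf.hasFDerivAt_phase ht x v) (hasFDerivAt_prodMk_left x v)

theorem RegularDensity.hasFDerivAt_momentum {I : Set ℝ} (hf : RegularDensity I f) (ht : t ∈ I)
    (x v : E3) :
    HasFDerivAt (fun w => f t x w)
      (((totalD I f t x v).comp (ContinuousLinearMap.inr ℝ ℝ (E3 × E3))).comp
        (ContinuousLinearMap.inr ℝ E3 E3)) v :=
  HasFDerivAt.comp (f := fun w : E3 => (x, w)) (g := fun z : E3 × E3 => f t z.1 z.2) v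
    (hf.hasFDerivAt_phase ht x v) (hasFDerivAt_prodMk_right x v)

/-- All derivatives in the Vlasov equation become values of one linear form, so that the equation
can be rearranged by linearity in the direction. -/
theorem RegularDensity.transport_eq {I : Set ℝ} (hI : UniqueDiffOn ℝ I) (hf : RegularDensity I f)
    (ht : t ∈ I) (x v X V : E3) :
    transport I f X V t x v = totalD I f t x v (1, 0, 0) + totalD I f t x v (0, X, 0)
      + totalD I f t x v (0, 0, V) := by
  rw [transport, (hf.hasDerivWithinAt_time ht x v).derivWithin (hI t ht),
    (hf.hasFDerivAt_position ht x v).fderiv, (hf.hasFDerivAt_momentum ht x v).fderiv]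
  rfl

/-- By symmetry `f t` is constant along the orbit of `(x, v)` under the curve of rotations, so its
derivative vanishes in the direction of the infinitesimal rotation. -/
theorem RegularDensity.rotation_deriv {I : Set ℝ} (hf : RegularDensity I f) (ht : t ∈ I)
    {M : ℝ → Matrix (Fin 3) (Fin 3) ℝ} (hM : ∀ θ, (M θ).transpose * M θ = 1)
    (hdet : ∀ θ, (M θ).det = 1) (hM0 : M 0 = 1) {x' v' : E3}
    (hx : HasDerivAt (fun θ => (WithLp.toLp 2 ((M θ).mulVec x.ofLp) : E3)) x' 0)
    (hv : HasDerivAt (fun θ => (WithLp.toLp 2 ((M θ).mulVec v.ofLp) : E3)) v' 0) :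
    totalD I f t x v (0, x', v') = 0 := by
  have h0 : ∀ y : E3, (WithLp.toLp 2 ((M 0).mulVec y.ofLp) : E3) = y := by
    intro y; rw [hM0, Matrix.one_mulVec]
  have h1 := (hf.hasFDerivAt_phase ht x v)
  have hc : HasDerivAt (fun θ => ((WithLp.toLp 2 ((M θ).mulVec x.ofLp) : E3),
      (WithLp.toLp 2 ((M θ).mulVec v.ofLp) : E3))) (x', v') 0 := hx.prodMk hv
  have h2 := HasFDerivAt.comp_hasDerivAt (x := (0 : ℝ))
    (l := fun z : E3 × E3 => f t z.1 z.2) (f := fun θ =>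
      ((WithLp.toLp 2 ((M θ).mulVec x.ofLp) : E3), (WithLp.toLp 2 ((M θ).mulVec v.ofLp) : E3)))
    (l' := (totalD I f t x v).comp (ContinuousLinearMap.inr ℝ ℝ (E3 × E3)))
    (by simpa only [h0] using h1) hc
  have h3 : ((fun z : E3 × E3 => f t z.1 z.2) ∘ fun θ =>
      ((WithLp.toLp 2 ((M θ).mulVec x.ofLp) : E3), (WithLp.toLp 2 ((M θ).mulVec v.ofLp) : E3)))
      = fun _ => f t x v := by
    funext θ
    exact (hf.symmetric t ht).apply_matrix (M θ) (hM θ) (hdet θ) x v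
  rw [h3] at h2
  exact h2.unique (hasDerivAt_const _ _)

/-- Symmetry expresses the tangential position derivatives on the axis through momentum
derivatives. -/
theorem RegularDensity.tangential_deriv {I : Set ℝ} (hf : RegularDensity I f) (ht : t ∈ I)
    {i : Fin 3} (hi : i ≠ 0) (r : ℝ) (v : E3) :
    r * totalD I f t (r • e) v (0, bas i, 0)
      = v i * totalD I f t (r • e) v (0, 0, bas 0) - v 0 * totalD I f t (r • e) v (0, 0, bas i) := by
  have key : totalD I f t (r • e) v (0, r • bas i, v 0 • bas i - v i • bas 0) = 0 := by
    fin_cases i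
    · exact absurd rfl hi
    · have := hf.rotation_deriv ht rotA_orthogonal rotA_det rotA_zero (hasDerivAt_rotA (r • e))
        (hasDerivAt_rotA v)
      simpa [e_eq_bas, bas_apply] using this
    · have := hf.rotation_deriv ht rotB_orthogonal rotB_det rotB_zero (hasDerivAt_rotB (r • e))
        (hasDerivAt_rotB v)
      simpa [e_eq_bas, bas_apply] using this
  have hsplit : ((0, r • bas i, v 0 • bas i - v i • bas 0) : ℝ × E3 × E3)
      = r • (0, bas i, 0) + (v 0 • (0, 0, bas i) - v i • (0, 0, bas 0)) := by
    ext <;> simp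
  rw [hsplit, map_add, map_sub, map_smul, map_smul, map_smul] at key
  simp only [smul_eq_mul] at key
  linarith

/-- The support bound is taken up to a time beyond `t`, so that it also controls derivatives at time
`t`. -/
theorem RegularDensity.exists_bound (hf : RegularDensity (timeInterval T) f)
    (ht : t ∈ timeInterval T) :
    ∃ t' ∈ timeInterval T, t < t' ∧ ∃ C : ℝ, ∀ s ∈ Icc 0 t', ∀ x v, f s x v ≠ 0 →
      ‖x‖ ≤ C ∧ ‖v‖ ≤ C := by
  obtain ⟨t', ht', hlt⟩ := exists_lt_mem_timeInterval ht
  obtain ⟨C, hC⟩ := hf.support (Icc 0 t') (Icc_subset_timeInterval ht') isCompact_Icc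
  exact ⟨t', ht', hlt, C, hC⟩

/-- As `t < t'` and `C < ‖v‖` are open conditions, `f` vanishes near `(t, x, v)` within the domain,
and with it the time derivative too. -/
theorem totalD_eq_zero (ht : t ∈ timeInterval T) {t' C : ℝ} (htt' : t < t')
    (hC : ∀ s ∈ Icc 0 t', ∀ x v, f s x v ≠ 0 → ‖x‖ ≤ C ∧ ‖v‖ ≤ C) (hv : C < ‖v‖) :
    totalD (timeInterval T) f t x v = 0 := by
  have hev : (fun q : ℝ × E3 × E3 => f q.1 q.2.1 q.2.2)
      =ᶠ[𝓝[timeInterval T ×ˢ univ] (t, x, v)] fun _ => 0 := by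
    have h1 : ∀ᶠ q : ℝ × E3 × E3 in 𝓝 (t, x, v), q.1 < t' ∧ C < ‖q.2.2‖ := by
      refine (Filter.Eventually.and ?_ ?_)
      · exact continuous_fst.continuousAt.eventually_lt continuousAt_const htt'
      · exact continuousAt_const.eventually_lt (by fun_prop) hv
    filter_upwards [self_mem_nhdsWithin, mem_nhdsWithin_of_mem_nhds h1] with q hq hq'
    by_contra hne
    exact absurd (hC q.1 ⟨hq.1.1, hq'.1.le⟩ _ _ hne).2 (not_le.2 hq'.2)
  rw [totalD, hev.fderivWithin_eq (hev.self_of_nhdsWithin ⟨ht, mem_univ _⟩)]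
  simp

theorem RegularDensity.continuous_momentum {I : Set ℝ} (hf : RegularDensity I f)
    (ht : t ∈ I) (x : E3) : Continuous (fun v => f t x v) :=
  continuous_iff_continuousAt.2 fun v => (hf.hasFDerivAt_momentum ht x v).continuousAt

theorem RegularDensity.continuous_totalD_momentum (hf : RegularDensity (timeInterval T) f)
    (ht : t ∈ timeInterval T) (x : E3) (w : ℝ × E3 × E3) :
    Continuous (fun v => totalD (timeInterval T) f t x v w) := by
  have h := (hf.continuousOn_totalD (timeInterval_uniqueDiffOn T)).comp_continuous
    (f := fun v : E3 => (t, x, v)) (by fun_prop) (fun v => ⟨ht, mem_univ _⟩)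
  exact h.clm_apply continuous_const

theorem RegularDensity.hasCompactSupport_momentum (hf : RegularDensity (timeInterval T) f)
    (ht : t ∈ timeInterval T) (x : E3) : HasCompactSupport (fun v => f t x v) := by
  obtain ⟨t', -, hlt, C, hC⟩ := hf.exists_bound ht
  refine HasCompactSupport.intro (isCompact_closedBall (0 : E3) C) fun v hv => ?_
  by_contra hne
  exact hv (by simpa using (hC t ⟨ht.1, hlt.le⟩ _ _ hne).2)

theorem RegularDensity.hasCompactSupport_totalD (hf : RegularDensity (timeInterval T) f)
    (ht : t ∈ timeInterval T) (x : E3) (w : ℝ × E3 × E3) :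
    HasCompactSupport (fun v => totalD (timeInterval T) f t x v w) := by
  obtain ⟨t', -, hlt, C, hC⟩ := hf.exists_bound ht
  refine HasCompactSupport.intro (isCompact_closedBall (0 : E3) C) fun v hv => ?_
  rw [totalD_eq_zero ht hlt hC (by simpa using hv)]
  rfl

theorem RegularDensity.integrable_mul (hf : RegularDensity (timeInterval T) f)
    (ht : t ∈ timeInterval T) (x : E3) {φ : E3 → ℝ} (hφ : Continuous φ) :
    Integrable (fun v => φ v * f t x v) :=
  (hφ.mul (hf.continuous_momentum ht x)).integrable_of_hasCompactSupport
    (hf.hasCompactSupport_momentum ht x).mul_left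

theorem RegularDensity.integrable_mul_totalD (hf : RegularDensity (timeInterval T) f)
    (ht : t ∈ timeInterval T) (x : E3) (w : ℝ × E3 × E3) {φ : E3 → ℝ} (hφ : Continuous φ) :
    Integrable (fun v => φ v * totalD (timeInterval T) f t x v w) :=
  (hφ.mul (hf.continuous_totalD_momentum ht x w)).integrable_of_hasCompactSupport
    (hf.hasCompactSupport_totalD ht x w).mul_left

/-- Integration by parts in the momentum variable. -/
theorem RegularDensity.integral_mul_momentum_deriv (hf : RegularDensity (timeInterval T) f)
    (ht : t ∈ timeInterval T) (x : E3) (w : E3) {φ φ' : E3 → ℝ} (hφ : Continuous φ)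
    (hφ' : Continuous φ') (hd : ∀ v, HasLineDerivAt ℝ φ (φ' v) v w) :
    ∫ v, φ v * totalD (timeInterval T) f t x v (0, 0, w) = -∫ v, φ' v * f t x v := by
  have := integral_bilinear_hasLineDerivAt_right_eq_neg_left_of_integrable
    (μ := (volume : Measure E3)) (f := φ) (f' := φ') (g := fun v => f t x v)
    (g' := fun v => totalD (timeInterval T) f t x v (0, 0, w)) (v := w)
    (B := ContinuousLinearMap.mul ℝ ℝ)
    (hf.integrable_mul ht x hφ') (hf.integrable_mul_totalD ht x _ hφ) (hf.integrable_mul ht x hφ)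
    (fun v _ => hd v) (fun v _ => (hf.hasFDerivAt_momentum ht x v).hasLineDerivAt w)
  simpa using this

end Density

/-! ### Velocity moments -/

section Moments

variable {T : EReal} {f : ℝ → E3 → E3 → ℝ} {t r : ℝ} {φ : E3 → ℝ}

/-- The moment `∫ φ(v) f(t, r e, v) dv`. -/
def moment (f : ℝ → E3 → E3 → ℝ) (φ : E3 → ℝ) (t r : ℝ) : ℝ := ∫ v : E3, φ v * f t (r • e) v

/-- The moment `∫ φ(v) Df(t, r e, v)·w dv` of a directional derivative of `f`. -/
def momentD (I : Set ℝ) (f : ℝ → E3 → E3 → ℝ) (w : ℝ × E3 × E3) (φ : E3 → ℝ) (t r : ℝ) : ℝ :=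
  ∫ v : E3, φ v * totalD I f t (r • e) v w

/-- The embedding `(s, ρ) ↦ (s, ρ e, 0)`. -/
def axisEmb : ℝ × ℝ →L[ℝ] ℝ × E3 × E3 :=
  (ContinuousLinearMap.fst ℝ ℝ ℝ).prod
    (((ContinuousLinearMap.snd ℝ ℝ ℝ).smulRight e).prod 0)

theorem axisEmb_apply (q : ℝ × ℝ) : axisEmb q = (q.1, q.2 • e, 0) := rfl

theorem RegularDensity.hasFDerivWithinAt_axis {I : Set ℝ} (hf : RegularDensity I f) {q : ℝ × ℝ}
    (ht : q.1 ∈ I) (v : E3) :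
    HasFDerivWithinAt (fun q : ℝ × ℝ => f q.1 (q.2 • e) v)
      ((totalD I f q.1 (q.2 • e) v).comp axisEmb) (halfStrip I) q := by
  have h1 : HasFDerivWithinAt (fun q : ℝ × ℝ => ((q.1, q.2 • e, v) : ℝ × E3 × E3)) axisEmb
      (halfStrip I) q := by
    have : (fun q : ℝ × ℝ => ((q.1, q.2 • e, v) : ℝ × E3 × E3))
        = fun q => axisEmb q + (0, 0, v) := by
      funext q; simp [axisEmb_apply]
    rw [this]
    exact axisEmb.hasFDerivWithinAt.add_const _
  have hmaps : MapsTo (fun q : ℝ × ℝ => ((q.1, q.2 • e, v) : ℝ × E3 × E3)) (halfStrip I)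
      (I ×ˢ univ) := fun z hz => ⟨hz.1, mem_univ _⟩
  exact HasFDerivWithinAt.comp (g := fun q : ℝ × E3 × E3 => f q.1 q.2.1 q.2.2) q
    (hf.hasFDerivWithinAt ht (q.2 • e) v) h1 hmaps

/-- For times in a neighbourhood of `t` the integrands live on one fixed ball of momenta, so the
compact parametric lemmas apply. Both moments of `f` and moments of its derivatives are unchanged by
the restriction to that ball. -/
theorem RegularDensity.moment_regularity (hf : RegularDensity (timeInterval T) f)
    (hφ : Continuous φ) (ht : t ∈ timeInterval T) (hr : 0 ≤ r) :
    HasFDerivWithinAt (fun q : ℝ × ℝ => moment f φ q.1 q.2)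
      (lin2 (momentD (timeInterval T) f (1, 0, 0) φ t r)
        (momentD (timeInterval T) f (0, e, 0) φ t r)) (halfStrip (timeInterval T)) (t, r) ∧
    ∀ w, ContinuousWithinAt (fun q : ℝ × ℝ => momentD (timeInterval T) f w φ q.1 q.2)
      (halfStrip (timeInterval T)) (t, r) := by
  obtain ⟨t', ht', hlt, C, hC⟩ := hf.exists_bound ht
  set I := timeInterval T with hIdef
  set k : Set E3 := Metric.closedBall 0 C with hk
  -- The time `t'` is left out: at each time of `S` the support bound holds a little longer, as
  -- `totalD_eq_zero` requires.
  set S : Set (ℝ × ℝ) := (Ico 0 t') ×ˢ Ici 0 with hS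
  have hsub : S ⊆ halfStrip I := prod_mono (fun s hs => Icc_subset_timeInterval ht'
    ⟨hs.1, hs.2.le⟩) subset_rfl
  have hSn : S ∈ 𝓝[halfStrip I] (t, r) := by
    have h1 : ∀ᶠ q : ℝ × ℝ in 𝓝 (t, r), q.1 < t' :=
      continuous_fst.continuousAt.eventually_lt continuousAt_const hlt
    filter_upwards [self_mem_nhdsWithin, mem_nhdsWithin_of_mem_nhds h1] with q hq hq'
    exact ⟨⟨hq.1.1, hq'⟩, hq.2⟩
  have hmem : ((t, r) : ℝ × ℝ) ∈ S := ⟨⟨ht.1, hlt⟩, hr⟩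
  have hconv : Convex ℝ S := (convex_Ico 0 t').prod (convex_Ici 0)
  have hkc : IsCompact k := isCompact_closedBall 0 C
  have hcont : ContinuousOn (fun z : (ℝ × ℝ) × E3 => totalD I f z.1.1 (z.1.2 • e) z.2)
      (S ×ˢ k) :=
    (hf.continuousOn_totalD (timeInterval_uniqueDiffOn T)).comp
      (f := fun z : (ℝ × ℝ) × E3 => (z.1.1, z.1.2 • e, z.2)) (by fun_prop)
      (fun z hz => ⟨(hsub hz.1).1, mem_univ _⟩)
  have hcontf : ContinuousOn (fun z : (ℝ × ℝ) × E3 => f z.1.1 (z.1.2 • e) z.2) (S ×ˢ k) :=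
    hf.contDiff.continuousOn.comp
      (f := fun z : (ℝ × ℝ) × E3 => (z.1.1, z.1.2 • e, z.2)) (by fun_prop)
      (fun z hz => ⟨(hsub hz.1).1, mem_univ _⟩)
  have hφ2 : ContinuousOn (fun z : (ℝ × ℝ) × E3 => φ z.2) (S ×ˢ k) :=
    (hφ.comp continuous_snd).continuousOn
  have hset : ∀ q ∈ S, ∀ w, ∫ v in k, φ v * totalD I f q.1 (q.2 • e) v w
      = momentD I f w φ q.1 q.2 := by
    intro q hq w
    refine setIntegral_eq_integral_of_forall_compl_eq_zero fun v hv => ?_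
    rw [totalD_eq_zero (hsub hq).1 hq.1.2 hC (by simpa [hk] using hv)]
    simp
  have hset0 : ∀ q ∈ S, ∫ v in k, φ v * f q.1 (q.2 • e) v = moment f φ q.1 q.2 := by
    intro q hq
    refine setIntegral_eq_integral_of_forall_compl_eq_zero fun v hv => ?_
    by_contra hne
    exact hv (by simpa [hk] using (hC q.1 ⟨hq.1.1, hq.1.2.le⟩ _ _ (right_ne_zero_of_mul hne)).2)
  constructor
  · have hF' : ContinuousOn (Function.uncurry fun (q : ℝ × ℝ) (v : E3) =>
        φ v • (totalD I f q.1 (q.2 • e) v).comp axisEmb) (S ×ˢ k) :=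
      hφ2.smul (hcont.clm_comp continuousOn_const)
    have hmain := hasFDerivWithinAt_setIntegral_of_isCompact (μ := (volume : Measure E3)) hconv hkc
      (F := fun (q : ℝ × ℝ) (v : E3) => φ v * f q.1 (q.2 • e) v)
      (F' := fun (q : ℝ × ℝ) (v : E3) => φ v • (totalD I f q.1 (q.2 • e) v).comp axisEmb)
      (hφ2.mul hcontf) hF'
      (fun q hq v _ => ((hf.hasFDerivWithinAt_axis (hsub hq).1 v).mono hsub).const_mul (φ v)) hmem
    have hint : IntegrableOn (fun v => φ v • (totalD I f t (r • e) v).comp axisEmb) k :=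
      (continuousOn_section hF' hmem).integrableOn_compact hkc
    rw [eq_lin2 (∫ v in k, _)] at hmain
    rw [ContinuousLinearMap.integral_apply hint, ContinuousLinearMap.integral_apply hint] at hmain
    simp only [smul_apply, ContinuousLinearMap.comp_apply, axisEmb_apply,
      smul_eq_mul, zero_smul, one_smul] at hmain
    rw [hset (t, r) hmem, hset (t, r) hmem] at hmain
    exact ((hmain.congr (fun q hq => (hset0 q hq).symm) (hset0 _ hmem).symm).mono_of_mem_nhdsWithin
      hSn)
  · intro w
    have h1 := continuousOn_setIntegral_of_isCompact (μ := (volume : Measure E3)) hkc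
      (F := fun (q : ℝ × ℝ) (v : E3) => φ v * totalD I f q.1 (q.2 • e) v w) (S := S)
      (hφ2.mul (hcont.clm_apply continuousOn_const))
    have h2 := (h1 (t, r) hmem).congr (fun q hq => (hset q hq w).symm) (hset _ hmem w).symm
    exact h2.mono_of_mem_nhdsWithin hSn

theorem RegularDensity.isCn_moment (hf : RegularDensity (timeInterval T) f) (hφ : Continuous φ) :
    IsCn 1 (timeInterval T) (moment f φ) :=
  isCn_succ_of_hasFDerivWithinAt (n := 0) (timeInterval_uniqueDiffOn T)
    (isCn_zero_of_continuousOn fun _ hq => (hf.moment_regularity hφ hq.1 hq.2).2 _)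
    (isCn_zero_of_continuousOn fun _ hq => (hf.moment_regularity hφ hq.1 hq.2).2 _)
    fun _ ht _ hr => (hf.moment_regularity hφ ht hr).1

theorem RegularDensity.dt_moment (hf : RegularDensity (timeInterval T) f) (hφ : Continuous φ)
    (ht : t ∈ timeInterval T) (hr : 0 ≤ r) :
    dt (timeInterval T) (moment f φ) t r = momentD (timeInterval T) f (1, 0, 0) φ t r := by
  rw [dt_eq (timeInterval_uniqueDiffOn T) ht (hasDerivWithinAt_time_of_hasFDerivWithinAt
    (hf.moment_regularity hφ ht hr).1 hr), lin2_apply]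
  simp

theorem RegularDensity.dr_moment (hf : RegularDensity (timeInterval T) f) (hφ : Continuous φ)
    (ht : t ∈ timeInterval T) (hr : 0 ≤ r) :
    dr (moment f φ) t r = momentD (timeInterval T) f (0, e, 0) φ t r := by
  rw [dr_eq hr (hasDerivWithinAt_radius_of_hasFDerivWithinAt
    (hf.moment_regularity hφ ht hr).1 ht), lin2_apply]
  simp

/-! ### The matter terms as moments -/

theorem jap_sq (v : E3) : jap v ^ 2 = 1 + (v 0 ^ 2 + v 1 ^ 2 + v 2 ^ 2) := by
  rw [jap, Real.sq_sqrt (by positivity), EuclideanSpace.norm_sq_eq, Fin.sum_univ_three]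
  simp

theorem jap_pos (v : E3) : 0 < jap v := Real.sqrt_pos.2 (by positivity)

theorem continuous_jap : Continuous jap := by unfold jap; fun_prop

/-- The sum of the two tangential pressures. -/
def presTan (f : ℝ → E3 → E3 → ℝ) (t r : ℝ) : ℝ :=
  moment f (fun v => (v 1 ^ 2 + v 2 ^ 2) / jap v) t r

theorem rho_eq_moment (f : ℝ → E3 → E3 → ℝ) : rho f = moment f jap := rfl

theorem curr_eq_moment (f : ℝ → E3 → E3 → ℝ) : curr f = moment f (fun v => v 0) := by
  funext t r; simp only [curr, moment, inner_e]

theorem pres_eq_moment (f : ℝ → E3 → E3 → ℝ) :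
    pres f = moment f (fun v => v 0 ^ 2 / jap v) := by
  funext t r
  simp only [pres, moment, inner_e]
  congr 1
  funext v
  ring

theorem continuous_div_jap {ψ : E3 → ℝ} (hψ : Continuous ψ) : Continuous (fun v => ψ v / jap v) :=
  hψ.div continuous_jap fun v => (jap_pos v).ne'

theorem RegularDensity.isCn_rho (hf : RegularDensity (timeInterval T) f) :
    IsCn 1 (timeInterval T) (rho f) := hf.isCn_moment continuous_jap

theorem RegularDensity.isCn_curr (hf : RegularDensity (timeInterval T) f) :
    IsCn 1 (timeInterval T) (curr f) := by
  rw [curr_eq_moment]; exact hf.isCn_moment (by fun_prop)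

theorem RegularDensity.isCn_pres (hf : RegularDensity (timeInterval T) f) :
    IsCn 1 (timeInterval T) (pres f) := by
  rw [pres_eq_moment]; exact hf.isCn_moment (continuous_div_jap (by fun_prop))

/-! ### Line derivatives along the coordinate axes -/

theorem hasDerivAt_coord (v : E3) (i k : Fin 3) :
    HasDerivAt (fun s : ℝ => (v + s • bas i) k) (if k = i then 1 else 0) 0 := by
  have : (fun s : ℝ => (v + s • bas i) k) = fun s => v k + s * (if k = i then 1 else 0) := by
    funext s; simp [bas_apply]
  rw [this]
  simpa using ((hasDerivAt_id (0 : ℝ)).mul_const (if k = i then (1 : ℝ) else 0)).const_add (v k)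

theorem hasDerivAt_jap (v : E3) (i : Fin 3) :
    HasDerivAt (fun s : ℝ => jap (v + s • bas i)) (v i / jap v) 0 := by
  have h : (fun s : ℝ => jap (v + s • bas i)) = fun s => Real.sqrt (1 + ((v + s • bas i) 0 ^ 2
      + (v + s • bas i) 1 ^ 2 + (v + s • bas i) 2 ^ 2)) := by
    funext s
    rw [← jap_sq, Real.sqrt_sq (jap_pos _).le]
  have hpos : 1 + ((v + (0 : ℝ) • bas i) 0 ^ 2
      + (v + (0 : ℝ) • bas i) 1 ^ 2 + (v + (0 : ℝ) • bas i) 2 ^ 2) ≠ 0 := by positivity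
  have hd := ((((hasDerivAt_coord v i 0).pow 2).add ((hasDerivAt_coord v i 1).pow 2)).add
    ((hasDerivAt_coord v i 2).pow 2)).const_add 1
  have h2 := hd.sqrt hpos
  rw [h]
  refine h2.congr_deriv ?_
  have h0 : v + (0 : ℝ) • bas i = v := by simp
  simp only [Pi.add_apply, Pi.pow_apply, h0]
  rw [← jap_sq, Real.sqrt_sq (jap_pos _).le]
  fin_cases i <;> simp <;> field_simp

end Moments

/-! ### Moment equations -/

section MomentEquations

variable {T : EReal} {f : ℝ → E3 → E3 → ℝ} {a β : ℝ → ℝ → ℝ} {t r : ℝ}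

/-- The reduced Vlasov equation on the axis, where all position derivatives but the radial one
have been replaced by momentum derivatives. -/
theorem vlasov_on_axis (hf : RegularDensity (timeInterval T) f) (ha : RegularA (timeInterval T) a)
    (hV : ReducedVlasov (timeInterval T) f a β) (ht : t ∈ timeInterval T) (hr : 0 < r) (v : E3) :
    totalD (timeInterval T) f t (r • e) v (1, 0, 0)
      = -(v 0 / (a t r * jap v) - β t r) * totalD (timeInterval T) f t (r • e) v (0, e, 0)
        + 1 / (a t r * jap v * r) *
          (v 0 * v 1 * totalD (timeInterval T) f t (r • e) v (0, 0, bas 1)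
            + v 0 * v 2 * totalD (timeInterval T) f t (r • e) v (0, 0, bas 2)
            - (v 1 ^ 2 + v 2 ^ 2) * totalD (timeInterval T) f t (r • e) v (0, 0, bas 0))
        - (4 * Real.pi * r * a t r * curr f t r + dr β t r) *
          (v 0 * totalD (timeInterval T) f t (r • e) v (0, 0, bas 0))
        - β t r / r * (v 1 * totalD (timeInterval T) f t (r • e) v (0, 0, bas 1)
            + v 2 * totalD (timeInterval T) f t (r • e) v (0, 0, bas 2)) := by
  have hne : r • e ≠ 0 := by
    rw [← norm_ne_zero_iff, norm_smul_e hr.le]; exact hr.ne'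
  have h := hV t ht (r • e) v hne
  have hw : inner ℝ (r • e) v / r = v 0 := by
    rw [real_inner_smul_left, inner_e]; field_simp
  simp only [norm_smul_e hr.le, hw] at h
  rw [hf.transport_eq (timeInterval_uniqueDiffOn T) ht] at h
  have h1 := hf.tangential_deriv ht (i := 1) (by decide) r v
  have h2 := hf.tangential_deriv ht (i := 2) (by decide) r v
  have ha0 := ha.pos t ht r hr.le
  have hj := jap_pos v
  set L := totalD (timeInterval T) f t (r • e) v
  have hX : ((0, (1 / (a t r * jap v)) • v - (β t r / r) • r • e, 0) : ℝ × E3 × E3)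
      = (1 / (a t r * jap v) * v 0 - β t r) • (0, e, 0)
        + (1 / (a t r * jap v) * v 1) • (0, bas 1, 0)
        + (1 / (a t r * jap v) * v 2) • (0, bas 2, 0) := by
    ext k
    · simp
    · have hb : β t r / r * r = β t r := by field_simp
      fin_cases k <;> simp [e_eq_bas, bas_apply, hb]
    · simp
  have hVd : ((0, 0, (4 * Real.pi * r * a t r * curr f t r * v 0 / r) • r • e
        + ((dr β t r - β t r / r) * v 0 / r) • r • e + (β t r / r) • v) : ℝ × E3 × E3)
      = ((4 * Real.pi * r * a t r * curr f t r + dr β t r) * v 0) • (0, 0, bas 0)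
        + (β t r / r * v 1) • (0, 0, bas 1) + (β t r / r * v 2) • (0, 0, bas 2) := by
    ext k
    · simp
    · simp
    · fin_cases k
      · simp [e_eq_bas, bas_apply]; field_simp; ring
      · simp [e_eq_bas, bas_apply]
      · simp [e_eq_bas, bas_apply]
  rw [hX, hVd] at h
  simp only [map_add, map_smul, smul_eq_mul] at h
  have h1' : L (0, bas 1, 0) = (v 1 * L (0, 0, bas 0) - v 0 * L (0, 0, bas 1)) / r := by
    rw [← h1]; field_simp
  have h2' : L (0, bas 2, 0) = (v 2 * L (0, 0, bas 0) - v 0 * L (0, 0, bas 2)) / r := by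
    rw [← h2]; field_simp
  rw [h1', h2'] at h
  have h3 := eq_neg_of_add_eq_zero_left ((add_assoc _ _ _).symm.trans h)
  rw [h3]
  field_simp
  ring

theorem integral_sum_const_mul {n : ℕ} (c : Fin n → ℝ) (A : Fin n → E3 → ℝ)
    (hA : ∀ i, Integrable (A i)) :
    ∫ v, ∑ i, c i * A i v = ∑ i, c i * ∫ v, A i v := by
  rw [integral_finsetSum _ fun i _ => (hA i).const_mul (c i)]
  simp only [integral_const_mul]

theorem RegularDensity.momentD_bas (hf : RegularDensity (timeInterval T) f)
    (ht : t ∈ timeInterval T) (i : Fin 3) {φ φ' : E3 → ℝ} (hφ : Continuous φ)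
    (hφ' : Continuous φ') (hd : ∀ v, HasDerivAt (fun s : ℝ => φ (v + s • bas i)) (φ' v) 0) :
    momentD (timeInterval T) f (0, 0, bas i) φ t r = -moment f φ' t r :=
  hf.integral_mul_momentum_deriv ht (r • e) (bas i) hφ hφ' hd

theorem RegularDensity.moment_add (hf : RegularDensity (timeInterval T) f)
    (ht : t ∈ timeInterval T) {φ ψ : E3 → ℝ} (hφ : Continuous φ) (hψ : Continuous ψ) :
    moment f (fun v => φ v + ψ v) t r = moment f φ t r + moment f ψ t r := by
  rw [moment, moment, moment, ← integral_add (hf.integrable_mul ht _ hφ)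
    (hf.integrable_mul ht _ hψ)]
  congr 1; funext v; ring

theorem RegularDensity.moment_sub (hf : RegularDensity (timeInterval T) f)
    (ht : t ∈ timeInterval T) {φ ψ : E3 → ℝ} (hφ : Continuous φ) (hψ : Continuous ψ) :
    moment f (fun v => φ v - ψ v) t r = moment f φ t r - moment f ψ t r := by
  rw [moment, moment, moment, ← integral_sub (hf.integrable_mul ht _ hφ)
    (hf.integrable_mul ht _ hψ)]
  congr 1; funext v; ring

theorem RegularDensity.momentD_coord_mul (hf : RegularDensity (timeInterval T) f)
    (ht : t ∈ timeInterval T) {i : Fin 3} (hi : i ≠ 0) :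
    momentD (timeInterval T) f (0, 0, bas i) (fun v => v 0 * v i) t r = -curr f t r := by
  rw [curr_eq_moment]
  refine hf.momentD_bas ht i (by fun_prop) (by fun_prop) fun v => ?_
  refine ((hasDerivAt_coord v i 0).mul (hasDerivAt_coord v i i)).congr_deriv ?_
  simp [hi.symm]

/-- The energy equation. -/
theorem dt_rho (hf : RegularDensity (timeInterval T) f) (ha : RegularA (timeInterval T) a)
    (hV : ReducedVlasov (timeInterval T) f a β) (ht : t ∈ timeInterval T) (hr : 0 < r) :
    dt (timeInterval T) (rho f) t r
      = β t r * dr (rho f) t r - 1 / a t r * (dr (curr f) t r + 2 * curr f t r / r)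
        + (4 * Real.pi * r * a t r * curr f t r + dr β t r) * (rho f t r + pres f t r)
        + β t r / r * (2 * rho f t r + presTan f t r) := by
  have ha0 := ha.pos t ht r hr.le
  have c0 : Continuous fun v : E3 => v 0 := by fun_prop
  have c1 : Continuous fun v : E3 => v 1 := by fun_prop
  have c2 : Continuous fun v : E3 => v 2 := by fun_prop
  have hz : ∀ (v : E3) (i : Fin 3), v + (0 : ℝ) • bas i = v := fun v i => by simp
  have e1 := hf.momentD_coord_mul ht (r := r) (i := 1) (by decide)
  have e2 := hf.momentD_coord_mul ht (r := r) (i := 2) (by decide)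
  have e3 : momentD (timeInterval T) f (0, 0, bas 0) (fun v => v 1 ^ 2 + v 2 ^ 2) t r = 0 := by
    rw [hf.momentD_bas ht 0 (φ' := fun _ => 0) (by fun_prop) (by fun_prop) fun v => ?_]
    · simp [moment]
    · exact (((hasDerivAt_coord v 0 1).pow 2).add
        ((hasDerivAt_coord v 0 2).pow 2)).congr_deriv (by simp)
  have e4 : ∀ i, momentD (timeInterval T) f (0, 0, bas i) (fun v => jap v * v i) t r
      = -(rho f t r + moment f (fun v => v i ^ 2 / jap v) t r) := by
    intro i
    rw [rho_eq_moment, ← hf.moment_add ht continuous_jap (continuous_div_jap (by fun_prop))]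
    refine hf.momentD_bas ht i (continuous_jap.mul (by fun_prop))
      (continuous_jap.add (continuous_div_jap (by fun_prop))) fun v => ?_
    have := (hasDerivAt_jap v i).mul (hasDerivAt_coord v i i)
    simp only [hz, if_true] at this
    refine this.congr_deriv ?_
    ring
  have hq : presTan f t r = moment f (fun v => v 1 ^ 2 / jap v) t r
      + moment f (fun v => v 2 ^ 2 / jap v) t r := by
    rw [presTan, ← hf.moment_add ht (continuous_div_jap (by fun_prop))
      (continuous_div_jap (by fun_prop))]
    simp only [add_div]
  -- The axis equation multiplied by `⟨v⟩` is a combination of eight terms with coefficients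
  -- independent of `v`. The first two integrate to `∂_r j` and `∂_r ρ`; the others are the momentum
  -- derivatives evaluated in `e1` to `e4`.
  have hsum := integral_sum_const_mul
    ![-(1 / a t r), β t r, 1 / (a t r * r), 1 / (a t r * r), -(1 / (a t r * r)),
      -(4 * Real.pi * r * a t r * curr f t r + dr β t r), -(β t r / r), -(β t r / r)]
    ![fun v => v 0 * totalD (timeInterval T) f t (r • e) v (0, e, 0),
      fun v => jap v * totalD (timeInterval T) f t (r • e) v (0, e, 0),
      fun v => v 0 * v 1 * totalD (timeInterval T) f t (r • e) v (0, 0, bas 1),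
      fun v => v 0 * v 2 * totalD (timeInterval T) f t (r • e) v (0, 0, bas 2),
      fun v => (v 1 ^ 2 + v 2 ^ 2) * totalD (timeInterval T) f t (r • e) v (0, 0, bas 0),
      fun v => jap v * v 0 * totalD (timeInterval T) f t (r • e) v (0, 0, bas 0),
      fun v => jap v * v 1 * totalD (timeInterval T) f t (r • e) v (0, 0, bas 1),
      fun v => jap v * v 2 * totalD (timeInterval T) f t (r • e) v (0, 0, bas 2)] (by
        have cj := continuous_jap
        intro i
        fin_cases i <;> exact hf.integrable_mul_totalD ht _ _ (by fun_prop))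
  refine Eq.trans (Eq.trans ?_ hsum) ?_
  · rw [rho_eq_moment, hf.dt_moment continuous_jap ht hr.le, momentD]
    refine integral_congr_ae (ae_of_all _ fun v => ?_)
    have hj := jap_pos v
    simp only [vlasov_on_axis hf ha hV ht hr v, Fin.sum_univ_succ]
    simp
    field_simp
    ring
  simp only [Fin.sum_univ_succ]
  have d1 : dr (curr f) t r = ∫ v, v 0 * totalD (timeInterval T) f t (r • e) v (0, e, 0) := by
    rw [curr_eq_moment, hf.dr_moment c0 ht hr.le, momentD]
  have d2 : dr (rho f) t r = ∫ v, jap v * totalD (timeInterval T) f t (r • e) v (0, e, 0) := by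
    rw [rho_eq_moment, hf.dr_moment continuous_jap ht hr.le, momentD]
  have e40 := e4 0
  have e41 := e4 1
  have e42 := e4 2
  simp only [momentD] at e1 e2 e3 e40 e41 e42
  simp [e1, e2, e3, e40, e41, e42, d1, d2, hq, pres_eq_moment]
  field_simp
  ring

/-- The momentum equation. -/
theorem dt_curr (hf : RegularDensity (timeInterval T) f) (ha : RegularA (timeInterval T) a)
    (hV : ReducedVlasov (timeInterval T) f a β) (ht : t ∈ timeInterval T) (hr : 0 < r) :
    dt (timeInterval T) (curr f) t r
      = β t r * dr (curr f) t r
        - 1 / a t r * (dr (pres f) t r + 2 * pres f t r / r - presTan f t r / r)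
        + 2 * (4 * Real.pi * r * a t r * curr f t r + dr β t r + β t r / r) * curr f t r := by
  have ha0 := ha.pos t ht r hr.le
  have c0 : Continuous fun v : E3 => v 0 := by fun_prop
  have cj := continuous_jap
  have cj0 : ∀ v : E3, jap v ≠ 0 := fun v => (jap_pos v).ne'
  have cj2 : ∀ v : E3, jap v ^ 2 ≠ 0 := fun v => pow_ne_zero 2 (cj0 v)
  have hz : ∀ (v : E3) (i : Fin 3), v + (0 : ℝ) • bas i = v := fun v i => by simp
  have e1 := hf.momentD_coord_mul ht (r := r) (i := 1) (by decide)
  have e2 := hf.momentD_coord_mul ht (r := r) (i := 2) (by decide)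
  have e3 : momentD (timeInterval T) f (0, 0, bas 0) (fun v => v 0 ^ 2) t r
      = -(curr f t r + curr f t r) := by
    rw [curr_eq_moment, ← hf.moment_add ht c0 c0]
    refine hf.momentD_bas ht 0 (by fun_prop) (by fun_prop) fun v => ?_
    refine ((hasDerivAt_coord v 0 0).pow 2).congr_deriv ?_
    simp; ring
  have e4 : ∀ i : Fin 3, i ≠ 0 →
      momentD (timeInterval T) f (0, 0, bas i) (fun v => v 0 ^ 2 * v i / jap v) t r
      = -moment f (fun v => v 0 ^ 2 / jap v - v 0 ^ 2 * v i ^ 2 / (jap v * jap v ^ 2)) t r := by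
    intro i hi
    refine hf.momentD_bas ht i (by fun_prop (disch := assumption))
      (by fun_prop (disch := simp [cj0])) fun v => ?_
    have := (((hasDerivAt_coord v i 0).pow 2).mul (hasDerivAt_coord v i i)).div
      (hasDerivAt_jap v i) (by simpa using cj0 v)
    simp only [hz, if_true, if_neg hi.symm, Pi.mul_apply, Pi.pow_apply] at this
    refine this.congr_deriv ?_
    have := cj0 v
    field_simp
    ring
  have e5 : momentD (timeInterval T) f (0, 0, bas 0) (fun v => v 0 * (v 1 ^ 2 + v 2 ^ 2) / jap v) t r
      = -moment f (fun v => (v 1 ^ 2 + v 2 ^ 2) / jap v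
          - v 0 ^ 2 * (v 1 ^ 2 + v 2 ^ 2) / (jap v * jap v ^ 2)) t r := by
    refine hf.momentD_bas ht 0 (by fun_prop (disch := assumption))
      (by fun_prop (disch := simp [cj0])) fun v => ?_
    have := ((hasDerivAt_coord v 0 0).mul (((hasDerivAt_coord v 0 1).pow 2).add
      ((hasDerivAt_coord v 0 2).pow 2))).div (hasDerivAt_jap v 0) (by simpa using cj0 v)
    simp only [hz, Pi.mul_apply, Pi.add_apply, Pi.pow_apply] at this
    refine this.congr_deriv ?_
    have := cj0 v
    simp
    field_simp
  -- Differentiating `1/⟨v⟩` produces terms `v_0² v_i² / ⟨v⟩³` that are not matter quantities. They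
  -- cancel between the tangential and the radial integrations by parts.
  have hcomb : moment f (fun v => v 0 ^ 2 / jap v - v 0 ^ 2 * v 1 ^ 2 / (jap v * jap v ^ 2)) t r
      + moment f (fun v => v 0 ^ 2 / jap v - v 0 ^ 2 * v 2 ^ 2 / (jap v * jap v ^ 2)) t r
      - moment f (fun v => (v 1 ^ 2 + v 2 ^ 2) / jap v
          - v 0 ^ 2 * (v 1 ^ 2 + v 2 ^ 2) / (jap v * jap v ^ 2)) t r
      = pres f t r + pres f t r - presTan f t r := by
    rw [pres_eq_moment, presTan, ← hf.moment_add ht (by fun_prop (disch := simp [cj0]))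
      (by fun_prop (disch := simp [cj0])), ← hf.moment_sub ht (by fun_prop (disch := simp [cj0]))
      (by fun_prop (disch := simp [cj0])), ← hf.moment_add ht (by fun_prop (disch := simp [cj0]))
      (by fun_prop (disch := simp [cj0])), ← hf.moment_sub ht (by fun_prop (disch := simp [cj0]))
      (by fun_prop (disch := simp [cj0]))]
    congr 1
    funext v
    ring
  have hsum := integral_sum_const_mul
    ![-(1 / a t r), β t r, 1 / (a t r * r), 1 / (a t r * r), -(1 / (a t r * r)),
      -(4 * Real.pi * r * a t r * curr f t r + dr β t r), -(β t r / r), -(β t r / r)]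
    ![fun v => v 0 ^ 2 / jap v * totalD (timeInterval T) f t (r • e) v (0, e, 0),
      fun v => v 0 * totalD (timeInterval T) f t (r • e) v (0, e, 0),
      fun v => v 0 ^ 2 * v 1 / jap v * totalD (timeInterval T) f t (r • e) v (0, 0, bas 1),
      fun v => v 0 ^ 2 * v 2 / jap v * totalD (timeInterval T) f t (r • e) v (0, 0, bas 2),
      fun v => v 0 * (v 1 ^ 2 + v 2 ^ 2) / jap v
        * totalD (timeInterval T) f t (r • e) v (0, 0, bas 0),
      fun v => v 0 ^ 2 * totalD (timeInterval T) f t (r • e) v (0, 0, bas 0),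
      fun v => v 0 * v 1 * totalD (timeInterval T) f t (r • e) v (0, 0, bas 1),
      fun v => v 0 * v 2 * totalD (timeInterval T) f t (r • e) v (0, 0, bas 2)] (by
        intro i
        fin_cases i <;> exact hf.integrable_mul_totalD ht _ _ (by fun_prop (disch := assumption)))
  refine Eq.trans (Eq.trans ?_ hsum) ?_
  · have hdt : dt (timeInterval T) (curr f) t r
        = momentD (timeInterval T) f (1, 0, 0) (fun v => v 0) t r := by
      rw [curr_eq_moment, hf.dt_moment c0 ht hr.le]
    rw [hdt, momentD]
    refine integral_congr_ae (ae_of_all _ fun v => ?_)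
    have hj := jap_pos v
    simp only [vlasov_on_axis hf ha hV ht hr v, Fin.sum_univ_succ]
    simp
    field_simp
    ring
  simp only [Fin.sum_univ_succ]
  have d1 : dr (pres f) t r
      = ∫ v, v 0 ^ 2 / jap v * totalD (timeInterval T) f t (r • e) v (0, e, 0) := by
    rw [pres_eq_moment, hf.dr_moment (continuous_div_jap (by fun_prop)) ht hr.le, momentD]
  have d2 : dr (curr f) t r = ∫ v, v 0 * totalD (timeInterval T) f t (r • e) v (0, e, 0) := by
    rw [curr_eq_moment, hf.dr_moment c0 ht hr.le, momentD]
  have e41 := e4 1 (by decide)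
  have e42 := e4 2 (by decide)
  simp only [momentD] at e1 e2 e3 e41 e42 e5
  -- Solved for the radial pressure, so that the moments with cubic denominators remain as
  -- independent atoms in the final identity.
  have hp : pres f t r
      = (moment f (fun v => v 0 ^ 2 / jap v - v 0 ^ 2 * v 1 ^ 2 / (jap v * jap v ^ 2)) t r
      + moment f (fun v => v 0 ^ 2 / jap v - v 0 ^ 2 * v 2 ^ 2 / (jap v * jap v ^ 2)) t r
      - moment f (fun v => (v 1 ^ 2 + v 2 ^ 2) / jap v
          - v 0 ^ 2 * (v 1 ^ 2 + v 2 ^ 2) / (jap v * jap v ^ 2)) t r + presTan f t r) / 2 := by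
    linarith
  simp [e1, e2, e3, e41, e42, e5, d1, d2, hp]
  field_simp
  ring

end MomentEquations

/-! ### Radial averages and radial integrals -/

section Radial

variable {T : EReal} {I : Set ℝ} {u : ℝ → ℝ → ℝ} {t r : ℝ}

/-- The average `∫_0^1 u(t, rσ) σ² dσ`. -/
def radialAvg (u : ℝ → ℝ → ℝ) (t r : ℝ) : ℝ := ∫ σ in Icc (0 : ℝ) 1, u t (r * σ) * σ ^ 2

theorem mapsTo_scale : MapsTo (fun z : (ℝ × ℝ) × ℝ => (z.1.1, z.1.2 * z.2))
    (halfStrip I ×ˢ Icc (0 : ℝ) 1) (halfStrip I) :=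
  fun _ hz => ⟨hz.1.1, mul_nonneg hz.1.2 hz.2.1⟩

theorem ContinuousOn.radialAvg {u : ℝ → ℝ → ℝ}
    (h : ContinuousOn (fun q : ℝ × ℝ => u q.1 q.2) (halfStrip I)) {g : ℝ → ℝ} (hg : Continuous g) :
    ContinuousOn (fun q : ℝ × ℝ => ∫ σ in Icc (0 : ℝ) 1, u q.1 (q.2 * σ) * g σ) (halfStrip I) :=
  continuousOn_setIntegral_of_isCompact (F := fun (q : ℝ × ℝ) (σ : ℝ) => u q.1 (q.2 * σ) * g σ)
    isCompact_Icc ((h.comp (f := fun z : (ℝ × ℝ) × ℝ => (z.1.1, z.1.2 * z.2)) (by fun_prop)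
      mapsTo_scale).mul (by fun_prop))

/-- In the variable `σ = s / r` the domain of integration is fixed, so differentiation under the
integral works up to and including `r = 0`. The `r`-derivative of `u(t, rσ)` supplies the extra
factor `σ`. -/
theorem IsCn.radialAvg (h : IsCn 1 I u) (hI : UniqueDiffOn ℝ I) (hc : Convex ℝ I) :
    IsCn 1 I (radialAvg u) := by
  have hcomp : ∀ {w : ℝ → ℝ → ℝ}, ContinuousOn (fun q : ℝ × ℝ => w q.1 q.2) (halfStrip I) →
      ContinuousOn (fun z : (ℝ × ℝ) × ℝ => w z.1.1 (z.1.2 * z.2)) (halfStrip I ×ˢ Icc (0 : ℝ) 1) :=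
    fun hw => hw.comp (f := fun z : (ℝ × ℝ) × ℝ => (z.1.1, z.1.2 * z.2)) (by fun_prop) mapsTo_scale
  have hdt := hcomp (h.dt_continuousOn hI)
  have hdr := hcomp (h.dr_continuousOn hI)
  have hF' : ContinuousOn (Function.uncurry fun (q : ℝ × ℝ) (σ : ℝ) =>
      lin2 (dt I u q.1 (q.2 * σ) * σ ^ 2) (dr u q.1 (q.2 * σ) * σ ^ 3))
      (halfStrip I ×ˢ Icc (0 : ℝ) 1) := by
    refine ((hdt.mul ?_).smul continuousOn_const).add ((hdr.mul ?_).smul continuousOn_const) <;>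
      fun_prop
  refine isCn_succ_of_hasFDerivWithinAt (n := 0) hI
    (p := fun t r => ∫ σ in Icc (0 : ℝ) 1, dt I u t (r * σ) * σ ^ 2)
    (q := fun t r => ∫ σ in Icc (0 : ℝ) 1, dr u t (r * σ) * σ ^ 3)
    (isCn_zero_of_continuousOn (ContinuousOn.radialAvg (h.dt_continuousOn hI) (by fun_prop)))
    (isCn_zero_of_continuousOn (ContinuousOn.radialAvg (h.dr_continuousOn hI) (by fun_prop)))
    fun t ht r hr => ?_
  have hmem : ((t, r) : ℝ × ℝ) ∈ halfStrip I := ⟨ht, hr⟩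
  have hmain := hasFDerivWithinAt_setIntegral_of_isCompact (μ := (volume : Measure ℝ))
    (halfStrip_convex hc) (isCompact_Icc (a := (0 : ℝ)) (b := 1))
    (F := fun (q : ℝ × ℝ) (σ : ℝ) => u q.1 (q.2 * σ) * σ ^ 2)
    (F' := fun (q : ℝ × ℝ) (σ : ℝ) =>
      lin2 (dt I u q.1 (q.2 * σ) * σ ^ 2) (dr u q.1 (q.2 * σ) * σ ^ 3))
    ((hcomp h.continuousOn).mul (by fun_prop)) hF' (fun q hq σ hσ => ?_) hmem
  · have hint := (continuousOn_section hF' hmem).integrableOn_compact (μ := volume) isCompact_Icc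
    rw [eq_lin2 (∫ σ in _, _)] at hmain
    rw [ContinuousLinearMap.integral_apply hint, ContinuousLinearMap.integral_apply hint] at hmain
    simp only [lin2_apply, mul_one, mul_zero, add_zero, zero_add] at hmain
    exact hmain
  · have h1 : HasFDerivWithinAt (fun q : ℝ × ℝ => (q.1, q.2 * σ))
        ((ContinuousLinearMap.fst ℝ ℝ ℝ).prod (σ • ContinuousLinearMap.snd ℝ ℝ ℝ)) (halfStrip I)
        q := by
      have := ((ContinuousLinearMap.fst ℝ ℝ ℝ).prod
        (σ • ContinuousLinearMap.snd ℝ ℝ ℝ)).hasFDerivWithinAt (s := halfStrip I) (x := q)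
      refine this.congr_of_eventuallyEq (Eventually.of_forall fun z => ?_) ?_ <;>
        simp [mul_comm]
    have hmaps : MapsTo (fun q : ℝ × ℝ => (q.1, q.2 * σ)) (halfStrip I) (halfStrip I) :=
      fun z hz => ⟨hz.1, mul_nonneg hz.2 hσ.1⟩
    have h2 := HasFDerivWithinAt.comp (g := fun q : ℝ × ℝ => u q.1 q.2) q
      (h.hasFDerivWithinAt one_ne_zero hI hq.1 (mul_nonneg hq.2 hσ.1)) h1 hmaps
    refine (h2.mul_const (σ ^ 2)).congr_fderiv ?_
    ext <;> simp [lin2] <;> ring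

/-- The substitution `s = rσ`. It exhibits the factor `r³` that compensates the `1/r` in `A`. -/
theorem radialIntegral_eq (u : ℝ → ℝ → ℝ) (t r : ℝ) :
    ∫ s in (0 : ℝ)..r, u t s * s ^ 2 = r ^ 3 * radialAvg u t r := by
  rcases eq_or_ne r 0 with rfl | hr
  · simp
  · have h := intervalIntegral.integral_comp_mul_left (a := 0) (b := 1)
      (fun s => u t s * s ^ 2) hr
    have h2 : ∫ σ in (0 : ℝ)..1, u t (r * σ) * (r * σ) ^ 2 = r ^ 2 * radialAvg u t r := by
      rw [radialAvg, integral_Icc_eq_integral_Ioc, ← intervalIntegral.integral_of_le zero_le_one,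
        ← intervalIntegral.integral_const_mul]
      congr 1
      funext σ
      ring
    rw [h2, mul_zero, mul_one, smul_eq_mul] at h
    field_simp at h
    linarith

theorem continuousOn_slice (h : ContinuousOn (fun q : ℝ × ℝ => u q.1 q.2) (halfStrip I))
    (ht : t ∈ I) : ContinuousOn (fun s => u t s) (Ici 0) :=
  h.comp (f := fun s : ℝ => (t, s)) (by fun_prop) fun _ hs => ⟨ht, hs⟩

theorem intervalIntegrable_slice
    (h : ContinuousOn (fun q : ℝ × ℝ => u q.1 q.2) (halfStrip I)) (ht : t ∈ I) (hr : 0 ≤ r) :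
    IntervalIntegrable (fun s => u t s) volume 0 r := by
  refine ((continuousOn_slice h ht).mono ?_).intervalIntegrable
  rw [uIcc_of_le hr]
  exact fun s hs => hs.1

theorem hasDerivAt_radialIntegral
    (h : ContinuousOn (fun q : ℝ × ℝ => u q.1 q.2) (halfStrip I)) (ht : t ∈ I) (hr : 0 < r) :
    HasDerivAt (fun r => ∫ s in (0 : ℝ)..r, u t s) (u t r) r := by
  -- Only radii `s ≥ 0` are controlled; the even extension is continuous on the whole line and
  -- agrees with `u t` on the interval of integration.
  have hc : Continuous fun s : ℝ => u t |s| :=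
    (continuousOn_slice h ht).comp_continuous continuous_abs fun s => abs_nonneg s
  have h1 := (hc.integral_hasStrictDerivAt 0 r).hasDerivAt
  rw [abs_of_pos hr] at h1
  refine h1.congr_of_eventuallyEq ?_
  filter_upwards [Ioi_mem_nhds hr] with ρ hρ
  refine intervalIntegral.integral_congr fun s hs => ?_
  rw [uIcc_of_le (mem_Ioi.1 hρ).le] at hs
  simp only [abs_of_nonneg hs.1]

theorem integral_dr_eq_sub (h : IsCn 1 I u) (hI : UniqueDiffOn ℝ I) (ht : t ∈ I) (hr : 0 ≤ r) :
    ∫ s in (0 : ℝ)..r, dr u t s = u t r - u t 0 := by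
  refine intervalIntegral.integral_eq_sub_of_hasDerivAt_of_le hr
    ((continuousOn_slice h.continuousOn ht).mono fun s hs => hs.1)
    (fun s hs => h.hasDerivAt_dr one_ne_zero ht hs.1)
    (intervalIntegrable_slice (h.dr_continuousOn hI) ht hr)

theorem hasDerivWithinAt_time_integral (h : IsCn 1 I u) (hI : UniqueDiffOn ℝ I)
    (hc : Convex ℝ I) (ht : t ∈ I) (hr : 0 ≤ r) :
    HasDerivWithinAt (fun τ => ∫ s in (0 : ℝ)..r, u τ s) (∫ s in (0 : ℝ)..r, dt I u t s) I t := by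
  simp only [intervalIntegral.integral_of_le hr, ← integral_Icc_eq_integral_Ioc]
  have hsub : I ×ˢ Icc 0 r ⊆ halfStrip I := prod_mono subset_rfl fun s hs => hs.1
  have hF' : ContinuousOn (Function.uncurry fun (τ : ℝ) (s : ℝ) =>
      dt I u τ s • (1 : ℝ →L[ℝ] ℝ)) (I ×ˢ Icc 0 r) :=
    ((h.dt_continuousOn hI).mono hsub).smul continuousOn_const
  have hmain := hasFDerivWithinAt_setIntegral_of_isCompact (μ := (volume : Measure ℝ)) hc
    (isCompact_Icc (a := (0 : ℝ)) (b := r)) (F := fun (τ : ℝ) (s : ℝ) => u τ s)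
    (F' := fun (τ : ℝ) (s : ℝ) => dt I u τ s • (1 : ℝ →L[ℝ] ℝ))
    (h.continuousOn.mono hsub) hF' (fun τ hτ s hs => ?_) ht
  · have hint := (continuousOn_section hF' ht).integrableOn_compact (μ := volume) isCompact_Icc
    have := hmain.hasDerivWithinAt
    rw [ContinuousLinearMap.integral_apply hint] at this
    simpa using this
  · have := (h.hasDerivWithinAt_dt one_ne_zero hτ hs.1).hasFDerivWithinAt
    refine this.congr_fderiv ?_
    ext
    simp

end Radial

/-! ### The mass function -/

section Mass

variable {T : EReal} {f : ℝ → E3 → E3 → ℝ} {a β : ℝ → ℝ → ℝ} {t r : ℝ}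

/-- The source `ρ - a β j` of the mass function. -/
def massSource (f : ℝ → E3 → E3 → ℝ) (a β : ℝ → ℝ → ℝ) (t r : ℝ) : ℝ :=
  rho f t r - a t r * β t r * curr f t r

/-- The flux `r² (β (ρ + p) - (a β² + a⁻¹) j)` of the mass function. -/
def massFlux (f : ℝ → E3 → E3 → ℝ) (a β : ℝ → ℝ → ℝ) (t r : ℝ) : ℝ :=
  r ^ 2 * (β t r * (rho f t r + pres f t r) - (a t r * β t r ^ 2 + (a t r)⁻¹) * curr f t r)

/-- The defect `1/a² - β² - A` of the constraint. -/
def defect (f : ℝ → E3 → E3 → ℝ) (a β : ℝ → ℝ → ℝ) (t r : ℝ) : ℝ :=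
  ((a t r) ^ 2)⁻¹ - β t r ^ 2 - Afun f a β t r

/-- The form of `A` without division by `r`, from which its regularity at the centre is read off. It
holds at `r = 0` as well, where both sides are `1`. -/
theorem Afun_eq (f : ℝ → E3 → E3 → ℝ) (a β : ℝ → ℝ → ℝ) (t r : ℝ) :
    Afun f a β t r = 1 - 8 * Real.pi * (r ^ 2 * radialAvg (massSource f a β) t r) := by
  have h := radialIntegral_eq (massSource f a β) t r
  simp only [massSource] at h
  rw [Afun, h]
  rcases eq_or_ne r 0 with rfl | hr
  · simp
  · field_simp

theorem mul_one_sub_Afun (f : ℝ → E3 → E3 → ℝ) (a β : ℝ → ℝ → ℝ) (t r : ℝ) :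
    r * (1 - Afun f a β t r)
      = 8 * Real.pi * ∫ s in (0 : ℝ)..r, massSource f a β t s * s ^ 2 := by
  rw [radialIntegral_eq, Afun_eq]; ring

theorem Afun_zero (f : ℝ → E3 → E3 → ℝ) (a β : ℝ → ℝ → ℝ) (t : ℝ) : Afun f a β t 0 = 1 := by
  rw [Afun_eq]; ring

namespace IsReducedSolution

theorem isCn_a_inv (hs : IsReducedSolution T f a β) :
    IsCn 1 (timeInterval T) (fun t r => (a t r)⁻¹) :=
  hs.regular_a.contDiff.inv fun t ht r hr => (hs.regular_a.pos t ht r hr).ne'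

theorem isCn_massSource (hs : IsReducedSolution T f a β) :
    IsCn 1 (timeInterval T) (massSource f a β) :=
  hs.regular_f.isCn_rho.sub
    ((hs.regular_a.contDiff.mul hs.regular_β.contDiff).mul hs.regular_f.isCn_curr)

theorem isCn_massFlux (hs : IsReducedSolution T f a β) :
    IsCn 1 (timeInterval T) (massFlux f a β) :=
  (isCn_radius.pow 2).mul
    ((hs.regular_β.contDiff.mul (hs.regular_f.isCn_rho.add hs.regular_f.isCn_pres)).sub
      (((hs.regular_a.contDiff.mul (hs.regular_β.contDiff.pow 2)).add hs.isCn_a_inv).mul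
        hs.regular_f.isCn_curr))

theorem isCn_massAvg (hs : IsReducedSolution T f a β) :
    IsCn 1 (timeInterval T) (radialAvg (massSource f a β)) :=
  hs.isCn_massSource.radialAvg (timeInterval_uniqueDiffOn T) (timeInterval_convex T)

theorem isCn_Afun (hs : IsReducedSolution T f a β) :
    IsCn 1 (timeInterval T) (Afun f a β) :=
  ((isCn_const 1).sub ((isCn_const (8 * Real.pi)).mul
    ((isCn_radius.pow 2).mul hs.isCn_massAvg))).congr fun t _ r _ => Afun_eq f a β t r

theorem isCn_defect (hs : IsReducedSolution T f a β) :
    IsCn 1 (timeInterval T) (defect f a β) :=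
  (((hs.regular_a.contDiff.pow 2).inv fun t ht r hr =>
    pow_ne_zero 2 (hs.regular_a.pos t ht r hr).ne').sub (hs.regular_β.contDiff.pow 2)).sub
    hs.isCn_Afun

theorem dr_Afun (hs : IsReducedSolution T f a β) (ht : t ∈ timeInterval T) (hr : 0 < r) :
    dr (Afun f a β) t r = (1 - Afun f a β t r) / r - 8 * Real.pi * r * massSource f a β t r := by
  have h1 := (hasDerivAt_radialIntegral (u := fun t s => massSource f a β t s * s ^ 2)
    (hs.isCn_massSource.mul (isCn_radius.pow 2)).continuousOn ht hr).const_mul (8 * Real.pi)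
  simp only [← mul_one_sub_Afun] at h1
  have h2 := (hasDerivAt_id r).mul
    ((hs.isCn_Afun.hasDerivAt_dr one_ne_zero ht hr).const_sub 1)
  have h3 := h1.unique h2
  simp only [id] at h3
  field_simp
  linarith

theorem dt_mass (hs : IsReducedSolution T f a β) (ht : t ∈ timeInterval T) (hr : 0 ≤ r) :
    HasDerivWithinAt (fun s => r * (1 - Afun f a β s r))
      (8 * Real.pi * ∫ s in (0 : ℝ)..r, dt (timeInterval T) (massSource f a β) t s * s ^ 2)
      (timeInterval T) t := by
  have h1 := (hasDerivWithinAt_time_integral (u := fun t s => massSource f a β t s * s ^ 2)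
    (hs.isCn_massSource.mul (isCn_radius.pow 2)) (timeInterval_uniqueDiffOn T)
    (timeInterval_convex T) ht hr).const_mul (8 * Real.pi)
  simp only [← mul_one_sub_Afun] at h1
  refine h1.congr_deriv ?_
  congr 1
  refine intervalIntegral.integral_congr fun s hs' => ?_
  rw [uIcc_of_le hr] at hs'
  exact dt_eq (timeInterval_uniqueDiffOn T) ht
    ((hs.isCn_massSource.hasDerivWithinAt_dt one_ne_zero ht hs'.1).mul_const _)

theorem dr_defect (hs : IsReducedSolution T f a β) (ht : t ∈ timeInterval T) (hr : 0 ≤ r) :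
    dr (defect f a β) t r = -(2 * dr a t r / a t r ^ 3) - 2 * β t r * dr β t r
      - dr (Afun f a β) t r := by
  have ha := hs.regular_a.contDiff.hasDerivWithinAt_dr one_ne_zero ht hr
  have ha0 := (hs.regular_a.pos t ht r hr).ne'
  refine dr_eq hr ((((ha.pow 2).inv (pow_ne_zero 2 ha0)).sub
    ((hs.regular_β.contDiff.hasDerivWithinAt_dr one_ne_zero ht hr).pow 2)).sub
    (hs.isCn_Afun.hasDerivWithinAt_dr one_ne_zero ht hr) |>.congr_deriv ?_)
  simp only [Pi.pow_apply]
  field_simp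
  ring

theorem dt_defect (hs : IsReducedSolution T f a β) (ht : t ∈ timeInterval T) (hr : 0 ≤ r) :
    dt (timeInterval T) (defect f a β) t r = -(2 * dt (timeInterval T) a t r / a t r ^ 3)
      - 2 * β t r * dt (timeInterval T) β t r - dt (timeInterval T) (Afun f a β) t r := by
  have ha := hs.regular_a.contDiff.hasDerivWithinAt_dt one_ne_zero ht hr
  have ha0 := (hs.regular_a.pos t ht r hr).ne'
  refine dt_eq (timeInterval_uniqueDiffOn T) ht ((((ha.pow 2).inv (pow_ne_zero 2 ha0)).sub
    ((hs.regular_β.contDiff.hasDerivWithinAt_dt one_ne_zero ht hr).pow 2)).sub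
    (hs.isCn_Afun.hasDerivWithinAt_dt one_ne_zero ht hr) |>.congr_deriv ?_)
  simp only [Pi.pow_apply]
  field_simp
  ring

theorem dr_massFlux (hs : IsReducedSolution T f a β) (ht : t ∈ timeInterval T) (hr : 0 ≤ r) :
    dr (massFlux f a β) t r
      = 2 * r * (β t r * (rho f t r + pres f t r) - (a t r * β t r ^ 2 + (a t r)⁻¹) * curr f t r)
        + r ^ 2 * (dr β t r * (rho f t r + pres f t r) + β t r * (dr (rho f) t r + dr (pres f) t r)
          - (dr a t r * β t r ^ 2 + 2 * a t r * β t r * dr β t r - dr a t r / a t r ^ 2)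
            * curr f t r
          - (a t r * β t r ^ 2 + (a t r)⁻¹) * dr (curr f) t r) := by
  have ha := hs.regular_a.contDiff.hasDerivWithinAt_dr one_ne_zero ht hr
  have ha0 := (hs.regular_a.pos t ht r hr).ne'
  have hb := hs.regular_β.contDiff.hasDerivWithinAt_dr one_ne_zero ht hr
  have hρ := hs.regular_f.isCn_rho.hasDerivWithinAt_dr one_ne_zero ht hr
  have hp := hs.regular_f.isCn_pres.hasDerivWithinAt_dr one_ne_zero ht hr
  have hj := hs.regular_f.isCn_curr.hasDerivWithinAt_dr one_ne_zero ht hr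
  refine dr_eq hr ((((hasDerivWithinAt_id r (Ici 0)).pow 2).mul
    ((hb.mul (hρ.add hp)).sub (((ha.mul (hb.pow 2)).add (ha.inv ha0)).mul hj))).congr_deriv ?_)
  simp only [Pi.pow_apply, Pi.mul_apply, Pi.add_apply, Pi.sub_apply, Pi.inv_apply, id]
  field_simp
  ring

theorem dt_massSource_expand (hs : IsReducedSolution T f a β) (ht : t ∈ timeInterval T)
    (hr : 0 ≤ r) :
    dt (timeInterval T) (massSource f a β) t r = dt (timeInterval T) (rho f) t r
      - (dt (timeInterval T) a t r * β t r * curr f t r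
        + a t r * dt (timeInterval T) β t r * curr f t r
        + a t r * β t r * dt (timeInterval T) (curr f) t r) := by
  have ha := hs.regular_a.contDiff.hasDerivWithinAt_dt one_ne_zero ht hr
  have hb := hs.regular_β.contDiff.hasDerivWithinAt_dt one_ne_zero ht hr
  have hρ := hs.regular_f.isCn_rho.hasDerivWithinAt_dt one_ne_zero ht hr
  have hj := hs.regular_f.isCn_curr.hasDerivWithinAt_dt one_ne_zero ht hr
  refine dt_eq (timeInterval_uniqueDiffOn T) ht ((hρ.sub ((ha.mul hb).mul hj)).congr_deriv ?_)
  simp only [Pi.mul_apply]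
  ring

/-- The local balance law for the mass density. -/
theorem mass_balance (hs : IsReducedSolution T f a β) (ht : t ∈ timeInterval T) (hr : 0 < r) :
    dt (timeInterval T) (massSource f a β) t r * r ^ 2 = dr (massFlux f a β) t r
      + 1 / 2 * (a t r * curr f t r * r ^ 2 * dr (defect f a β) t r) := by
  have ha0 := (hs.regular_a.pos t ht r hr.le).ne'
  have hat := eq_add_of_sub_eq (hs.a_eq t ht r hr.le)
  have hbt := eq_add_of_sub_eq (hs.β_eq t ht r hr.le)
  -- All time derivatives are eliminated through the moment equations and the reduced system. The
  -- tangential pressure cancels between `∂_t ρ` and `a β ∂_t j`; the remaining check is algebraic.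
  rw [hs.dr_defect ht hr.le, hs.dr_massFlux ht hr.le, hs.dt_massSource_expand ht hr.le,
    hs.dr_Afun ht hr, dt_rho hs.regular_f hs.regular_a hs.vlasov ht hr,
    dt_curr hs.regular_f hs.regular_a hs.vlasov ht hr, hat, hbt]
  simp only [massSource]
  have hr0 := hr.ne'
  field_simp
  ring

/-- The mass function satisfies its evolution equation up to a term in the constraint defect. -/
theorem dt_mass_eq (hs : IsReducedSolution T f a β) (ht : t ∈ timeInterval T) (hr : 0 ≤ r) :
    HasDerivWithinAt (fun s => r * (1 - Afun f a β s r))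
      (8 * Real.pi * massFlux f a β t r + 4 * Real.pi *
        ∫ s in (0 : ℝ)..r, a t s * curr f t s * s ^ 2 * dr (defect f a β) t s)
      (timeInterval T) t := by
  refine (hs.dt_mass ht hr).congr_deriv ?_
  have hI := timeInterval_uniqueDiffOn T
  have h1 : ∫ s in (0 : ℝ)..r, dt (timeInterval T) (massSource f a β) t s * s ^ 2
      = ∫ s in (0 : ℝ)..r, (dr (massFlux f a β) t s
        + 1 / 2 * (a t s * curr f t s * s ^ 2 * dr (defect f a β) t s)) := by
    -- The balance law is known for positive radii only, and `Ioc 0 r` omits the centre.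
    rw [intervalIntegral.integral_of_le hr, intervalIntegral.integral_of_le hr]
    exact setIntegral_congr_fun measurableSet_Ioc fun s hs' => hs.mass_balance ht hs'.1
  have hcont : ContinuousOn (fun q : ℝ × ℝ =>
      a q.1 q.2 * curr f q.1 q.2 * q.2 ^ 2 * dr (defect f a β) q.1 q.2)
      (halfStrip (timeInterval T)) :=
    ((hs.regular_a.contDiff.mul hs.regular_f.isCn_curr).mul (isCn_radius.pow 2)).continuousOn.mul
      (hs.isCn_defect.dr_continuousOn hI)
  have hint := intervalIntegrable_slice
    (u := fun t s => a t s * curr f t s * s ^ 2 * dr (defect f a β) t s) hcont ht hr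
  rw [h1, intervalIntegral.integral_add
    (intervalIntegrable_slice (hs.isCn_massFlux.dr_continuousOn hI) ht hr) (hint.const_mul _),
    integral_dr_eq_sub hs.isCn_massFlux hI ht hr, intervalIntegral.integral_const_mul]
  simp [massFlux]
  ring

/-- The transport equation for the constraint defect. -/
theorem defect_transport (hs : IsReducedSolution T f a β) (ht : t ∈ timeInterval T) (hr : 0 < r) :
    dt (timeInterval T) (defect f a β) t r - β t r * dr (defect f a β) t r
      = 4 * Real.pi / r * ∫ s in (0 : ℝ)..r, a t s * curr f t s * s ^ 2
        * dr (defect f a β) t s := by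
  have ha0 := (hs.regular_a.pos t ht r hr.le).ne'
  have hat := eq_add_of_sub_eq (hs.a_eq t ht r hr.le)
  have hbt := eq_add_of_sub_eq (hs.β_eq t ht r hr.le)
  have h1 := hs.dt_mass_eq ht hr.le
  have h2 := ((hs.isCn_Afun.hasDerivWithinAt_dt one_ne_zero ht hr.le).const_sub 1).const_mul r
  have h3 := (timeInterval_uniqueDiffOn T t ht).eq_deriv _ h1 h2
  set Z := ∫ s in (0 : ℝ)..r, a t s * curr f t s * s ^ 2 * dr (defect f a β) t s
  have hr0 := hr.ne'
  have hAt : dt (timeInterval T) (Afun f a β) t r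
      = -(8 * Real.pi * massFlux f a β t r + 4 * Real.pi * Z) / r := by
    rw [h3]; field_simp
  -- All local terms cancel after substitution; only the integral `Z` survives.
  rw [hs.dt_defect ht hr.le, hs.dr_defect ht hr.le, hs.dr_Afun ht hr, hAt, hat, hbt]
  simp only [massSource, massFlux]
  field_simp
  ring

end IsReducedSolution

end Mass

/-! ### Backward characteristics -/

section Characteristics

variable {T : EReal} {f : ℝ → E3 → E3 → ℝ} {a β u : ℝ → ℝ → ℝ} {t r : ℝ}

theorem exists_abs_le_of_continuousOn
    (h : ContinuousOn (fun q : ℝ × ℝ => u q.1 q.2) (halfStrip (timeInterval T)))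
    (ht : t ∈ timeInterval T) (L : ℝ) :
    ∃ K : ℝ, 0 ≤ K ∧ ∀ s ∈ Icc 0 t, ∀ r ∈ Icc 0 L, |u s r| ≤ K := by
  have hc : IsCompact (Icc 0 t ×ˢ Icc 0 L) := isCompact_Icc.prod isCompact_Icc
  obtain ⟨K, hK⟩ := hc.exists_bound_of_continuousOn
    (h.mono (prod_mono (Icc_subset_timeInterval ht) fun r hr => hr.1))
  exact ⟨max K 0, le_max_right _ _, fun s hs r hr =>
    (hK (s, r) ⟨hs, hr⟩).trans (le_max_left _ _)⟩

/-- The source term of the equation for `β`. -/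
def betaSource (f : ℝ → E3 → E3 → ℝ) (a β : ℝ → ℝ → ℝ) (t r : ℝ) : ℝ :=
  4 * Real.pi * r * (radialAvg (massSource f a β) t r + pres f t r)

/-- Along `R' = -β` this says that `β` changes at the rate `betaSource`, which contains no
derivative of `β`. At `r = 0` the convention `x / 0 = 0` gives the intended value of `(1 - A) /
(2r)`. -/
theorem IsReducedSolution.dt_beta (hs : IsReducedSolution T f a β) (ht : t ∈ timeInterval T)
    (hr : 0 ≤ r) :
    dt (timeInterval T) β t r = β t r * dr β t r + betaSource f a β t r := by
  have h := eq_add_of_sub_eq (hs.β_eq t ht r hr)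
  rw [h, Afun_eq, betaSource]
  rcases eq_or_ne r 0 with rfl | hr0
  · simp
  · field_simp
    ring

theorem moment_eq_zero {φ : E3 → ℝ} (h : ∀ v, f t (r • e) v = 0) : moment f φ t r = 0 := by
  simp [moment, h]

/-- The source term of the equation for `β` is bounded, uniformly in the radius. -/
theorem IsReducedSolution.exists_betaSource_le (hs : IsReducedSolution T f a β)
    (ht : t ∈ timeInterval T) :
    ∃ M : ℝ, 0 ≤ M ∧ ∀ s ∈ Icc 0 t, ∀ r, 0 ≤ r → |betaSource f a β s r| ≤ M := by
  obtain ⟨C, hC⟩ := hs.regular_f.support (Icc 0 t) (Icc_subset_timeInterval ht) isCompact_Icc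
  -- A positive radius outside the support of `f` at all times in `Icc 0 t`. Up to `L` compactness
  -- gives the bound; beyond `L` there is vacuum.
  set L : ℝ := max C 0 + 1 with hL
  have hLpos : 0 < L := by positivity
  obtain ⟨K₁, hK₁, hb₁⟩ := exists_abs_le_of_continuousOn hs.isCn_massAvg.continuousOn ht L
  obtain ⟨K₂, hK₂, hb₂⟩ := exists_abs_le_of_continuousOn hs.regular_f.isCn_pres.continuousOn ht L
  have hpi := Real.pi_pos
  refine ⟨4 * Real.pi * L * (K₁ + K₂), by positivity, fun s hs' r hr => ?_⟩
  rcases le_total r L with hrL | hrL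
  · rw [betaSource, abs_mul, abs_of_nonneg (by positivity : 0 ≤ 4 * Real.pi * r)]
    have h1 := hb₁ s hs' r ⟨hr, hrL⟩
    have h2 := hb₂ s hs' r ⟨hr, hrL⟩
    have h3 := abs_add_le (radialAvg (massSource f a β) s r) (pres f s r)
    gcongr
    linarith
  · have hrpos : 0 < r := hLpos.trans_le hrL
    have hvan : ∀ ρ, L ≤ ρ → ∀ v, f s (ρ • e) v = 0 := by
      intro ρ hρ v
      by_contra hne
      have h1 := (hC s hs' _ _ hne).1
      rw [norm_smul_e (hLpos.le.trans hρ)] at h1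
      have := le_max_left C 0
      linarith
    have hsrc : ∀ ρ, L ≤ ρ → massSource f a β s ρ = 0 := by
      intro ρ hρ
      rw [massSource, rho_eq_moment, curr_eq_moment, moment_eq_zero (hvan ρ hρ),
        moment_eq_zero (hvan ρ hρ)]
      ring
    have hp : pres f s r = 0 := by rw [pres_eq_moment, moment_eq_zero (hvan r hrL)]
    have hint : ∀ ρ, 0 ≤ ρ → IntervalIntegrable (fun x => massSource f a β s x * x ^ 2)
        volume 0 ρ := fun ρ hρ => intervalIntegrable_slice
          (u := fun t s => massSource f a β t s * s ^ 2)
          (hs.isCn_massSource.mul (isCn_radius.pow 2)).continuousOn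
          (Icc_subset_timeInterval ht hs') hρ
    -- In vacuum the enclosed mass no longer grows, so `r` times the average decays like `r⁻²` and
    -- is largest at `L`.
    have hmass : r ^ 3 * radialAvg (massSource f a β) s r
        = L ^ 3 * radialAvg (massSource f a β) s L := by
      rw [← radialIntegral_eq, ← radialIntegral_eq, ← intervalIntegral.integral_add_adjacent_intervals
        (hint L hLpos.le) ((hint L hLpos.le).symm.trans (hint r hr))]
      rw [add_eq_left]
      refine (intervalIntegral.integral_congr (g := fun _ => 0) fun x hx => ?_).trans (by simp)
      rw [uIcc_of_le hrL] at hx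
      simp [hsrc x hx.1]
    have havg : r * radialAvg (massSource f a β) s r
        = L * (L / r) ^ 2 * radialAvg (massSource f a β) s L := by
      field_simp
      linarith
    have h1 := hb₁ s hs' L ⟨hLpos.le, le_rfl⟩
    have hle : (L / r) ^ 2 ≤ 1 := pow_le_one₀ (by positivity) ((div_le_one hrpos).2 hrL)
    rw [betaSource, hp, add_zero, mul_assoc, havg, abs_mul,
      abs_of_pos (by positivity : 0 < 4 * Real.pi), abs_mul,
      abs_of_nonneg (by positivity : 0 ≤ L * (L / r) ^ 2)]
    calc 4 * Real.pi * (L * (L / r) ^ 2 * |radialAvg (massSource f a β) s L|)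
        ≤ 4 * Real.pi * (L * 1 * K₁) := by gcongr
      _ ≤ 4 * Real.pi * L * (K₁ + K₂) := by nlinarith [mul_nonneg (mul_pos hpi hLpos).le hK₂]

/-- The restriction of a number to `[0, L]`. -/
def clamp (L r : ℝ) : ℝ := max 0 (min r L)

theorem clamp_mem {L : ℝ} (hL : 0 ≤ L) (r : ℝ) : clamp L r ∈ Icc 0 L :=
  ⟨le_max_left _ _, max_le hL (min_le_right _ _)⟩

theorem clamp_of_mem {L : ℝ} (hr : r ∈ Icc 0 L) : clamp L r = r := by
  rw [clamp, min_eq_left hr.2, max_eq_right hr.1]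

theorem abs_clamp_sub_le (L x y : ℝ) : |clamp L x - clamp L y| ≤ |x - y| := by
  rw [clamp, clamp]
  refine (abs_max_sub_max_le_max _ _ _ _).trans ?_
  rw [sub_self, abs_zero, max_eq_right (abs_nonneg _)]
  refine (abs_min_sub_min_le_max _ _ _ _).trans ?_
  rw [sub_self, abs_zero, max_eq_left (abs_nonneg _)]

/-- Freezing the radius outside `[0, L]` makes the vector field globally Lipschitz and bounded while
leaving it unchanged on `[0, L]`. The Lipschitz constant is a bound of `∂_r u` on a compact set. -/
theorem exists_lipschitz_clamp (hu : IsCn 1 (timeInterval T) u) (ht : t ∈ timeInterval T) {L : ℝ}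
    (hL : 0 ≤ L) :
    ∃ K : NNReal, ∀ s ∈ Icc 0 t, LipschitzWith K (fun r => -u s (clamp L r)) := by
  obtain ⟨K, hK, hb⟩ := exists_abs_le_of_continuousOn
    (hu.dr_continuousOn (timeInterval_uniqueDiffOn T)) ht L
  refine ⟨⟨K, hK⟩, fun s hs => LipschitzWith.of_dist_le_mul fun x y => ?_⟩
  rw [dist_neg_neg, Real.dist_eq, Real.dist_eq]
  have h1 := (convex_Icc 0 L).norm_image_sub_le_of_norm_hasDerivWithin_le
    (f := fun r => u s r) (f' := fun r => dr u s r) (C := K)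
    (fun r hr => (hu.hasDerivWithinAt_dr one_ne_zero (Icc_subset_timeInterval ht hs) hr.1).mono
      fun z hz => hz.1) (fun r hr => hb s hs r hr) (clamp_mem hL y) (clamp_mem hL x)
  rw [Real.norm_eq_abs, Real.norm_eq_abs] at h1
  exact h1.trans (mul_le_mul_of_nonneg_left (abs_clamp_sub_le L x y) hK)

theorem exists_clamped_characteristic (hu : IsCn 1 (timeInterval T) u) (ht : t ∈ timeInterval T)
    {L : ℝ} (hL : 0 ≤ L) (r : ℝ) :
    ∃ R : ℝ → ℝ, R t = r ∧ ∀ s ∈ Icc 0 t,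
      HasDerivWithinAt R (-u s (clamp L (R s))) (Icc 0 t) s := by
  obtain ⟨K, hK⟩ := exists_lipschitz_clamp hu ht hL
  obtain ⟨B, hB, hb⟩ := exists_abs_le_of_continuousOn hu.continuousOn ht L
  -- The initial condition sits at the right end point `t`. With speed at most `B` nothing leaves
  -- the ball of radius `B t`, so one application covers all of `Icc 0 t`.
  have hPL : IsPicardLindelof (fun s r => -u s (clamp L r)) (tmin := 0) (tmax := t)
      ⟨t, ht.1, le_rfl⟩ r ⟨B * t, mul_nonneg hB ht.1⟩ 0 ⟨B, hB⟩ K := by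
    refine ⟨fun s hs => (hK s hs).lipschitzOnWith, fun x _ => ?_, fun s hs x _ => ?_, ?_⟩
    · exact (hu.continuousOn.comp (f := fun s : ℝ => (s, clamp L x)) (by fun_prop)
        fun s hs => ⟨Icc_subset_timeInterval ht hs, (clamp_mem hL x).1⟩).neg
    · rw [norm_neg]; exact hb s hs _ (clamp_mem hL x)
    · simp only [sub_self, sub_zero, max_eq_right ht.1, NNReal.coe_zero]
      exact le_rfl
  exact hPL.exists_eq_forall_mem_Icc_hasDerivWithinAt₀

/-- The characteristic of `∂_t - β ∂_r` through any point exists back to the initial time: along it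
`β` changes at a bounded rate, so that it cannot escape to infinity. -/
theorem IsReducedSolution.exists_characteristic (hs : IsReducedSolution T f a β)
    (ht : t ∈ timeInterval T) (hr : 0 ≤ r) :
    ∃ R : ℝ → ℝ, R t = r ∧ (∀ s ∈ Icc 0 t, 0 ≤ R s) ∧ ∀ s ∈ Icc 0 t,
      HasDerivWithinAt R (-β s (R s)) (Icc 0 t) s := by
  obtain ⟨M, hM, hMb⟩ := hs.exists_betaSource_le ht
  -- A bound of `|β|` along the characteristic: its value at the end point plus the rate `M` times
  -- the elapsed time.
  set B : ℝ := |β t r| + M * t with hBdef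
  have hB : 0 ≤ B := add_nonneg (abs_nonneg _) (mul_nonneg hM ht.1)
  -- Strictly beyond the radius `r + B t` that can be reached backwards at speed `B`, so that the
  -- clamp will turn out to be inactive.
  set L : ℝ := r + B * t + 1 with hLdef
  have hBt : 0 ≤ B * t := mul_nonneg hB ht.1
  have hL : 0 ≤ L := by positivity
  obtain ⟨R, hRt, hR⟩ := exists_clamped_characteristic hs.regular_β.contDiff ht hL r
  obtain ⟨K, hK⟩ := exists_lipschitz_clamp hs.regular_β.contDiff ht hL
  have hRc : ContinuousOn R (Icc 0 t) := fun s hs => (hR s hs).continuousWithinAt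
  -- The centre is an equilibrium, as `β(s, 0) = 0`. A solution that is negative at `s₀` would meet
  -- `0` at a later `s₁`, and backward uniqueness would make it vanish on all of `[s₀, s₁]`.
  have hnonneg : ∀ s ∈ Icc 0 t, 0 ≤ R s := by
    intro s₀ hs₀
    by_contra hneg
    push Not at hneg
    obtain ⟨s₁, hs₁, hRs₁⟩ := intermediate_value_Icc hs₀.2
      (hRc.mono (Icc_subset_Icc_left hs₀.1)) (show (0 : ℝ) ∈ Icc (R s₀) (R t) from
        ⟨hneg.le, by rw [hRt]; exact hr⟩)
    have hs₁t : s₁ ∈ Icc 0 t := ⟨hs₀.1.trans hs₁.1, hs₁.2⟩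
    have hEq : EqOn R (fun _ => 0) (Icc s₀ s₁) := by
      refine ODE_solution_unique_of_mem_Icc_left (v := fun s r => -β s (clamp L r))
        (s := fun _ => univ) (K := K) (fun s hs' => (hK s ⟨hs₀.1.trans hs'.1.le,
          hs'.2.trans hs₁.2⟩).lipschitzOnWith)
        (hRc.mono fun s hs' => ⟨hs₀.1.trans hs'.1, hs'.2.trans hs₁.2⟩) (fun s hs' => ?_)
        (fun _ _ => mem_univ _) continuousOn_const (fun s hs' => ?_) (fun _ _ => mem_univ _) hRs₁
      · have hs't : s ∈ Icc 0 t := ⟨hs₀.1.trans hs'.1.le, hs'.2.trans hs₁.2⟩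
        refine (hR s hs't).mono_of_mem_nhdsWithin ?_
        have h0 : 0 < s := lt_of_le_of_lt hs₀.1 hs'.1
        filter_upwards [self_mem_nhdsWithin, mem_nhdsWithin_of_mem_nhds (Ioi_mem_nhds h0)]
          with z hz hz'
        exact ⟨le_of_lt hz', le_trans hz hs't.2⟩
      · have hs't : s ∈ Icc 0 t := ⟨hs₀.1.trans hs'.1.le, hs'.2.trans hs₁.2⟩
        have : clamp L 0 = 0 := clamp_of_mem ⟨le_rfl, hL⟩
        rw [this, hs.regular_β.at_zero s (Icc_subset_timeInterval ht hs't), neg_zero]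
        exact hasDerivWithinAt_const _ _ _
    have := hEq ⟨le_rfl, hs₁.1⟩
    simp only at this
    linarith
  have hlt : ∀ s ∈ Icc 0 t, R s < L := by
    by_contra hcon
    push Not at hcon
    obtain ⟨s₂, hs₂, hRs₂⟩ := hcon
    have hcomp : IsCompact (Icc 0 t ∩ R ⁻¹' Ici L) :=
      isCompact_Icc.of_isClosed_subset
        (hRc.preimage_isClosed_of_isClosed isClosed_Icc isClosed_Ici) inter_subset_left
    -- The last time at which `R` reaches `L`. From then on `R ≤ L`, so `R` is a true
    -- characteristic, and the bound `B` on its speed contradicts the choice of `L`.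
    obtain ⟨s₁, ⟨hs₁, hRs₁⟩, hmax⟩ := hcomp.exists_isGreatest ⟨s₂, hs₂, hRs₂⟩
    have hRtL : R t < L := by rw [hRt]; linarith
    have hRL : R s₁ = L := by
      obtain ⟨s', hs', hRs'⟩ := intermediate_value_Icc' hs₁.2
        (hRc.mono (Icc_subset_Icc_left hs₁.1)) (show L ∈ Icc (R t) (R s₁) from ⟨hRtL.le, hRs₁⟩)
      have h1 : s' ≤ s₁ := hmax ⟨⟨hs₁.1.trans hs'.1, hs'.2⟩, hRs'.ge⟩
      rw [← le_antisymm h1 hs'.1, hRs']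
    have hle : ∀ s ∈ Icc s₁ t, R s ≤ L := by
      intro s hs'
      rcases eq_or_lt_of_le hs'.1 with h | h
      · rw [← h, hRL]
      · by_contra hc
        push Not at hc
        exact absurd (hmax ⟨⟨hs₁.1.trans hs'.1, hs'.2⟩, hc.le⟩) (not_le.2 h)
    have hsub : Icc s₁ t ⊆ Icc 0 t := Icc_subset_Icc_left hs₁.1
    have hR' : ∀ s ∈ Icc s₁ t, HasDerivWithinAt R (-β s (R s)) (Icc s₁ t) s := by
      intro s hs'
      have := (hR s (hsub hs')).mono hsub
      rwa [clamp_of_mem ⟨hnonneg s (hsub hs'), hle s hs'⟩] at this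
    -- The chain rule along the characteristic cancels the term `β ∂_r β` in the equation for `β`.
    have hb : ∀ s ∈ Icc s₁ t, HasDerivWithinAt (fun s => β s (R s))
        (betaSource f a β s (R s)) (Icc s₁ t) s := by
      intro s hs'
      have hsI := Icc_subset_timeInterval ht (hsub hs')
      have h1 := (hs.regular_β.contDiff.hasFDerivWithinAt one_ne_zero (timeInterval_uniqueDiffOn T)
        hsI (hnonneg s (hsub hs'))).comp_hasDerivWithinAt (f := fun s : ℝ => (s, R s))
        (s := Icc s₁ t) s ((hasDerivWithinAt_id s _).prodMk (hR' s hs'))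
        (fun z hz => ⟨Icc_subset_timeInterval ht (hsub hz), hnonneg z (hsub hz)⟩)
      refine h1.congr_deriv ?_
      rw [lin2_apply, hs.dt_beta hsI (hnonneg s (hsub hs'))]
      ring
    have hts : ∀ s ∈ Icc s₁ t, ‖s - t‖ ≤ t := by
      intro s hs'
      rw [Real.norm_eq_abs, abs_le]
      constructor <;> linarith [hs'.1, hs'.2, hs₁.1]
    have hbB : ∀ s ∈ Icc s₁ t, |β s (R s)| ≤ B := by
      intro s hs'
      have h1 := (convex_Icc s₁ t).norm_image_sub_le_of_norm_hasDerivWithin_le hb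
        (fun z hz => hMb z (hsub hz) _ (hnonneg z (hsub hz))) (right_mem_Icc.2 hs₁.2) hs'
      rw [hRt] at h1
      have h2 : M * ‖s - t‖ ≤ M * t := mul_le_mul_of_nonneg_left (hts s hs') hM
      have h3 := abs_sub_abs_le_abs_sub (β s (R s)) (β t r)
      rw [Real.norm_eq_abs] at h1
      rw [hBdef]
      linarith
    have h1 := (convex_Icc s₁ t).norm_image_sub_le_of_norm_hasDerivWithin_le hR'
      (fun z hz => by rw [norm_neg]; exact hbB z hz) (right_mem_Icc.2 hs₁.2)
      (left_mem_Icc.2 hs₁.2)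
    have h2 : B * ‖s₁ - t‖ ≤ B * t := mul_le_mul_of_nonneg_left (hts s₁ (left_mem_Icc.2 hs₁.2)) hB
    rw [hRL, hRt, Real.norm_eq_abs] at h1
    have h3 := le_abs_self (L - r)
    linarith
  refine ⟨R, hRt, hnonneg, fun s hs' => ?_⟩
  have := hR s hs'
  rwa [clamp_of_mem ⟨hnonneg s hs', (hlt s hs').le⟩] at this

end Characteristics

/-! ### The constraint is propagated -/

section Constraint

variable {T : EReal} {f : ℝ → E3 → E3 → ℝ} {a β : ℝ → ℝ → ℝ} {t r : ℝ}

namespace IsReducedSolution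

theorem defect_zero (hs : IsReducedSolution T f a β) (ht : t ∈ timeInterval T) :
    defect f a β t 0 = 0 := by
  rw [defect, Afun_zero, hs.regular_a.at_zero t ht, hs.regular_β.at_zero t ht]; norm_num

theorem defect_initial (hs : IsReducedSolution T f a β) (hr : 0 ≤ r) : defect f a β 0 r = 0 := by
  have h : Afun f a β 0 r = 1 / a 0 r ^ 2 - β 0 r ^ 2 := hs.data.constraint r hr
  rw [defect, h]; ring

/-- At a radius where the defect is largest among all smaller radii, the nonlocal source of its
transport equation is controlled by the defect itself. -/
theorem exists_defect_source_le (hs : IsReducedSolution T f a β) (ht : t ∈ timeInterval T)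
    {L : ℝ} (hL : 0 ≤ L) :
    ∃ K : ℝ, 0 ≤ K ∧ ∀ s ∈ Icc 0 t, ∀ r ∈ Ioc 0 L,
      (∀ r' ∈ Icc 0 r, |defect f a β s r'| ≤ |defect f a β s r|) →
      |dt (timeInterval T) (defect f a β) s r - β s r * dr (defect f a β) s r|
        ≤ K * |defect f a β s r| := by
  have hI := timeInterval_uniqueDiffOn T
  have hk : IsCn 1 (timeInterval T) (fun t r => a t r * curr f t r) :=
    hs.regular_a.contDiff.mul hs.regular_f.isCn_curr
  obtain ⟨K₁, hK₁, hb₁⟩ := exists_abs_le_of_continuousOn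
    (u := fun t r => a t r * curr f t r) hk.continuousOn ht L
  obtain ⟨K₂, hK₂, hb₂⟩ := exists_abs_le_of_continuousOn (hk.dr_continuousOn hI) ht L
  have hpi := Real.pi_pos
  -- The first summand comes from the boundary term of the integration by parts; the second, `(K₂ L
  -- + 2 K₁) L`, bounds `∂_r (a j r²)`.
  refine ⟨4 * Real.pi * (K₁ * L + (K₂ * L + 2 * K₁) * L), by positivity,
    fun s hs' r hr hmax => ?_⟩
  have hsI := Icc_subset_timeInterval ht hs'
  set D := defect f a β with hD
  set W : ℝ → ℝ → ℝ := fun t r => a t r * curr f t r * r ^ 2 with hW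
  have hWc : IsCn 1 (timeInterval T) W := hk.mul (isCn_radius.pow 2)
  have hWD : IsCn 1 (timeInterval T) (fun t r => W t r * D t r) := hWc.mul hs.isCn_defect
  have hdW : ∀ x, 0 ≤ x → dr W s x
      = dr (fun t r => a t r * curr f t r) s x * x ^ 2 + a s x * curr f s x * (2 * x) := by
    intro x hx
    refine dr_eq hx (((hk.hasDerivWithinAt_dr one_ne_zero hsI hx).mul
      ((hasDerivWithinAt_id x (Ici 0)).pow 2)).congr_deriv ?_)
    simp
  have hdWD : ∀ x, 0 ≤ x → dr (fun t r => W t r * D t r) s x = dr W s x * D s x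
      + W s x * dr D s x := fun x hx =>
    dr_eq hx ((hWc.hasDerivWithinAt_dr one_ne_zero hsI hx).mul
      (hs.isCn_defect.hasDerivWithinAt_dr one_ne_zero hsI hx))
  have hc1 : ContinuousOn (fun q : ℝ × ℝ => dr W q.1 q.2 * D q.1 q.2)
      (halfStrip (timeInterval T)) := (hWc.dr_continuousOn hI).mul hs.isCn_defect.continuousOn
  have hc2 : ContinuousOn (fun q : ℝ × ℝ => W q.1 q.2 * dr D q.1 q.2)
      (halfStrip (timeInterval T)) := hWc.continuousOn.mul (hs.isCn_defect.dr_continuousOn hI)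
  -- The derivative is moved off the defect, since only the defect itself is to be estimated. The
  -- factor `r²` in `W` kills the boundary term at the centre.
  have hparts : ∫ x in (0 : ℝ)..r, W s x * dr D s x
      = W s r * D s r - ∫ x in (0 : ℝ)..r, dr W s x * D s x := by
    have h1 := integral_dr_eq_sub hWD hI hsI hr.1.le
    have h2 : ∫ x in (0 : ℝ)..r, dr (fun t r => W t r * D t r) s x
        = ∫ x in (0 : ℝ)..r, (dr W s x * D s x + W s x * dr D s x) := by
      refine intervalIntegral.integral_congr fun x hx => ?_
      rw [uIcc_of_le hr.1.le] at hx
      exact hdWD x hx.1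
    rw [h2, intervalIntegral.integral_add
      (intervalIntegrable_slice (u := fun t r => dr W t r * D t r) hc1 hsI hr.1.le)
      (intervalIntegrable_slice (u := fun t r => W t r * dr D t r) hc2 hsI hr.1.le)] at h1
    have hW0 : W s 0 = 0 := by simp [hW]
    rw [hW0] at h1
    linarith
  -- A factor `r` is kept here, and by the length of the interval in `hint`, to cancel the `1/r` in
  -- front of the integral.
  have hWr : |W s r| ≤ K₁ * L * r := by
    simp only [hW]
    rw [abs_mul, abs_of_nonneg (sq_nonneg r), sq, ← mul_assoc]
    have h1 := hb₁ s hs' r ⟨hr.1.le, hr.2⟩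
    have h0 := hr.1.le
    have h2 := hr.2
    gcongr
  have hint : |∫ x in (0 : ℝ)..r, dr W s x * D s x|
      ≤ (K₂ * L + 2 * K₁) * L * |D s r| * |r - 0| := by
    rw [← Real.norm_eq_abs]
    refine intervalIntegral.norm_integral_le_of_norm_le_const fun x hx => ?_
    rw [uIoc_of_le hr.1.le] at hx
    have hx0 := hx.1.le
    have hxL : x ≤ L := hx.2.trans hr.2
    rw [hdW x hx0, norm_mul, Real.norm_eq_abs, Real.norm_eq_abs]
    have h1 := hb₁ s hs' x ⟨hx0, hxL⟩
    have h2 := hb₂ s hs' x ⟨hx0, hxL⟩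
    refine mul_le_mul ?_ (hmax x ⟨hx0, hx.2⟩) (abs_nonneg _) (by positivity)
    refine (abs_add_le _ _).trans ?_
    rw [abs_mul, abs_mul _ (2 * x), abs_of_nonneg (sq_nonneg x),
      abs_of_nonneg (by positivity : 0 ≤ 2 * x)]
    calc |dr (fun t r => a t r * curr f t r) s x| * x ^ 2 + |a s x * curr f s x| * (2 * x)
        ≤ K₂ * L ^ 2 + K₁ * (2 * L) := by gcongr
      _ = (K₂ * L + 2 * K₁) * L := by ring
  rw [hs.defect_transport hsI hr.1, hparts, abs_mul, abs_of_pos (div_pos (by positivity) hr.1)]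
  rw [sub_zero, abs_of_pos hr.1] at hint
  have hsum : |W s r * D s r - ∫ x in (0 : ℝ)..r, dr W s x * D s x|
      ≤ (K₁ * L + (K₂ * L + 2 * K₁) * L) * |D s r| * r := by
    refine (abs_sub _ _).trans ?_
    rw [abs_mul]
    have := mul_le_mul_of_nonneg_right hWr (abs_nonneg (D s r))
    linarith
  rw [div_mul_eq_mul_div, div_le_iff₀ hr.1]
  have := mul_le_mul_of_nonneg_left hsum (by positivity : 0 ≤ 4 * Real.pi)
  linarith

/-- The constraint holds for all times. -/
theorem defect_eq_zero (hs : IsReducedSolution T f a β) (ht : t ∈ timeInterval T) (hr : 0 ≤ r) :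
    defect f a β t r = 0 := by
  obtain ⟨R, hRt, hR0, hR⟩ := hs.exists_characteristic ht hr
  have hI := timeInterval_uniqueDiffOn T
  have hRc : ContinuousOn R (Icc 0 t) := fun s hs => (hR s hs).continuousWithinAt
  set D := defect f a β with hD
  -- The region below the characteristic, written as the continuous image of a rectangle, so that it
  -- is compact even where `R` vanishes.
  set Ω : Set (ℝ × ℝ) := (fun z : ℝ × ℝ => (z.1, z.2 * R z.1)) '' (Icc 0 t ×ˢ Icc 0 1) with hΩ
  have hmemΩ : ∀ s ρ, (s, ρ) ∈ Ω ↔ s ∈ Icc 0 t ∧ 0 ≤ ρ ∧ ρ ≤ R s := by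
    intro s ρ
    constructor
    · rintro ⟨⟨s', σ⟩, ⟨hs', hσ⟩, h⟩
      simp only [Prod.mk.injEq] at h
      obtain ⟨rfl, rfl⟩ := h
      exact ⟨hs', mul_nonneg hσ.1 (hR0 _ hs'), mul_le_of_le_one_left (hR0 _ hs') hσ.2⟩
    · rintro ⟨hs', h0, h1⟩
      rcases eq_or_lt_of_le (hR0 s hs') with hz | hz
      · refine ⟨(s, 0), ⟨hs', by simp⟩, ?_⟩
        have : ρ = 0 := le_antisymm (h1.trans hz.ge) h0
        simp [this]
      · refine ⟨(s, ρ / R s), ⟨hs', by positivity, (div_le_one hz).2 h1⟩, ?_⟩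
        simp only [Prod.mk.injEq, true_and]
        field_simp
  have hΩc : IsCompact Ω := by
    refine (isCompact_Icc.prod isCompact_Icc).image_of_continuousOn ?_
    exact continuousOn_fst.prodMk (continuousOn_snd.mul
      (hRc.comp continuousOn_fst fun z hz => hz.1))
  have hΩsub : Ω ⊆ halfStrip (timeInterval T) := by
    rintro ⟨s, ρ⟩ h
    rw [hmemΩ] at h
    exact ⟨Icc_subset_timeInterval ht h.1, h.2.1⟩
  obtain ⟨L, hLub⟩ := (isCompact_Icc.image_of_continuousOn hRc).bddAbove
  have hRL : ∀ s ∈ Icc 0 t, R s ≤ L := fun s hs' => hLub ⟨s, hs', rfl⟩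
  have hL : 0 ≤ L := (hR0 t ⟨ht.1, le_rfl⟩).trans (hRL t ⟨ht.1, le_rfl⟩)
  obtain ⟨K, hK, hKb⟩ := hs.exists_defect_source_le ht hL
  -- The source lets `D²` grow at a rate of at most `2K` at the relevant points; the weight `exp(-c
  -- s)` decays strictly faster.
  set c : ℝ := 2 * (K + 1) with hc
  have hcont : ContinuousOn (fun q : ℝ × ℝ => Real.exp (-c * q.1) * D q.1 q.2 ^ 2) Ω :=
    (Continuous.continuousOn (by fun_prop)).mul ((hs.isCn_defect.continuousOn.mono hΩsub).pow 2)
  have hmemtr : ((t, r) : ℝ × ℝ) ∈ Ω := (hmemΩ t r).2 ⟨⟨ht.1, le_rfl⟩, hr, hRt.ge⟩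
  obtain ⟨⟨s₀, r₀⟩, hmem₀, hmax⟩ := hΩc.exists_isMaxOn ⟨_, hmemtr⟩ hcont
  have hmax' : ∀ s ρ, (s, ρ) ∈ Ω →
      Real.exp (-c * s) * D s ρ ^ 2 ≤ Real.exp (-c * s₀) * D s₀ r₀ ^ 2 := fun s ρ h => hmax h
  obtain ⟨hs₀, hr₀, hrR₀⟩ := (hmemΩ s₀ r₀).1 hmem₀
  have hs₀I := Icc_subset_timeInterval ht hs₀
  suffices hz : D s₀ r₀ = 0 by
    have h1 := hmax' t r hmemtr
    rw [hz] at h1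
    have h2 : Real.exp (-c * t) * D t r ^ 2 ≤ 0 := by simpa using h1
    have h3 : D t r ^ 2 ≤ 0 := by
      by_contra hcon
      push Not at hcon
      exact absurd h2 (not_le.2 (mul_pos (Real.exp_pos _) hcon))
    exact pow_eq_zero_iff two_ne_zero |>.1 (le_antisymm h3 (sq_nonneg _))
  by_contra hne
  have hs₀pos : 0 < s₀ := by
    refine lt_of_le_of_ne hs₀.1 fun h => hne ?_
    rw [← h]; exact hs.defect_initial hr₀
  have hr₀pos : 0 < r₀ := by
    refine lt_of_le_of_ne hr₀ fun h => hne ?_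
    rw [← h]; exact hs.defect_zero hs₀I
  -- `Ω` contains the whole radial segment below `(s₀, r₀)`, on which the weight is constant; so the
  -- maximum point meets the hypothesis of the source estimate.
  have hloc : ∀ r' ∈ Icc 0 r₀, |D s₀ r'| ≤ |D s₀ r₀| := by
    intro r' hr'
    have h1 := hmax' s₀ r' ((hmemΩ _ _).2 ⟨hs₀, hr'.1, hr'.2.trans hrR₀⟩)
    exact sq_le_sq.1 (le_of_mul_le_mul_left h1 (Real.exp_pos _))
  have hsource := hKb s₀ hs₀ r₀ ⟨hr₀pos, hrR₀.trans (hRL s₀ hs₀)⟩ hloc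
  have hsub : Icc 0 s₀ ⊆ Icc 0 t := Icc_subset_Icc_right hs₀.2
  -- A curve into the past that stays in `Ω` and has velocity `-β` at `s₀`: the characteristic `R`
  -- itself when the maximum lies on the outer boundary, and a straight line otherwise. Only its
  -- derivative at `s₀` matters.
  obtain ⟨γ, hγ₀, hγd, hγΩ⟩ : ∃ γ : ℝ → ℝ, γ s₀ = r₀ ∧
      HasDerivWithinAt γ (-β s₀ r₀) (Icc 0 s₀) s₀ ∧
      ∀ᶠ s in 𝓝[Icc 0 s₀] s₀, (s, γ s) ∈ Ω := by
    rcases eq_or_lt_of_le hrR₀ with h | h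
    · refine ⟨R, h.symm, ?_, ?_⟩
      · rw [h]; exact (hR s₀ hs₀).mono hsub
      · filter_upwards [self_mem_nhdsWithin] with s hs'
        exact (hmemΩ _ _).2 ⟨hsub hs', hR0 s (hsub hs'), le_rfl⟩
    · refine ⟨fun s => r₀ + (-β s₀ r₀) * (s - s₀), by simp, ?_, ?_⟩
      · have := (((hasDerivAt_id s₀).sub_const s₀).const_mul (-β s₀ r₀)).const_add r₀
        simpa using this.hasDerivWithinAt
      · have hγc : ContinuousWithinAt (fun s => r₀ + (-β s₀ r₀) * (s - s₀)) (Icc 0 s₀) s₀ :=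
          Continuous.continuousWithinAt (by fun_prop)
        have h1 : ∀ᶠ s in 𝓝[Icc 0 s₀] s₀, 0 < r₀ + (-β s₀ r₀) * (s - s₀) :=
          continuousWithinAt_const.eventually_lt hγc (by simpa using hr₀pos)
        have h2 : ∀ᶠ s in 𝓝[Icc 0 s₀] s₀, r₀ + (-β s₀ r₀) * (s - s₀) < R s :=
          hγc.eventually_lt ((hRc s₀ hs₀).mono hsub) (by simpa using h)
        filter_upwards [self_mem_nhdsWithin, h1, h2] with s hs' h1 h2
        exact (hmemΩ _ _).2 ⟨hsub hs', h1.le, h2.le⟩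
  have hN : {s | (s, γ s) ∈ Ω} ∩ Icc 0 s₀ ∈ 𝓝[Icc 0 s₀] s₀ :=
    inter_mem hγΩ self_mem_nhdsWithin
  have hDγ : HasDerivWithinAt (fun s => D s (γ s))
      (dt (timeInterval T) D s₀ r₀ - β s₀ r₀ * dr D s₀ r₀) (Icc 0 s₀) s₀ := by
    have h1 := hs.isCn_defect.hasFDerivWithinAt one_ne_zero hI hs₀I hr₀
    rw [← hγ₀] at h1
    have h2 := h1.comp_hasDerivWithinAt (f := fun s : ℝ => (s, γ s))
      (s := {s | (s, γ s) ∈ Ω} ∩ Icc 0 s₀) s₀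
      ((hasDerivWithinAt_id s₀ _).prodMk (hγd.mono inter_subset_right))
      (fun z hz => hΩsub hz.1)
    refine (h2.mono_of_mem_nhdsWithin hN).congr_deriv ?_
    rw [lin2_apply, hγ₀]
    ring
  have hexp : HasDerivWithinAt (fun s => Real.exp (-c * s)) (Real.exp (-c * s₀) * (-c))
      (Icc 0 s₀) s₀ := by
    simpa using (((hasDerivAt_id s₀).const_mul (-c)).exp).hasDerivWithinAt
  have hΨ := (hexp.mul (hDγ.pow 2)).hasFDerivWithinAt
  have hlm : IsLocalMaxOn ((fun s => Real.exp (-c * s)) * (fun s => D s (γ s)) ^ 2)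
      (Icc 0 s₀) s₀ := by
    filter_upwards [hγΩ] with s hs'
    simpa [hγ₀] using hmax' s (γ s) hs'
  -- The maximum is compared with earlier times only, which also covers `s₀ = t`; the derivative of
  -- the weighted square along `γ` is then nonnegative at `s₀`.
  have hcone : (0 : ℝ) - s₀ ∈ posTangentConeAt (Icc 0 s₀) s₀ := by
    refine sub_mem_posTangentConeAt_of_segment_subset ?_
    rw [segment_symm, segment_eq_Icc hs₀pos.le]
  have hfin := hlm.hasFDerivWithinAt_nonpos hΨ hcone
  simp only [ContinuousLinearMap.toSpanSingleton_apply, Pi.pow_apply, hγ₀, smul_eq_mul] at hfin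
  set d := dt (timeInterval T) D s₀ r₀ - β s₀ r₀ * dr D s₀ r₀ with hd
  have hE := Real.exp_pos (-c * s₀)
  generalize Real.exp (-c * s₀) = E at hfin hE
  rw [hc] at hfin
  -- The sign of the derivative reads `-c D² + 2 D d ≥ 0` with `c = 2 (K + 1)`. Against `|d| ≤ K
  -- |D|` this forces `D = 0`.
  have hineq : (K + 1) * D s₀ r₀ ^ 2 ≤ D s₀ r₀ * d := by
    by_contra hcon
    push Not at hcon
    have h1 := mul_pos (mul_pos hs₀pos hE) (sub_pos.2 hcon)
    norm_num at hfin
    nlinarith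
  have h1 : D s₀ r₀ * d ≤ K * D s₀ r₀ ^ 2 := by
    calc D s₀ r₀ * d ≤ |D s₀ r₀| * |d| := by rw [← abs_mul]; exact le_abs_self _
      _ ≤ |D s₀ r₀| * (K * |D s₀ r₀|) := mul_le_mul_of_nonneg_left hsource (abs_nonneg _)
      _ = K * D s₀ r₀ ^ 2 := by rw [← sq_abs (D s₀ r₀)]; ring
  have h2 : 0 < D s₀ r₀ ^ 2 := by positivity
  linarith

end IsReducedSolution

end Constraint

/-! ### Consequences of the constraint -/

section Consequences

variable {T : EReal} {f : ℝ → E3 → E3 → ℝ} {a β : ℝ → ℝ → ℝ} {t r : ℝ}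

namespace IsReducedSolution

theorem Afun_eq_metric (hs : IsReducedSolution T f a β) (ht : t ∈ timeInterval T) (hr : 0 ≤ r) :
    Afun f a β t r = 1 / a t r ^ 2 - β t r ^ 2 := by
  have h := hs.defect_eq_zero ht hr
  rw [defect] at h
  rw [one_div]
  linarith

theorem dr_defect_eq_zero (hs : IsReducedSolution T f a β) (ht : t ∈ timeInterval T)
    (hr : 0 ≤ r) : dr (defect f a β) t r = 0 := by
  refine dr_eq hr ((hasDerivWithinAt_const r (Ici 0) (0 : ℝ)).congr (fun s hs' => ?_) ?_)
  · exact hs.defect_eq_zero ht hs'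
  · exact hs.defect_eq_zero ht hr

/-- The evolution equation of the mass function. -/
theorem hasDerivWithinAt_mass (hs : IsReducedSolution T f a β) (ht : t ∈ timeInterval T)
    (hr : 0 ≤ r) :
    HasDerivWithinAt (fun s => r * (1 - Afun f a β s r))
      (8 * Real.pi * r ^ 2 * (β t r * (rho f t r + pres f t r)
        - (a t r * β t r ^ 2 + (a t r)⁻¹) * curr f t r)) (timeInterval T) t := by
  refine (hs.dt_mass_eq ht hr).congr_deriv ?_
  have h0 : ∫ s in (0 : ℝ)..r, a t s * curr f t s * s ^ 2 * dr (defect f a β) t s = 0 := by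
    refine (intervalIntegral.integral_congr (g := fun _ => 0) fun s hs' => ?_).trans (by simp)
    rw [uIcc_of_le hr] at hs'
    simp only [hs.dr_defect_eq_zero ht hs'.1, mul_zero]
  rw [h0, massFlux]
  ring

/-- The original Vlasov equation. -/
theorem original_vlasov (hs : IsReducedSolution T f a β) : Vlasov (timeInterval T) f a β := by
  intro t ht x v hx
  have hr : 0 < ‖x‖ := norm_pos_iff.2 hx
  have ha := (hs.regular_a.pos t ht ‖x‖ hr.le).ne'
  have h := hs.vlasov t ht x v hx
  have hat := eq_add_of_sub_eq (hs.a_eq t ht ‖x‖ hr.le)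
  dsimp only at h ⊢
  -- The two equations differ only in the momentum coefficient, and the equation for `a` gives `β
  -- ∂_r a / a - ∂_t a / a = 4π r a j`.
  convert h using 2
  rw [hat, smul_sub, smul_smul]
  rw [add_sub, sub_eq_add_neg, add_right_comm, ← neg_smul, ← add_smul, ← add_smul]
  congr 2
  field_simp
  ring

/-- The mass equation divided by `r`, with the constant value `A = 1` taking care of the centre. No
derivatives appear on the right, so `∂_t A` is as regular as `a`, `β` and the matter terms. -/
theorem dt_Afun (hs : IsReducedSolution T f a β) (ht : t ∈ timeInterval T) (hr : 0 ≤ r) :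
    dt (timeInterval T) (Afun f a β) t r = -(8 * Real.pi * r * (β t r * (rho f t r + pres f t r)
        - (a t r * β t r ^ 2 + (a t r)⁻¹) * curr f t r)) := by
  rcases eq_or_lt_of_le hr with rfl | hpos
  · refine dt_eq (timeInterval_uniqueDiffOn T) ht ?_
    simp only [Afun_zero]
    simpa using hasDerivWithinAt_const t (timeInterval T) (1 : ℝ)
  · have h1 := hs.hasDerivWithinAt_mass ht hr
    have h2 := ((hs.isCn_Afun.hasDerivWithinAt_dt one_ne_zero ht hr).const_sub 1).const_mul r
    have h3 := (timeInterval_uniqueDiffOn T t ht).eq_deriv _ h1 h2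
    have h4 : r * (dt (timeInterval T) (Afun f a β) t r + (8 * Real.pi * r *
        (β t r * (rho f t r + pres f t r)
          - (a t r * β t r ^ 2 + (a t r)⁻¹) * curr f t r))) = 0 := by linarith
    rcases mul_eq_zero.1 h4 with h | h
    · exact absurd h hpos.ne'
    · linarith

/-- In contrast to `dr_Afun` this form has no division by `r` and is valid at the centre, as needed
for regularity up to the boundary. -/
theorem dr_Afun_eq (hs : IsReducedSolution T f a β) (ht : t ∈ timeInterval T) (hr : 0 ≤ r) :
    dr (Afun f a β) t r
      = 8 * Real.pi * r * (radialAvg (massSource f a β) t r - massSource f a β t r) := by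
  rcases eq_or_lt_of_le hr with rfl | hpos
  · have h1 := ((hasDerivWithinAt_id (0 : ℝ) (Ici 0)).pow 2).mul
      (hs.isCn_massAvg.hasDerivWithinAt_dr one_ne_zero ht le_rfl)
    have h2 := (h1.const_mul (8 * Real.pi)).const_sub 1
    refine dr_eq le_rfl ((h2.congr (fun s _ => ?_) ?_).congr_deriv ?_)
    · exact Afun_eq f a β t s
    · exact Afun_eq f a β t 0
    · simp
  · rw [hs.dr_Afun ht hpos, Afun_eq]
    field_simp
    ring

/-- Both partial derivatives of `A` are given by expressions in `C^1` functions that contain no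
derivatives: this is where a derivative is gained. -/
theorem isCn_two_Afun (hs : IsReducedSolution T f a β) : IsCn 2 (timeInterval T) (Afun f a β) := by
  have hρ := hs.regular_f.isCn_rho
  have hp := hs.regular_f.isCn_pres
  have hj := hs.regular_f.isCn_curr
  refine hs.isCn_Afun.succ_of_partials (n := 1) (timeInterval_uniqueDiffOn T) ?_ ?_
  · have h : IsCn 1 (timeInterval T) (fun t r => (-(8 * Real.pi)) * r *
        (β t r * (rho f t r + pres f t r) - (a t r * β t r ^ 2 + (a t r)⁻¹) * curr f t r)) :=
      ((isCn_const _).mul isCn_radius).mul ((hs.regular_β.contDiff.mul (hρ.add hp)).sub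
        (((hs.regular_a.contDiff.mul (hs.regular_β.contDiff.pow 2)).add hs.isCn_a_inv).mul hj))
    refine h.congr fun t ht r hr => ?_
    rw [hs.dt_Afun ht hr]
    ring
  · have h : IsCn 1 (timeInterval T) (fun t r => 8 * Real.pi * r *
        (radialAvg (massSource f a β) t r - massSource f a β t r)) :=
      ((isCn_const _).mul isCn_radius).mul (hs.isCn_massAvg.sub hs.isCn_massSource)
    exact h.congr fun t ht r hr => hs.dr_Afun_eq ht hr

theorem isCn_betaSource (hs : IsReducedSolution T f a β) :
    IsCn 1 (timeInterval T) (betaSource f a β) :=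
  ((isCn_const _).mul isCn_radius).mul (hs.isCn_massAvg.add hs.regular_f.isCn_pres)

/-- `∂_r β` is `C^1` by assumption, and the evolution equation expresses `∂_t β` through it and a
`C^1` source. -/
theorem isCn_two_beta (hs : IsReducedSolution T f a β) : IsCn 2 (timeInterval T) β := by
  refine hs.regular_β.contDiff.succ_of_partials (n := 1) (timeInterval_uniqueDiffOn T) ?_
    hs.regular_β.contDiff_dr
  exact ((hs.regular_β.contDiff.mul hs.regular_β.contDiff_dr).add hs.isCn_betaSource).congr
    fun t ht r hr => hs.dt_beta ht hr

/-- The constraint recovers `a` from `A` and `β`, which gains a derivative. -/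
theorem isCn_two_a (hs : IsReducedSolution T f a β) : IsCn 2 (timeInterval T) a := by
  have heq : ∀ t ∈ timeInterval T, ∀ r, 0 ≤ r →
      Afun f a β t r + β t r ^ 2 = (a t r ^ 2)⁻¹ := by
    intro t ht r hr
    rw [hs.Afun_eq_metric ht hr]
    ring
  have hne : ∀ t ∈ timeInterval T, ∀ r, 0 ≤ r → Afun f a β t r + β t r ^ 2 ≠ 0 := by
    intro t ht r hr
    rw [heq t ht r hr]
    have := hs.regular_a.pos t ht r hr
    positivity
  have h1 : IsCn 2 (timeInterval T) (fun t r => Afun f a β t r + β t r ^ 2) :=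
    hs.isCn_two_Afun.add (hs.isCn_two_beta.pow 2)
  have h2 : IsCn 2 (timeInterval T) (fun t r => (Real.sqrt (Afun f a β t r + β t r ^ 2))⁻¹) :=
    (h1.sqrt hne).inv fun t ht r hr => by
      rw [heq t ht r hr]
      have := hs.regular_a.pos t ht r hr
      positivity
  refine h2.congr fun t ht r hr => ?_
  rw [heq t ht r hr, Real.sqrt_inv, inv_inv, Real.sqrt_sq (hs.regular_a.pos t ht r hr).le]

end IsReducedSolution

end Consequences

/-! ### Curvature of the Painlevé-Gullstrand metric -/

section Curvature

variable {I : Set ℝ} {a β : ℝ → ℝ → ℝ} {X : Fin 4 → ℝ}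

/-- Partial derivatives of a function of the form `k(t, r) S(θ)` on the chart. -/
theorem partialD_eq (hI : UniqueDiffOn ℝ I) (hX : X ∈ chart I) {h : (Fin 4 → ℝ) → ℝ}
    {k : ℝ → ℝ → ℝ} {S : ℝ → ℝ} {kt kr S' : ℝ}
    (hh : ∀ Y ∈ chart I, h Y = k (Y 0) (Y 1) * S (Y 2))
    (ht : HasDerivWithinAt (fun s => k s (X 1)) kt I (X 0))
    (hr : HasDerivAt (fun s => k (X 0) s) kr (X 1)) (hS : HasDerivAt S S' (X 2)) (μ : Fin 4) :
    partialD (chart I) μ h X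
      = ![kt * S (X 2), kr * S (X 2), k (X 0) (X 1) * S', 0] μ := by
  obtain ⟨h0, h1, h2, h3⟩ := hX
  have hself : ∀ i, Function.update X i (X i) ∈ chart I := fun i => by
    rw [Function.update_eq_self]; exact ⟨h0, h1, h2, h3⟩
  -- Varying a single coordinate, the chart cuts out `I`, `]0, ∞[`, `]0, π[` and `ℝ`. Only the time
  -- derivative can be one-sided.
  fin_cases μ
  · have hset : {s | Function.update X 0 s ∈ chart I} = I := by
      ext s; simp [chart, h1, h2, h3]
    simp only [partialD, Fin.zero_eta, hset]
    refine HasDerivWithinAt.derivWithin ?_ (hI _ h0)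
    refine (ht.mul_const (S (X 2))).congr (fun s hs => ?_) ?_
    · rw [hh _ (hset.symm ▸ hs : s ∈ {s | Function.update X 0 s ∈ chart I})]
      simp
    · rw [hh _ (hself 0)]
      simp
  · have hset : {s | Function.update X 1 s ∈ chart I} = Ioi 0 := by
      ext s; simp [chart, h0, h2, h3]
    simp only [partialD, Fin.mk_one, hset]
    refine HasDerivWithinAt.derivWithin ?_ (isOpen_Ioi.uniqueDiffWithinAt h1)
    refine (hr.mul_const (S (X 2))).hasDerivWithinAt.congr (fun s hs => ?_) ?_
    · rw [hh _ (hset.symm ▸ hs : s ∈ {s | Function.update X 1 s ∈ chart I})]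
      simp
    · rw [hh _ (hself 1)]
      simp
  · have hset : {s | Function.update X 2 s ∈ chart I} = Ioo 0 Real.pi := by
      ext s; simp [chart, h0, h1]
    simp only [partialD, Fin.reduceFinMk, hset]
    refine HasDerivWithinAt.derivWithin ?_ (isOpen_Ioo.uniqueDiffWithinAt ⟨h2, h3⟩)
    refine (hS.const_mul (k (X 0) (X 1))).hasDerivWithinAt.congr (fun s hs => ?_) ?_
    · rw [hh _ (hset.symm ▸ hs : s ∈ {s | Function.update X 2 s ∈ chart I})]
      simp
    · rw [hh _ (hself 2)]
      simp
  · have hset : {s | Function.update X 3 s ∈ chart I} = univ := by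
      ext s; simp [chart, h0, h1, h2, h3]
    simp only [partialD, Fin.reduceFinMk, hset]
    refine HasDerivWithinAt.derivWithin ?_ uniqueDiffWithinAt_univ
    refine (hasDerivWithinAt_const (X 3) univ (h X)).congr (fun s hs => ?_) ?_
    · rw [hh _ (hset.symm ▸ hs : s ∈ {s | Function.update X 3 s ∈ chart I}),
        hh X ⟨h0, h1, h2, h3⟩]
      simp
    · rw [hh _ (hself 3), hh X ⟨h0, h1, h2, h3⟩]
      simp

/-- The metric coefficients without their dependence on `θ`. -/
def metricTab (A B r : ℝ) : Matrix (Fin 4) (Fin 4) ℝ :=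
  !![-1 + A ^ 2 * B ^ 2, A ^ 2 * B, 0, 0; A ^ 2 * B, A ^ 2, 0, 0; 0, 0, r ^ 2, 0; 0, 0, 0, r ^ 2]

/-- The derivative of `metricTab` along a curve. -/
def metricTab' (A B r A' B' r' : ℝ) : Matrix (Fin 4) (Fin 4) ℝ :=
  !![2 * A * B * (A' * B + A * B'), 2 * A * A' * B + A ^ 2 * B', 0, 0;
    2 * A * A' * B + A ^ 2 * B', 2 * A * A', 0, 0; 0, 0, 2 * r * r', 0; 0, 0, 0, 2 * r * r']

/-- The dependence of the metric coefficients on `θ`. -/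
def metricAng (θ : ℝ) : Matrix (Fin 4) (Fin 4) ℝ :=
  !![1, 1, 1, 1; 1, 1, 1, 1; 1, 1, 1, 1; 1, 1, 1, Real.sin θ ^ 2]

/-- The derivative of `metricAng`. -/
def metricAng' (θ : ℝ) : Matrix (Fin 4) (Fin 4) ℝ :=
  !![0, 0, 0, 0; 0, 0, 0, 0; 0, 0, 0, 0; 0, 0, 0, 2 * Real.sin θ * Real.cos θ]

theorem pgMetric_eq (a β : ℝ → ℝ → ℝ) (X : Fin 4 → ℝ) (μ ν : Fin 4) :
    pgMetric a β X μ ν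
      = metricTab (a (X 0) (X 1)) (β (X 0) (X 1)) (X 1) μ ν * metricAng (X 2) μ ν := by
  fin_cases μ <;> fin_cases ν <;> simp [pgMetric, metricTab, metricAng]

theorem hasDerivWithinAt_metricTab {A B R : ℝ → ℝ} {A' B' r' x : ℝ} {s : Set ℝ}
    (hA : HasDerivWithinAt A A' s x) (hB : HasDerivWithinAt B B' s x)
    (hR : HasDerivWithinAt R r' s x) (μ ν : Fin 4) :
    HasDerivWithinAt (fun y => metricTab (A y) (B y) (R y) μ ν)
      (metricTab' (A x) (B x) (R x) A' B' r' μ ν) s x := by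
  have h00 : HasDerivWithinAt (fun y => -1 + A y ^ 2 * B y ^ 2)
      (2 * A x * B x * (A' * B x + A x * B')) s x := by
    refine (((hA.pow 2).mul (hB.pow 2)).const_add (-1)).congr_deriv ?_
    simp; ring
  have h01 : HasDerivWithinAt (fun y => A y ^ 2 * B y)
      (2 * A x * A' * B x + A x ^ 2 * B') s x := by
    refine ((hA.pow 2).mul hB).congr_deriv ?_
    simp
  have h11 : HasDerivWithinAt (fun y => A y ^ 2) (2 * A x * A') s x := by
    refine (hA.pow 2).congr_deriv ?_
    simp
  have h22 : HasDerivWithinAt (fun y => R y ^ 2) (2 * R x * r') s x := by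
    refine (hR.pow 2).congr_deriv ?_
    simp
  have h0 := hasDerivWithinAt_const x s (0 : ℝ)
  fin_cases μ <;> fin_cases ν <;>
    first
    | exact h0 | exact h00 | exact h01 | exact h11 | exact h22

theorem hasDerivAt_metricAng (θ : ℝ) (μ ν : Fin 4) :
    HasDerivAt (fun y => metricAng y μ ν) (metricAng' θ μ ν) θ := by
  have h0 := hasDerivAt_const θ (1 : ℝ)
  have h33 : HasDerivAt (fun y => Real.sin y ^ 2) (2 * Real.sin θ * Real.cos θ) θ := by
    refine ((Real.hasDerivAt_sin θ).pow 2).congr_deriv ?_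
    simp
  fin_cases μ <;> fin_cases ν <;>
    first
    | exact h0 | exact h33

/-- The inverse of the metric. -/
def metricInv (A B r s : ℝ) : Matrix (Fin 4) (Fin 4) ℝ :=
  !![-1, B, 0, 0; B, 1 / A ^ 2 - B ^ 2, 0, 0; 0, 0, 1 / r ^ 2, 0; 0, 0, 0, 1 / (r ^ 2 * s ^ 2)]

theorem pgMetric_inv (hA : a (X 0) (X 1) ≠ 0) (hr : X 1 ≠ 0) (hs : Real.sin (X 2) ≠ 0) :
    (pgMetric a β X)⁻¹ = metricInv (a (X 0) (X 1)) (β (X 0) (X 1)) (X 1) (Real.sin (X 2)) := by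
  refine Matrix.inv_eq_right_inv ?_
  ext μ ν
  fin_cases μ <;> fin_cases ν <;>
    simp [pgMetric, metricInv, Matrix.mul_apply, Fin.sum_univ_four] <;> field_simp <;> ring

/-- The Christoffel symbols without their dependence on `θ`, in terms of
`A = a`, `B = β`, `P = ∂_t a`, `Q = ∂_r a`, `M = ∂_t β`, `N = ∂_r β`. -/
def chrTab (A B P Q M N r : ℝ) : Fin 4 → Matrix (Fin 4) (Fin 4) ℝ :=
  let κ := P - B * Q - A * N
  ![!![A * B ^ 2 * κ, A * B * κ, 0, 0; A * B * κ, A * κ, 0, 0; 0, 0, -(r * B), 0;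
      0, 0, 0, -(r * B)],
    !![-(A * B ^ 3 * κ) + (2 * P * B / A + M - B * (Q * B / A + N)), -(A * B ^ 2 * κ) + P / A, 0, 0;
      -(A * B ^ 2 * κ) + P / A, -(A * B * κ) + Q / A, 0, 0;
      0, 0, -(r * (1 / A ^ 2 - B ^ 2)), 0; 0, 0, 0, -(r * (1 / A ^ 2 - B ^ 2))],
    !![0, 0, 0, 0; 0, 0, 1 / r, 0; 0, 1 / r, 0, 0; 0, 0, 0, -1],
    !![0, 0, 0, 0; 0, 0, 0, 1 / r; 0, 0, 0, 1; 0, 1 / r, 1, 0]]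

/-- The derivative of `chrTab` along a curve. -/
def chrTab' (A B P Q N r A' B' P' Q' M' N' r' : ℝ) : Fin 4 → Matrix (Fin 4) (Fin 4) ℝ :=
  let κ := P - B * Q - A * N
  let κ' := P' - (B' * Q + B * Q') - (A' * N + A * N')
  let Z₁₁ := -(A' * B * κ + A * B' * κ + A * B * κ') + (Q' * A - Q * A') / A ^ 2
  let Z₀₁ := -(A' * B ^ 2 * κ + 2 * A * B * B' * κ + A * B ^ 2 * κ') + (P' * A - P * A') / A ^ 2
  let Z₀₀ := -(A' * B ^ 3 * κ + 3 * A * B ^ 2 * B' * κ + A * B ^ 3 * κ')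
    + ((2 * (P' * B + P * B') * A - 2 * P * B * A') / A ^ 2 + M'
      - (B' * (Q * B / A + N) + B * (((Q' * B + Q * B') * A - Q * B * A') / A ^ 2 + N')))
  let Z₂₂ := -(r' * (1 / A ^ 2 - B ^ 2) + r * (-(2 * A' / A ^ 3) - 2 * B * B'))
  ![!![A' * B ^ 2 * κ + 2 * A * B * B' * κ + A * B ^ 2 * κ',
      A' * B * κ + A * B' * κ + A * B * κ', 0, 0;
      A' * B * κ + A * B' * κ + A * B * κ', A' * κ + A * κ', 0, 0;
      0, 0, -(r' * B + r * B'), 0; 0, 0, 0, -(r' * B + r * B')],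
    !![Z₀₀, Z₀₁, 0, 0; Z₀₁, Z₁₁, 0, 0; 0, 0, Z₂₂, 0; 0, 0, 0, Z₂₂],
    !![0, 0, 0, 0; 0, 0, -(r' / r ^ 2), 0; 0, -(r' / r ^ 2), 0, 0; 0, 0, 0, 0],
    !![0, 0, 0, 0; 0, 0, 0, -(r' / r ^ 2); 0, 0, 0, 0; 0, -(r' / r ^ 2), 0, 0]]

/-- The dependence of the Christoffel symbols on `θ`. -/
def chrAng (θ : ℝ) : Fin 4 → Matrix (Fin 4) (Fin 4) ℝ :=
  ![!![1, 1, 1, 1; 1, 1, 1, 1; 1, 1, 1, 1; 1, 1, 1, Real.sin θ ^ 2],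
    !![1, 1, 1, 1; 1, 1, 1, 1; 1, 1, 1, 1; 1, 1, 1, Real.sin θ ^ 2],
    !![1, 1, 1, 1; 1, 1, 1, 1; 1, 1, 1, 1; 1, 1, 1, Real.sin θ * Real.cos θ],
    !![1, 1, 1, 1; 1, 1, 1, 1; 1, 1, 1, Real.cos θ / Real.sin θ;
      1, 1, Real.cos θ / Real.sin θ, 1]]

/-- The derivative of `chrAng`. -/
def chrAng' (θ : ℝ) : Fin 4 → Matrix (Fin 4) (Fin 4) ℝ :=
  ![!![0, 0, 0, 0; 0, 0, 0, 0; 0, 0, 0, 0; 0, 0, 0, 2 * Real.sin θ * Real.cos θ],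
    !![0, 0, 0, 0; 0, 0, 0, 0; 0, 0, 0, 0; 0, 0, 0, 2 * Real.sin θ * Real.cos θ],
    !![0, 0, 0, 0; 0, 0, 0, 0; 0, 0, 0, 0; 0, 0, 0, Real.cos θ ^ 2 - Real.sin θ ^ 2],
    !![0, 0, 0, 0; 0, 0, 0, 0; 0, 0, 0, -(1 + (Real.cos θ / Real.sin θ) ^ 2);
      0, 0, -(1 + (Real.cos θ / Real.sin θ) ^ 2), 0]]

theorem hasDerivAt_chrAng {θ : ℝ} (hθ : Real.sin θ ≠ 0) (l μ ν : Fin 4) :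
    HasDerivAt (fun y => chrAng y l μ ν) (chrAng' θ l μ ν) θ := by
  have h0 := hasDerivAt_const θ (1 : ℝ)
  have h1 : HasDerivAt (fun y => Real.sin y ^ 2) (2 * Real.sin θ * Real.cos θ) θ := by
    refine ((Real.hasDerivAt_sin θ).pow 2).congr_deriv ?_
    simp
  have h2 : HasDerivAt (fun y => Real.sin y * Real.cos y)
      (Real.cos θ ^ 2 - Real.sin θ ^ 2) θ := by
    refine ((Real.hasDerivAt_sin θ).mul (Real.hasDerivAt_cos θ)).congr_deriv ?_
    ring
  have h3 : HasDerivAt (fun y => Real.cos y / Real.sin y)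
      (-(1 + (Real.cos θ / Real.sin θ) ^ 2)) θ := by
    refine ((Real.hasDerivAt_cos θ).div (Real.hasDerivAt_sin θ) hθ).congr_deriv ?_
    field_simp
    ring
  fin_cases l <;> fin_cases μ <;> fin_cases ν <;>
    first
    | exact h0 | exact h1 | exact h2 | exact h3

theorem hasDerivWithinAt_chrTab {A B P Q M N R : ℝ → ℝ} {A' B' P' Q' M' N' r' x : ℝ} {s : Set ℝ}
    (hA0 : A x ≠ 0) (hR0 : R x ≠ 0) (hA : HasDerivWithinAt A A' s x)
    (hB : HasDerivWithinAt B B' s x) (hP : HasDerivWithinAt P P' s x)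
    (hQ : HasDerivWithinAt Q Q' s x) (hM : HasDerivWithinAt M M' s x)
    (hN : HasDerivWithinAt N N' s x) (hR : HasDerivWithinAt R r' s x) (l μ ν : Fin 4) :
    HasDerivWithinAt (fun y => chrTab (A y) (B y) (P y) (Q y) (M y) (N y) (R y) l μ ν)
      (chrTab' (A x) (B x) (P x) (Q x) (N x) (R x) A' B' P' Q' M' N' r' l μ ν) s x := by
  -- The common factor `κ` is made opaque, so that the product rule treats it as one function.
  obtain ⟨κ, hκdef⟩ : ∃ κ : ℝ → ℝ, ∀ y, κ y = P y - B y * Q y - A y * N y := ⟨_, fun _ => rfl⟩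
  obtain ⟨κ', hκ'def⟩ : ∃ κ' : ℝ, κ' = P' - (B' * Q x + B x * Q') - (A' * N x + A x * N') :=
    ⟨_, rfl⟩
  have hκ : HasDerivWithinAt κ κ' s x := by
    rw [hκ'def]
    exact ((hP.sub (hB.mul hQ)).sub (hA.mul hN)).congr (fun y _ => hκdef y) (hκdef x)
  simp only [chrTab, chrTab', ← hκdef, ← hκ'def]
  have z := hasDerivWithinAt_const x s (0 : ℝ)
  have z1 := hasDerivWithinAt_const x s (1 : ℝ)
  have z2 := hasDerivWithinAt_const x s (-1 : ℝ)
  have a0 := ((hA.mul (hB.pow 2)).mul hκ)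
  have a1 := ((hA.mul hB).mul hκ)
  have a2 := hA.mul hκ
  have a3 := (hR.mul hB).neg
  have b1 := ((hA.mul (hB.pow 2)).mul hκ).neg.add (hP.div hA hA0)
  have b2 := ((hA.mul hB).mul hκ).neg.add (hQ.div hA hA0)
  have b0 := ((hA.mul (hB.pow 3)).mul hκ).neg.add
    (((((hP.const_mul 2).mul hB).div hA hA0).add hM).sub
      (hB.mul (((hQ.mul hB).div hA hA0).add hN)))
  have b3 := (hR.mul (((hasDerivWithinAt_const x s (1 : ℝ)).div (hA.pow 2)
    (pow_ne_zero 2 hA0)).sub (hB.pow 2))).neg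
  have c0 := (hasDerivWithinAt_const x s (1 : ℝ)).div hR hR0
  simp only [Pi.pow_apply, Pi.mul_apply, Pi.add_apply, Pi.sub_apply, Pi.div_apply]
    at a0 a1 a2 a3 b0 b1 b2 b3 c0
  have Ha0 := a0.congr_deriv (show _ = A' * B x ^ 2 * κ x + 2 * A x * B x * B' * κ x
    + A x * B x ^ 2 * κ' by norm_num; ring)
  have Ha1 := a1.congr_deriv (show _ = A' * B x * κ x + A x * B' * κ x + A x * B x * κ' by ring)
  have Hb1 := b1.congr_deriv (show _ = -(A' * B x ^ 2 * κ x + 2 * A x * B x * B' * κ x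
    + A x * B x ^ 2 * κ') + (P' * A x - P x * A') / A x ^ 2 by norm_num; ring)
  have Hb2 := b2.congr_deriv (show _ = -(A' * B x * κ x + A x * B' * κ x + A x * B x * κ')
    + (Q' * A x - Q x * A') / A x ^ 2 by ring)
  have Hb0 := b0.congr_deriv (show _ =
    -(A' * B x ^ 3 * κ x + 3 * A x * B x ^ 2 * B' * κ x + A x * B x ^ 3 * κ')
    + ((2 * (P' * B x + P x * B') * A x - 2 * P x * B x * A') / A x ^ 2 + M'
      - (B' * (Q x * B x / A x + N x)
        + B x * (((Q' * B x + Q x * B') * A x - Q x * B x * A') / A x ^ 2 + N'))) by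
    norm_num; ring)
  have Hb3 := b3.congr_deriv (show _ = -(r' * (1 / A x ^ 2 - B x ^ 2)
    + R x * (-(2 * A' / A x ^ 3) - 2 * B x * B')) by
    push_cast; field_simp; ring)
  have Hc0 := c0.congr_deriv (show _ = -(r' / R x ^ 2) by ring)
  fin_cases l <;> fin_cases μ <;> fin_cases ν <;>
    first
    | exact z | exact Ha0 | exact Ha1 | exact a2 | exact a3 | exact Hb0 | exact Hb1 | exact Hb2
    | exact Hb3 | exact Hc0 | exact z1 | exact z2

end Curvature

/-! ### Christoffel symbols and Ricci tensor -/

section Curvature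

variable {I : Set ℝ} {a β : ℝ → ℝ → ℝ} {X : Fin 4 → ℝ}

theorem sin_ne_zero_of_mem_chart (hX : X ∈ chart I) : Real.sin (X 2) ≠ 0 :=
  (Real.sin_pos_of_pos_of_lt_pi hX.2.2.1 hX.2.2.2).ne'

theorem partialD_pgMetric (hI : UniqueDiffOn ℝ I) (ha : IsCn 1 I a) (hb : IsCn 1 I β)
    (hX : X ∈ chart I) (l μ ν : Fin 4) :
    partialD (chart I) l (fun Y => pgMetric a β Y μ ν) X
      = ![metricTab' (a (X 0) (X 1)) (β (X 0) (X 1)) (X 1) (dt I a (X 0) (X 1))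
          (dt I β (X 0) (X 1)) 0 μ ν * metricAng (X 2) μ ν,
        metricTab' (a (X 0) (X 1)) (β (X 0) (X 1)) (X 1) (dr a (X 0) (X 1))
          (dr β (X 0) (X 1)) 1 μ ν * metricAng (X 2) μ ν,
        metricTab (a (X 0) (X 1)) (β (X 0) (X 1)) (X 1) μ ν * metricAng' (X 2) μ ν, 0] l := by
  have h0 := hX.1
  have h1 := hX.2.1
  refine partialD_eq hI hX (k := fun t r => metricTab (a t r) (β t r) r μ ν)
    (S := fun θ => metricAng θ μ ν) (fun Y _ => pgMetric_eq a β Y μ ν)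
    (hasDerivWithinAt_metricTab (ha.hasDerivWithinAt_dt one_ne_zero h0 h1.le)
      (hb.hasDerivWithinAt_dt one_ne_zero h0 h1.le) (hasDerivWithinAt_const _ _ _) μ ν)
    ?_ (hasDerivAt_metricAng _ μ ν) l
  exact (hasDerivWithinAt_metricTab (ha.hasDerivWithinAt_dr one_ne_zero h0 h1.le)
    (hb.hasDerivWithinAt_dr one_ne_zero h0 h1.le) (hasDerivWithinAt_id _ _) μ ν).hasDerivAt
    (Ici_mem_nhds h1)

/-- The factorisation into a `(t, r)`-part and a `θ`-part is established on the whole chart, so that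
the symbols can be differentiated once more through `partialD_eq`. -/
theorem christoffel_eq (hI : UniqueDiffOn ℝ I) (ha : IsCn 1 I a) (hb : IsCn 1 I β)
    (ha0 : ∀ t ∈ I, ∀ r, 0 ≤ r → a t r ≠ 0) (hX : X ∈ chart I) (l μ ν : Fin 4) :
    christoffel (chart I) (pgMetric a β) l μ ν X
      = chrTab (a (X 0) (X 1)) (β (X 0) (X 1)) (dt I a (X 0) (X 1)) (dr a (X 0) (X 1))
          (dt I β (X 0) (X 1)) (dr β (X 0) (X 1)) (X 1) l μ ν * chrAng (X 2) l μ ν := by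
  have hs := sin_ne_zero_of_mem_chart hX
  have hr : X 1 ≠ 0 := hX.2.1.ne'
  have hA := ha0 _ hX.1 _ hX.2.1.le
  simp only [christoffel, partialD_pgMetric hI ha hb hX, pgMetric_inv hA hr hs]
  -- The coefficients and their derivatives become free variables, and each component is an identity
  -- of rational expressions.
  generalize a (X 0) (X 1) = A at *
  generalize β (X 0) (X 1) = B at *
  generalize dt I a (X 0) (X 1) = P
  generalize dr a (X 0) (X 1) = Q
  generalize dt I β (X 0) (X 1) = M
  generalize dr β (X 0) (X 1) = N
  generalize X 1 = r at *
  generalize X 2 = θ at *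
  fin_cases l <;> fin_cases μ <;> fin_cases ν <;>
    simp [metricInv, metricTab, metricTab', metricAng, metricAng', chrTab, chrAng,
      Fin.sum_univ_four] <;>
    first
    | done
    | (field_simp; done)
    | (field_simp; ring)

theorem partialD_christoffel (hI : UniqueDiffOn ℝ I) (ha : IsCn 2 I a) (hb : IsCn 2 I β)
    (ha0 : ∀ t ∈ I, ∀ r, 0 ≤ r → a t r ≠ 0) (hX : X ∈ chart I) (k l μ ν : Fin 4) :
    partialD (chart I) k (christoffel (chart I) (pgMetric a β) l μ ν) X
      = ![chrTab' (a (X 0) (X 1)) (β (X 0) (X 1)) (dt I a (X 0) (X 1)) (dr a (X 0) (X 1))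
          (dr β (X 0) (X 1)) (X 1) (dt I a (X 0) (X 1)) (dt I β (X 0) (X 1))
          (dt I (dt I a) (X 0) (X 1)) (dt I (dr a) (X 0) (X 1)) (dt I (dt I β) (X 0) (X 1))
          (dt I (dr β) (X 0) (X 1)) 0 l μ ν * chrAng (X 2) l μ ν,
        chrTab' (a (X 0) (X 1)) (β (X 0) (X 1)) (dt I a (X 0) (X 1)) (dr a (X 0) (X 1))
          (dr β (X 0) (X 1)) (X 1) (dr a (X 0) (X 1)) (dr β (X 0) (X 1))
          (dr (dt I a) (X 0) (X 1)) (dr (dr a) (X 0) (X 1)) (dr (dt I β) (X 0) (X 1))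
          (dr (dr β) (X 0) (X 1)) 1 l μ ν * chrAng (X 2) l μ ν,
        chrTab (a (X 0) (X 1)) (β (X 0) (X 1)) (dt I a (X 0) (X 1)) (dr a (X 0) (X 1))
          (dt I β (X 0) (X 1)) (dr β (X 0) (X 1)) (X 1) l μ ν * chrAng' (X 2) l μ ν, 0] k := by
  have h0 := hX.1
  have h1 := hX.2.1
  obtain ⟨hat, har⟩ := IsCn.partials (n := 1) ha hI
  obtain ⟨hbt, hbr⟩ := IsCn.partials (n := 1) hb hI
  have ha1 := ha.of_le one_le_two
  have hb1 := hb.of_le one_le_two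
  have hA := ha0 _ h0 _ h1.le
  refine partialD_eq hI hX (k := fun t r => chrTab (a t r) (β t r) (dt I a t r) (dr a t r)
      (dt I β t r) (dr β t r) r l μ ν)
    (S := fun θ => chrAng θ l μ ν) (fun Y hY => christoffel_eq hI ha1 hb1 ha0 hY l μ ν)
    (hasDerivWithinAt_chrTab (A := fun s => a s (X 1)) (B := fun s => β s (X 1))
      (P := fun s => dt I a s (X 1)) (Q := fun s => dr a s (X 1)) (M := fun s => dt I β s (X 1))
      (N := fun s => dr β s (X 1)) (R := fun _ => X 1)
      hA h1.ne' (ha1.hasDerivWithinAt_dt one_ne_zero h0 h1.le)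
      (hb1.hasDerivWithinAt_dt one_ne_zero h0 h1.le)
      (hat.hasDerivWithinAt_dt one_ne_zero h0 h1.le)
      (har.hasDerivWithinAt_dt one_ne_zero h0 h1.le)
      (hbt.hasDerivWithinAt_dt one_ne_zero h0 h1.le)
      (hbr.hasDerivWithinAt_dt one_ne_zero h0 h1.le)
      (hasDerivWithinAt_const _ _ _) l μ ν)
    ?_ (hasDerivAt_chrAng (sin_ne_zero_of_mem_chart hX) l μ ν) k
  exact (hasDerivWithinAt_chrTab hA h1.ne' (ha1.hasDerivWithinAt_dr one_ne_zero h0 h1.le)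
    (hb1.hasDerivWithinAt_dr one_ne_zero h0 h1.le)
    (hat.hasDerivWithinAt_dr one_ne_zero h0 h1.le)
    (har.hasDerivWithinAt_dr one_ne_zero h0 h1.le)
    (hbt.hasDerivWithinAt_dr one_ne_zero h0 h1.le)
    (hbr.hasDerivWithinAt_dr one_ne_zero h0 h1.le)
    (hasDerivWithinAt_id _ _) l μ ν).hasDerivAt (Ici_mem_nhds h1)

/-- The Gauss curvature of the quotient metric `-dt² + a² (dr + β dt)²`, in terms of
`A = a`, `B = β`, `P = ∂_t a`, `Q = ∂_r a`, `M = ∂_t β`, `N = ∂_r β` and second derivatives. -/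
def gaussCurv (A B P Q M N Ptt Ptr Prr Ntr Nrr : ℝ) : ℝ :=
  ((Ptt - (M * Q + B * Ptr) - (P * N + A * Ntr))
    - B * (Ptr - (N * Q + B * Prr) - (Q * N + A * Nrr)) - N * (P - B * Q - A * N)) / A

/-- The trace `g^{μν} Γ^r_{μν}` over the quotient, which is `-□r`. -/
def boxTrace (A B P Q M N : ℝ) : ℝ := -(M - B * N) - B * (P - B * Q - A * N) / A + Q / A ^ 3

/-- The Ricci tensor without its dependence on `θ`. -/
def ricciTab (A B P Q M N r K : ℝ) : Matrix (Fin 4) (Fin 4) ℝ :=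
  let κ := P - B * Q - A * N
  let L := 1 - (1 / A ^ 2 - B ^ 2) + r * boxTrace A B P Q M N
  !![K * (-1 + A ^ 2 * B ^ 2) + 2 / r * (-(A * B ^ 3 * κ)
        + (2 * P * B / A + M - B * (Q * B / A + N))),
      K * (A ^ 2 * B) + 2 / r * (-(A * B ^ 2 * κ) + P / A), 0, 0;
    K * (A ^ 2 * B) + 2 / r * (-(A * B ^ 2 * κ) + P / A),
      K * A ^ 2 + 2 / r * (-(A * B * κ) + Q / A), 0, 0;
    0, 0, L, 0; 0, 0, 0, L]

-- The curvature of a warped product with warping function `r`: on the quotient `R_{ab} = K g_{ab} -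
-- (2/r) ∇_a ∇_b r` with `∇_a ∇_b r = -Γ^r_{ab}`, and on the sphere the factor `1 - |∇r|² - r □r`.
-- Derivatives are free parameters here. One symbol stands for each mixed second derivative, and
-- `∂_t² β` does not enter the result.
set_option maxHeartbeats 1000000 in
theorem ricciTab_identity {A B P Q M N r : ℝ} (Ptt Ptr Prr Mtt Ntr Nrr : ℝ) (hA : A ≠ 0)
    (hr : r ≠ 0) (θ : ℝ) (hs : Real.sin θ ≠ 0) (μ ν : Fin 4) :
    ∑ l, (![chrTab' A B P Q N r P M Ptt Ptr Mtt Ntr 0 l μ ν * chrAng θ l μ ν,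
        chrTab' A B P Q N r Q N Ptr Prr Ntr Nrr 1 l μ ν * chrAng θ l μ ν,
        chrTab A B P Q M N r l μ ν * chrAng' θ l μ ν, 0] l
      - ![chrTab' A B P Q N r P M Ptt Ptr Mtt Ntr 0 l μ l * chrAng θ l μ l,
        chrTab' A B P Q N r Q N Ptr Prr Ntr Nrr 1 l μ l * chrAng θ l μ l,
        chrTab A B P Q M N r l μ l * chrAng' θ l μ l, 0] ν)
    + ∑ l, ∑ σ, (chrTab A B P Q M N r l l σ * chrAng θ l l σ
          * (chrTab A B P Q M N r σ μ ν * chrAng θ σ μ ν)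
        - chrTab A B P Q M N r l ν σ * chrAng θ l ν σ
          * (chrTab A B P Q M N r σ μ l * chrAng θ σ μ l))
      = ricciTab A B P Q M N r (gaussCurv A B P Q M N Ptt Ptr Prr Ntr Nrr) μ ν
        * metricAng θ μ ν := by
  fin_cases μ <;> fin_cases ν <;>
    simp [metricAng, chrTab, chrTab', chrAng, chrAng', ricciTab, gaussCurv, boxTrace,
      Fin.sum_univ_four] <;>
    first
    | done
    | (field_simp; done)
    | (field_simp; ring)

end Curvature

/-! ### Einstein tensor of the metric -/

section Curvature

variable {I : Set ℝ} {a β : ℝ → ℝ → ℝ} {X : Fin 4 → ℝ}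

theorem ricci_eq (hI : UniqueDiffOn ℝ I) (hcl : I ⊆ closure (interior I)) (ha : IsCn 2 I a)
    (hb : IsCn 2 I β) (ha0 : ∀ t ∈ I, ∀ r, 0 ≤ r → a t r ≠ 0) (hX : X ∈ chart I) (μ ν : Fin 4) :
    ricci (chart I) (pgMetric a β) μ ν X
      = ricciTab (a (X 0) (X 1)) (β (X 0) (X 1)) (dt I a (X 0) (X 1)) (dr a (X 0) (X 1))
          (dt I β (X 0) (X 1)) (dr β (X 0) (X 1)) (X 1)
          (gaussCurv (a (X 0) (X 1)) (β (X 0) (X 1)) (dt I a (X 0) (X 1)) (dr a (X 0) (X 1))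
            (dt I β (X 0) (X 1)) (dr β (X 0) (X 1)) (dt I (dt I a) (X 0) (X 1))
            (dr (dt I a) (X 0) (X 1)) (dr (dr a) (X 0) (X 1)) (dr (dt I β) (X 0) (X 1))
            (dr (dr β) (X 0) (X 1))) μ ν * metricAng (X 2) μ ν := by
  have ha1 := ha.of_le one_le_two
  have hb1 := hb.of_le one_le_two
  rw [← ricciTab_identity _ _ _ (dt I (dt I β) (X 0) (X 1)) _ _ (ha0 _ hX.1 _ hX.2.1.le)
    hX.2.1.ne' (X 2) (sin_ne_zero_of_mem_chart hX)]
  simp only [ricci, partialD_christoffel hI ha hb ha0 hX, christoffel_eq hI ha1 hb1 ha0 hX,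
    ha.dt_dr_comm hI hcl hX.1 hX.2.1.le, hb.dt_dr_comm hI hcl hX.1 hX.2.1.le]

/-- The Einstein tensor without its dependence on `θ`. -/
def einsteinTab (A B P Q M N r K : ℝ) : Matrix (Fin 4) (Fin 4) ℝ :=
  let κ := P - B * Q - A * N
  let F := 2 * boxTrace A B P Q M N / r + (1 - (1 / A ^ 2 - B ^ 2)) / r ^ 2
  let L := -(r * boxTrace A B P Q M N) - r ^ 2 * K
  !![2 / r * (-(A * B ^ 3 * κ) + (2 * P * B / A + M - B * (Q * B / A + N)))
        - F * (-1 + A ^ 2 * B ^ 2),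
      2 / r * (-(A * B ^ 2 * κ) + P / A) - F * (A ^ 2 * B), 0, 0;
    2 / r * (-(A * B ^ 2 * κ) + P / A) - F * (A ^ 2 * B),
      2 / r * (-(A * B * κ) + Q / A) - F * A ^ 2, 0, 0;
    0, 0, L, 0; 0, 0, 0, L]

theorem scalar_identity {A B P Q M N r K : ℝ} (hA : A ≠ 0) (hr : r ≠ 0) (θ : ℝ)
    (hs : Real.sin θ ≠ 0) :
    ∑ μ, ∑ ν, metricInv A B r (Real.sin θ) μ ν
        * (ricciTab A B P Q M N r K μ ν * metricAng θ μ ν)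
      = 2 * K + 4 * boxTrace A B P Q M N / r + 2 * (1 - (1 / A ^ 2 - B ^ 2)) / r ^ 2 := by
  simp [metricInv, ricciTab, metricAng, boxTrace, Fin.sum_univ_four]
  field_simp
  ring

theorem einstein_eq (hI : UniqueDiffOn ℝ I) (hcl : I ⊆ closure (interior I)) (ha : IsCn 2 I a)
    (hb : IsCn 2 I β) (ha0 : ∀ t ∈ I, ∀ r, 0 ≤ r → a t r ≠ 0) (hX : X ∈ chart I) (μ ν : Fin 4) :
    einstein (chart I) (pgMetric a β) μ ν X
      = einsteinTab (a (X 0) (X 1)) (β (X 0) (X 1)) (dt I a (X 0) (X 1)) (dr a (X 0) (X 1))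
          (dt I β (X 0) (X 1)) (dr β (X 0) (X 1)) (X 1)
          (gaussCurv (a (X 0) (X 1)) (β (X 0) (X 1)) (dt I a (X 0) (X 1)) (dr a (X 0) (X 1))
            (dt I β (X 0) (X 1)) (dr β (X 0) (X 1)) (dt I (dt I a) (X 0) (X 1))
            (dr (dt I a) (X 0) (X 1)) (dr (dr a) (X 0) (X 1)) (dr (dt I β) (X 0) (X 1))
            (dr (dr β) (X 0) (X 1))) μ ν * metricAng (X 2) μ ν := by
  have hs := sin_ne_zero_of_mem_chart hX
  have hr : X 1 ≠ 0 := hX.2.1.ne'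
  have hA := ha0 _ hX.1 _ hX.2.1.le
  simp only [einstein, scalarCurvature, ricci_eq hI hcl ha hb ha0 hX, pgMetric_inv hA hr hs,
    pgMetric_eq, scalar_identity hA hr (X 2) hs]
  generalize gaussCurv (a (X 0) (X 1)) _ _ _ _ _ _ _ _ _ _ = K
  generalize a (X 0) (X 1) = A at *
  generalize β (X 0) (X 1) = B at *
  generalize dt I a (X 0) (X 1) = P
  generalize dr a (X 0) (X 1) = Q
  generalize dt I β (X 0) (X 1) = M
  generalize dr β (X 0) (X 1) = N
  generalize X 1 = r at *
  generalize X 2 = θ at *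
  fin_cases μ <;> fin_cases ν <;>
    simp [metricTab, metricAng, ricciTab, einsteinTab] <;>
    first
    | done
    | (field_simp; done)
    | (field_simp; ring)

end Curvature

/-! ### The Einstein tensor of a solution -/

section EinsteinSolution

variable {T : EReal} {f : ℝ → E3 → E3 → ℝ} {a β : ℝ → ℝ → ℝ} {t r : ℝ}

/-- The matter tensor without its dependence on `θ`. -/
def matterTab (A B r ρ p j q : ℝ) : Matrix (Fin 4) (Fin 4) ℝ :=
  !![ρ - 2 * A * B * j + A ^ 2 * B ^ 2 * p, -(A * j) + A ^ 2 * B * p, 0, 0;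
    -(A * j) + A ^ 2 * B * p, A ^ 2 * p, 0, 0; 0, 0, r ^ 2 * q / 2, 0; 0, 0, 0, r ^ 2 * q / 2]

/-- `hP` and `hM` are the evolution equations, `hQ` is the radial derivative of the constraint, and
`hK` is `gaussCurv_eq`. The first three settle the `(t, r)`-block, where `K` has dropped out; the
angular components need all four. -/
theorem einsteinTab_identity {A B P Q M N r K ρ p j q : ℝ} (hA : A ≠ 0) (hr : r ≠ 0)
    (hP : P = -4 * Real.pi * r * A ^ 2 * j + B * Q)
    (hM : M = 1 / (2 * r) * (1 - (1 / A ^ 2 - B ^ 2)) + 4 * Real.pi * r * p + B * N)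
    (hQ : Q = -A ^ 3 * ((1 - (1 / A ^ 2 - B ^ 2)) / (2 * r)
      - 4 * Real.pi * r * (ρ - A * B * j) + B * N))
    (hK : K = 4 * Real.pi * (p - q - ρ) + (1 - (1 / A ^ 2 - B ^ 2)) / r ^ 2) (μ ν : Fin 4) :
    einsteinTab A B P Q M N r K μ ν = 8 * Real.pi * matterTab A B r ρ p j q μ ν := by
  rw [hP, hM, hK, hQ]
  fin_cases μ <;> fin_cases ν <;>
    simp [einsteinTab, matterTab, boxTrace] <;>
    first
    | done
    | (field_simp; done)
    | (field_simp; ring)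

namespace IsReducedSolution

/-- The constraint holds identically in `r`, so its radial derivative vanishes and can be solved for
`∂_r a`. -/
theorem dr_a_eq (hs : IsReducedSolution T f a β) (ht : t ∈ timeInterval T) (hr : 0 < r) :
    dr a t r = -a t r ^ 3 * ((1 - (1 / a t r ^ 2 - β t r ^ 2)) / (2 * r)
      - 4 * Real.pi * r * (rho f t r - a t r * β t r * curr f t r) + β t r * dr β t r) := by
  have ha0 := (hs.regular_a.pos t ht r hr.le).ne'
  have h := hs.dr_defect ht hr.le
  rw [hs.dr_defect_eq_zero ht hr.le, hs.dr_Afun ht hr, hs.Afun_eq_metric ht hr.le, massSource] at h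
  have hr0 := hr.ne'
  field_simp at h ⊢
  linarith

theorem dt_dt_a (hs : IsReducedSolution T f a β) (ht : t ∈ timeInterval T) (hr : 0 ≤ r) :
    dt (timeInterval T) (dt (timeInterval T) a) t r
      = -4 * Real.pi * r * (2 * a t r * dt (timeInterval T) a t r * curr f t r
          + a t r ^ 2 * dt (timeInterval T) (curr f) t r)
        + (dt (timeInterval T) β t r * dr a t r + β t r * dr (dt (timeInterval T) a) t r) := by
  have hI := timeInterval_uniqueDiffOn T
  have hat : ∀ s ∈ timeInterval T, dt (timeInterval T) a s r
      = -4 * Real.pi * r * (a s r ^ 2 * curr f s r) + β s r * dr a s r := fun s hs' => by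
    rw [eq_add_of_sub_eq (hs.a_eq s hs' r hr)]; ring
  have h1 := (hs.regular_a.contDiff.hasDerivWithinAt_dt one_ne_zero ht hr).pow 2
  have h2 := hs.regular_f.isCn_curr.hasDerivWithinAt_dt one_ne_zero ht hr
  have h3 := hs.regular_β.contDiff.hasDerivWithinAt_dt one_ne_zero ht hr
  have h4 := (IsCn.partials (n := 1) hs.isCn_two_a hI).2.hasDerivWithinAt_dt one_ne_zero ht hr
  -- The mixed derivative is reordered, because the evolution equation is differentiated in `t`
  -- whereas `gaussCurv` contains `∂_r ∂_t a`.
  rw [← hs.isCn_two_a.dt_dr_comm hI (timeInterval_subset_closure_interior T) ht hr]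
  refine dt_eq hI ht ((((h1.mul h2).const_mul (-4 * Real.pi * r)).add (h3.mul h4)).congr
    hat (hat t ht) |>.congr_deriv ?_)
  simp

theorem dr_dt_a (hs : IsReducedSolution T f a β) (ht : t ∈ timeInterval T) (hr : 0 ≤ r) :
    dr (dt (timeInterval T) a) t r
      = -4 * Real.pi * (a t r ^ 2 * curr f t r)
        - 4 * Real.pi * r * (2 * a t r * dr a t r * curr f t r + a t r ^ 2 * dr (curr f) t r)
        + (dr β t r * dr a t r + β t r * dr (dr a) t r) := by
  have hI := timeInterval_uniqueDiffOn T
  have hat : ∀ s ∈ Ici (0 : ℝ), dt (timeInterval T) a t s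
      = -4 * Real.pi * s * (a t s ^ 2 * curr f t s) + β t s * dr a t s := fun s hs' => by
    rw [eq_add_of_sub_eq (hs.a_eq t ht s hs')]; ring
  have h0 := (hasDerivWithinAt_id r (Ici 0)).const_mul (-4 * Real.pi)
  have h1 := (hs.regular_a.contDiff.hasDerivWithinAt_dr one_ne_zero ht hr).pow 2
  have h2 := hs.regular_f.isCn_curr.hasDerivWithinAt_dr one_ne_zero ht hr
  have h3 := hs.regular_β.contDiff.hasDerivWithinAt_dr one_ne_zero ht hr
  have h4 := (IsCn.partials (n := 1) hs.isCn_two_a hI).2.hasDerivWithinAt_dr one_ne_zero ht hr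
  refine dr_eq hr (((h0.mul (h1.mul h2)).add (h3.mul h4)).congr hat (hat r hr) |>.congr_deriv ?_)
  simp
  ring

theorem dr_dt_beta (hs : IsReducedSolution T f a β) (ht : t ∈ timeInterval T) (hr : 0 < r) :
    dr (dt (timeInterval T) β) t r
      = dr β t r ^ 2 + β t r * dr (dr β) t r - dr (Afun f a β) t r / (2 * r)
        - (1 - Afun f a β t r) / (2 * r ^ 2) + 4 * Real.pi * pres f t r
        + 4 * Real.pi * r * dr (pres f) t r := by
  have hI := timeInterval_uniqueDiffOn T
  have hr0 := hr.ne'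
  have hbt : ∀ s ∈ Ici (0 : ℝ), dt (timeInterval T) β t s
      = (1 - Afun f a β t s) / (2 * s) + 4 * Real.pi * s * pres f t s + β t s * dr β t s :=
    fun s hs' => by
      rw [eq_add_of_sub_eq (hs.β_eq t ht s hs')]; ring
  have h0 := (hasDerivWithinAt_id r (Ici 0)).const_mul (4 * Real.pi)
  have h0' := (hasDerivWithinAt_id r (Ici 0)).const_mul 2
  have h1 := (hs.isCn_Afun.hasDerivWithinAt_dr one_ne_zero ht hr.le).const_sub 1
  have h2 := hs.regular_f.isCn_pres.hasDerivWithinAt_dr one_ne_zero ht hr.le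
  have h3 := hs.regular_β.contDiff.hasDerivWithinAt_dr one_ne_zero ht hr.le
  have h4 := hs.regular_β.contDiff_dr.hasDerivWithinAt_dr one_ne_zero ht hr.le
  refine dr_eq hr.le ((((h1.div h0' (by simpa using hr0)).add (h0.mul h2)).add (h3.mul h4)).congr
    hbt (hbt r hr.le) |>.congr_deriv ?_)
  simp only [id]
  field_simp
  ring

/-- With `κ = ∂_t a - β ∂_r a - a ∂_r β` the curvature is `(∂_t κ - β ∂_r κ - κ ∂_r β) / a`, and the
equation for `a` gives `κ = -4π r a² j - a ∂_r β`. Hence its derivatives are reached by the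
evolution equations, and `∂_t j` from the momentum equation brings in the tangential pressure. -/
theorem gaussCurv_eq (hs : IsReducedSolution T f a β) (ht : t ∈ timeInterval T) (hr : 0 < r) :
    gaussCurv (a t r) (β t r) (dt (timeInterval T) a t r) (dr a t r) (dt (timeInterval T) β t r)
        (dr β t r) (dt (timeInterval T) (dt (timeInterval T) a) t r)
        (dr (dt (timeInterval T) a) t r) (dr (dr a) t r) (dr (dt (timeInterval T) β) t r)
        (dr (dr β) t r)
      = 4 * Real.pi * (pres f t r - presTan f t r - rho f t r)
        + (1 - (1 / a t r ^ 2 - β t r ^ 2)) / r ^ 2 := by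
  have ha0 := (hs.regular_a.pos t ht r hr.le).ne'
  have hr0 := hr.ne'
  rw [gaussCurv, hs.dt_dt_a ht hr.le, hs.dr_dt_beta ht hr, hs.dr_dt_a ht hr.le,
    dt_curr hs.regular_f hs.regular_a hs.vlasov ht hr, hs.dr_Afun ht hr,
    hs.Afun_eq_metric ht hr.le, massSource, eq_add_of_sub_eq (hs.a_eq t ht r hr.le)]
  -- The remaining occurrences of `∂_t β` cancel, so its value is irrelevant.
  generalize dt (timeInterval T) β t r = M
  field_simp
  ring

theorem einstein_eq_matterTab (hs : IsReducedSolution T f a β) {X : Fin 4 → ℝ}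
    (hX : X ∈ chart (timeInterval T)) (μ ν : Fin 4) :
    einstein (chart (timeInterval T)) (pgMetric a β) μ ν X
      = 8 * Real.pi * (matterTab (a (X 0) (X 1)) (β (X 0) (X 1)) (X 1) (rho f (X 0) (X 1))
          (pres f (X 0) (X 1)) (curr f (X 0) (X 1)) (presTan f (X 0) (X 1)) μ ν
          * metricAng (X 2) μ ν) := by
  have h0 := hX.1
  have h1 := hX.2.1
  rw [einstein_eq (timeInterval_uniqueDiffOn T) (timeInterval_subset_closure_interior T)
    hs.isCn_two_a hs.isCn_two_beta (fun t ht r hr => (hs.regular_a.pos t ht r hr).ne') hX,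
    einsteinTab_identity (hs.regular_a.pos _ h0 _ h1.le).ne' h1.ne'
      (eq_add_of_sub_eq (hs.a_eq _ h0 _ h1.le)) ?_ (hs.dr_a_eq h0 h1) (hs.gaussCurv_eq h0 h1)]
  · ring
  · rw [eq_add_of_sub_eq (hs.β_eq _ h0 _ h1.le), hs.Afun_eq_metric h0 h1.le]

end IsReducedSolution

end EinsteinSolution

/-! ### The energy momentum tensor -/

section EnergyMomentum

variable {T : EReal} {f : ℝ → E3 → E3 → ℝ} {a β : ℝ → ℝ → ℝ} {t r : ℝ} {X : Fin 4 → ℝ}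

/-- Change of variables `p_i = c_i u_i`. -/
theorem integral_eq_integral_diagonal (c : Fin 3 → ℝ) (hc : ∀ i, c i ≠ 0) (G : (Fin 3 → ℝ) → ℝ) :
    ∫ p, G p = |c 0 * c 1 * c 2| * ∫ u : E3, G (fun i => c i * u i) := by
  have hdet : LinearMap.det (Matrix.toLin' (Matrix.diagonal c)) = c 0 * c 1 * c 2 := by
    rw [LinearMap.det_toLin', Matrix.det_diagonal, Fin.prod_univ_three]
  have happ : ∀ u, Matrix.toLin' (Matrix.diagonal c) u = fun i => c i * u i := fun u => by
    funext i
    rw [Matrix.toLin'_apply, Matrix.mulVec_diagonal]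
  set D := (Matrix.toLin' (Matrix.diagonal c)).toContinuousLinearMap with hD
  have hDapp : ∀ u, D u = fun i => c i * u i := happ
  have hinj : Function.Injective D := fun u w h => by
    funext i
    exact mul_left_cancel₀ (hc i) (by simpa [hDapp] using congrFun h i)
  have hsurj : Function.Surjective D := fun w => ⟨fun i => w i / c i, by
    rw [hDapp]; funext i; exact mul_div_cancel₀ _ (hc i)⟩
  have h := integral_image_eq_integral_abs_det_fderiv_smul (volume : Measure (Fin 3 → ℝ))
    MeasurableSet.univ (f := D) (f' := fun _ => D) (fun x _ => D.hasFDerivWithinAt) hinj.injOn G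
  rw [image_univ, hsurj.range_eq, setIntegral_univ, setIntegral_univ, integral_smul] at h
  have hd : D.det = c 0 * c 1 * c 2 := hdet
  rw [h, hd, smul_eq_mul]
  congr 1
  rw [← (PiLp.volume_preserving_ofLp (Fin 3)).integral_comp
    (MeasurableEquiv.toLp 2 (Fin 3 → ℝ)).symm.measurableEmbedding]
  simp only [hDapp]

/-- Moments are invariant under rotations about the axis. -/
theorem RegularDensity.moment_comp_matrix {I : Set ℝ} (hf : RegularDensity I f) (ht : t ∈ I)
    (φ : E3 → ℝ) {M : Matrix (Fin 3) (Fin 3) ℝ} (hM : M.transpose * M = 1) (hdet : M.det = 1)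
    (he : (WithLp.toLp 2 (M.mulVec e.ofLp) : E3) = e) :
    moment f (fun v => φ (WithLp.toLp 2 (M.mulVec v.ofLp))) t r = moment f φ t r := by
  obtain ⟨O, hO, hOx⟩ := exists_isometry_of_matrix M hM hdet
  have hOe : O (r • e) = r • e := by rw [map_smul, hOx, he]
  rw [moment, moment, ← O.measurePreserving.integral_comp O.toMeasurableEquiv.measurableEmbedding
    (fun v => φ v * f t (r • e) v)]
  refine integral_congr_ae (ae_of_all _ fun v => ?_)
  dsimp only
  rw [← hOx, ← hf.symmetric t ht O hO (r • e) v, hOe]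

/-- The rotation about the axis by a right angle. -/
def axisQuarter : Matrix (Fin 3) (Fin 3) ℝ := !![1, 0, 0; 0, 0, -1; 0, 1, 0]

/-- The rotation about the axis by a straight angle. -/
def axisHalf : Matrix (Fin 3) (Fin 3) ℝ := !![1, 0, 0; 0, -1, 0; 0, 0, -1]

theorem axisQuarter_mulVec (v : E3) :
    (WithLp.toLp 2 (axisQuarter.mulVec v.ofLp) : E3) = !₂[v 0, -v 2, v 1] := by
  ext i
  fin_cases i <;> simp [axisQuarter, Matrix.mulVec, dotProduct, Fin.sum_univ_three]

theorem axisHalf_mulVec (v : E3) :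
    (WithLp.toLp 2 (axisHalf.mulVec v.ofLp) : E3) = !₂[v 0, -v 1, -v 2] := by
  ext i
  fin_cases i <;> simp [axisHalf, Matrix.mulVec, dotProduct, Fin.sum_univ_three]

theorem RegularDensity.moment_comp_axisQuarter {I : Set ℝ} (hf : RegularDensity I f) (ht : t ∈ I)
    (φ : E3 → ℝ) :
    moment f (fun v => φ !₂[v 0, -v 2, v 1]) t r = moment f φ t r := by
  simp only [← axisQuarter_mulVec]
  refine hf.moment_comp_matrix ht φ ?_ ?_ ?_
  · ext i k
    fin_cases i <;> fin_cases k <;> simp [axisQuarter, Matrix.mul_apply, Fin.sum_univ_three]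
  · simp [axisQuarter, Matrix.det_fin_three]
  · ext i
    fin_cases i <;> simp [axisQuarter, e, Matrix.mulVec, dotProduct]

theorem RegularDensity.moment_comp_axisHalf {I : Set ℝ} (hf : RegularDensity I f) (ht : t ∈ I)
    (φ : E3 → ℝ) :
    moment f (fun v => φ !₂[v 0, -v 1, -v 2]) t r = moment f φ t r := by
  simp only [← axisHalf_mulVec]
  refine hf.moment_comp_matrix ht φ ?_ ?_ ?_
  · ext i k
    fin_cases i <;> fin_cases k <;> simp [axisHalf, Matrix.mul_apply, Fin.sum_univ_three]
  · simp [axisHalf, Matrix.det_fin_three]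
  · ext i
    fin_cases i <;> simp [axisHalf, e, Matrix.mulVec, dotProduct]

theorem jap_eq (v : E3) : jap v = Real.sqrt (1 + (v 0 ^ 2 + v 1 ^ 2 + v 2 ^ 2)) := by
  rw [← jap_sq, Real.sqrt_sq (jap_pos v).le]

theorem moment_neg (φ : E3 → ℝ) : moment f (fun v => -φ v) t r = -moment f φ t r := by
  simp only [moment, neg_mul, integral_neg]

theorem moment_const_mul (c : ℝ) (φ : E3 → ℝ) :
    moment f (fun v => c * φ v) t r = c * moment f φ t r := by
  simp only [moment, mul_assoc, integral_const_mul]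

/-- Moments of weights that are odd under the reflection of both tangential components vanish. -/
theorem RegularDensity.moment_eq_zero_of_odd {I : Set ℝ} (hf : RegularDensity I f) (ht : t ∈ I)
    {φ : E3 → ℝ} (hφ : ∀ v : E3, φ !₂[v 0, -v 1, -v 2] = -φ v) : moment f φ t r = 0 := by
  have h := hf.moment_comp_axisHalf ht (r := r) φ
  simp only [hφ, moment_neg] at h
  linarith

/-- A quarter turn about the axis changes the sign of `v_1 v_2` and preserves `⟨v⟩`. -/
theorem RegularDensity.moment_tangential_mul {I : Set ℝ} (hf : RegularDensity I f) (ht : t ∈ I) :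
    moment f (fun v => v 1 * v 2 / jap v) t r = 0 := by
  have h := hf.moment_comp_axisQuarter ht (r := r) (fun v => v 1 * v 2 / jap v)
  have hv : ∀ v : E3, (fun v : E3 => v 1 * v 2 / jap v) !₂[v 0, -v 2, v 1]
      = -(v 1 * v 2 / jap v) := fun v => by
    simp [jap_eq, add_assoc, add_comm, add_left_comm, mul_comm, neg_div]
  rw [funext hv, moment_neg] at h
  linarith

theorem RegularDensity.moment_tangential_sq (hf : RegularDensity (timeInterval T) f)
    (ht : t ∈ timeInterval T) :
    moment f (fun v => v 1 ^ 2 / jap v) t r = presTan f t r / 2 ∧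
      moment f (fun v => v 2 ^ 2 / jap v) t r = presTan f t r / 2 := by
  have h := hf.moment_comp_axisQuarter ht (r := r) (fun v => v 1 ^ 2 / jap v)
  have hv : ∀ v : E3, (fun v : E3 => v 1 ^ 2 / jap v) !₂[v 0, -v 2, v 1] = v 2 ^ 2 / jap v :=
    fun v => by
      simp [jap_eq, add_assoc, add_comm, add_left_comm]
  rw [funext hv] at h
  have hq : presTan f t r = moment f (fun v => v 1 ^ 2 / jap v) t r
      + moment f (fun v => v 2 ^ 2 / jap v) t r := by
    rw [presTan, ← hf.moment_add ht (continuous_div_jap (by fun_prop))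
      (continuous_div_jap (by fun_prop))]
    simp only [add_div]
  constructor <;> linarith

/-- The matrix with columns `e_r, e_θ, e_φ`. -/
def polarFrame (θ φ : ℝ) : Matrix (Fin 3) (Fin 3) ℝ :=
  !![Real.sin θ * Real.cos φ, Real.cos θ * Real.cos φ, -Real.sin φ;
    Real.sin θ * Real.sin φ, Real.cos θ * Real.sin φ, Real.cos φ;
    Real.cos θ, -Real.sin θ, 0]

theorem polarFrame_orthogonal (θ φ : ℝ) : (polarFrame θ φ).transpose * polarFrame θ φ = 1 := by
  have h1 := Real.sin_sq_add_cos_sq θ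
  have h2 := Real.sin_sq_add_cos_sq φ
  ext i k
  fin_cases i <;> fin_cases k <;>
    simp [polarFrame, Matrix.mul_apply, Fin.sum_univ_three] <;> grind

theorem polarFrame_det (θ φ : ℝ) : (polarFrame θ φ).det = 1 := by
  have h1 := Real.sin_sq_add_cos_sq θ
  have h2 := Real.sin_sq_add_cos_sq φ
  simp [polarFrame, Matrix.det_fin_three]
  grind

theorem cartPos_eq (X : Fin 4 → ℝ) :
    cartPos X = WithLp.toLp 2 ((polarFrame (X 2) (X 3)).mulVec (X 1 • e).ofLp) := by
  ext i
  fin_cases i <;>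
    simp [cartPos, polarFrame, e, Matrix.mulVec, dotProduct, mul_comm]

theorem norm_cartPos (hr : 0 ≤ X 1) : ‖cartPos X‖ = X 1 := by
  obtain ⟨O, -, hO⟩ := exists_isometry_of_matrix _ (polarFrame_orthogonal (X 2) (X 3))
    (polarFrame_det _ _)
  rw [cartPos_eq, ← hO, O.norm_map, norm_smul_e hr]

/-- The canonical momenta `(p_r, p_θ, p_φ)` that belong to the frame components `u`. -/
def frameScale (A r s : ℝ) : Fin 3 → ℝ := ![A, r, r * s]

theorem cartMom_frameScale (hr : X 1 ≠ 0) (hs : Real.sin (X 2) ≠ 0) (A : ℝ) (u : E3) :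
    cartMom X (fun i => frameScale A (X 1) (Real.sin (X 2)) i * u i)
      = WithLp.toLp 2 ((polarFrame (X 2) (X 3)).mulVec !₂[A * u 0, u 1, u 2].ofLp) := by
  ext i
  fin_cases i <;>
    simp [cartMom, polarFrame, frameScale, Matrix.mulVec, dotProduct, Fin.sum_univ_three] <;>
    field_simp

/-- The factor `1/a` in the radial part of `v` undoes the scaling `p_r = a u_0`, so that `v` has the
components `u` in the orthonormal frame `e_r, e_θ, e_φ`. -/
theorem noncanonical_frameScale (hr : 0 < X 1) (hs : Real.sin (X 2) ≠ 0) {A : ℝ} (hA : A ≠ 0)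
    (u : E3) :
    noncanonical A (cartPos X)
        (cartMom X (fun i => frameScale A (X 1) (Real.sin (X 2)) i * u i))
      = WithLp.toLp 2 ((polarFrame (X 2) (X 3)).mulVec u.ofLp) := by
  obtain ⟨O, -, hO⟩ := exists_isometry_of_matrix _ (polarFrame_orthogonal (X 2) (X 3))
    (polarFrame_det _ _)
  have hr0 := hr.ne'
  rw [noncanonical, norm_cartPos hr.le, cartMom_frameScale hr0 hs, cartPos_eq, ← hO, ← hO, ← hO,
    O.inner_map_map, inner_smul_left, inner_e, ← map_smul, ← map_add]
  congr 1
  ext i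
  fin_cases i <;> simp [e]
  field_simp
  ring

/-- Position and momentum are images of `r e` and `u` under the same rotation, which spherical
symmetry removes. -/
theorem canonicalDensity_frameScale (hf : ∀ t ∈ timeInterval T, SphericallySymmetric (f t))
    (hX : X ∈ chart (timeInterval T)) (hA : a (X 0) (X 1) ≠ 0) (u : E3) :
    canonicalDensity f a X
        (fun i => frameScale (a (X 0) (X 1)) (X 1) (Real.sin (X 2)) i * u i)
      = f (X 0) (X 1 • e) u := by
  rw [canonicalDensity, noncanonical_frameScale hX.2.1 (sin_ne_zero_of_mem_chart hX) hA,
    cartPos_eq, (hf _ hX.1).apply_matrix _ (polarFrame_orthogonal _ _) (polarFrame_det _ _)]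

theorem pUpZero_frameScale {A B r s : ℝ} (hA : A ≠ 0) (hr : r ≠ 0) (hs : s ≠ 0)
    {g : Matrix (Fin 4) (Fin 4) ℝ} (hg : g⁻¹ = metricInv A B r s) (u : E3) :
    pUpZero g (fun i => frameScale A r s i * u i) = jap u := by
  rw [pUpZero, hg, jap_eq]
  congr 1
  simp [metricInv, frameScale, Fin.sum_univ_three]
  field_simp
  ring

/-- The covariant components of the momentum in terms of the frame components `u`. -/
def frameMom (A B r s : ℝ) (u : E3) : Fin 4 → ℝ :=
  ![-jap u + B * (A * u 0), A * u 0, r * u 1, r * s * u 2]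

theorem pLow_frameScale {A B r s : ℝ} (hA : A ≠ 0) (hr : r ≠ 0) (hs : s ≠ 0)
    {g : Matrix (Fin 4) (Fin 4) ℝ} (hg : g⁻¹ = metricInv A B r s) (u : E3) (μ : Fin 4) :
    pLow g (fun i => frameScale A r s i * u i) μ = frameMom A B r s u μ := by
  rw [pLow, pUpZero_frameScale hA hr hs hg, hg]
  fin_cases μ
  · simp [metricInv, frameScale, frameMom, Fin.sum_univ_three]
    ring
  all_goals rfl

theorem sqrt_abs_det_pgMetric (hA : 0 < a (X 0) (X 1)) (hr : 0 < X 1) (hs : 0 < Real.sin (X 2)) :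
    Real.sqrt |(pgMetric a β X).det| = a (X 0) (X 1) * X 1 * (X 1 * Real.sin (X 2)) := by
  have h : (pgMetric a β X).det = -(a (X 0) (X 1) * X 1 * (X 1 * Real.sin (X 2))) ^ 2 := by
    simp [pgMetric, Matrix.det_succ_row_zero, Fin.sum_univ_succ, Fin.succAbove]
    ring
  rw [h, abs_neg, abs_sq, Real.sqrt_sq (by positivity)]

/-- In frame components the mass shell is Euclidean, `p^0 = ⟨u⟩`, and the Jacobian `a r · r sin θ`
of the change of variables equals `|g|^{1/2}` and cancels the prefactor. -/
theorem energyMomentum_eq_moment (hf : ∀ t ∈ timeInterval T, SphericallySymmetric (f t))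
    (hX : X ∈ chart (timeInterval T)) (hA : 0 < a (X 0) (X 1)) (μ ν : Fin 4) :
    energyMomentum (pgMetric a β X) (canonicalDensity f a X) μ ν
      = moment f (fun u =>
          frameMom (a (X 0) (X 1)) (β (X 0) (X 1)) (X 1) (Real.sin (X 2)) u μ
            * frameMom (a (X 0) (X 1)) (β (X 0) (X 1)) (X 1) (Real.sin (X 2)) u ν / jap u)
          (X 0) (X 1) := by
  have hr := hX.2.1
  have hs : 0 < Real.sin (X 2) := Real.sin_pos_of_pos_of_lt_pi hX.2.2.1 hX.2.2.2
  have hg := pgMetric_inv (β := β) hA.ne' hr.ne' hs.ne'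
  have hpos : 0 < a (X 0) (X 1) * X 1 * (X 1 * Real.sin (X 2)) := by positivity
  rw [energyMomentum, sqrt_abs_det_pgMetric hA hr hs,
    integral_eq_integral_diagonal (frameScale (a (X 0) (X 1)) (X 1) (Real.sin (X 2)))
      (fun i => by fin_cases i <;> simp [frameScale, hA.ne', hr.ne', hs.ne'])]
  simp only [pLow_frameScale hA.ne' hr.ne' hs.ne' hg, pUpZero_frameScale hA.ne' hr.ne' hs.ne' hg,
    canonicalDensity_frameScale hf hX hA.ne']
  have hc : frameScale (a (X 0) (X 1)) (X 1) (Real.sin (X 2)) 0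
      * frameScale (a (X 0) (X 1)) (X 1) (Real.sin (X 2)) 1
      * frameScale (a (X 0) (X 1)) (X 1) (Real.sin (X 2)) 2
      = a (X 0) (X 1) * X 1 * (X 1 * Real.sin (X 2)) := rfl
  rw [hc, abs_of_pos hpos, inv_mul_cancel_left₀ hpos.ne', moment]
  refine integral_congr_ae (ae_of_all _ fun u => ?_)
  dsimp only
  ring

/-- Components mixing `(t, r)` with an angle are odd under the half turn about the axis, and the
`(θ, φ)`-component is odd under the quarter turn. The quarter turn also exchanges the two tangential
pressures, so that each is half of `presTan`. -/
theorem RegularDensity.moment_frameMom (hf : RegularDensity (timeInterval T) f)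
    (ht : t ∈ timeInterval T) (A B r θ : ℝ) (μ ν : Fin 4) :
    moment f (fun u => frameMom A B r (Real.sin θ) u μ * frameMom A B r (Real.sin θ) u ν / jap u)
        t r
      = matterTab A B r (rho f t r) (pres f t r) (curr f t r) (presTan f t r) μ ν
        * metricAng θ μ ν := by
  have hj : ∀ v, jap v ≠ 0 := fun v => (jap_pos v).ne'
  have hrefl : ∀ v : E3, jap !₂[v 0, -v 1, -v 2] = jap v := fun v => by simp [jap_eq]
  have cj := continuous_jap
  have cp : Continuous fun v : E3 => v 0 ^ 2 / jap v := continuous_div_jap (by fun_prop)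
  have h00 : moment f (fun u => (-jap u + B * (A * u 0)) * (-jap u + B * (A * u 0)) / jap u) t r
      = rho f t r - 2 * A * B * curr f t r + A ^ 2 * B ^ 2 * pres f t r := by
    rw [rho_eq_moment, curr_eq_moment, pres_eq_moment, ← moment_const_mul, ← moment_const_mul,
      ← hf.moment_sub ht (by fun_prop) (by fun_prop), ← hf.moment_add ht (by fun_prop)
      (by fun_prop)]
    congr 1
    funext u
    have := hj u
    field_simp
    ring
  have h01 : moment f (fun u => (-jap u + B * (A * u 0)) * (A * u 0) / jap u) t r
      = -(A * curr f t r) + A ^ 2 * B * pres f t r := by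
    rw [curr_eq_moment, pres_eq_moment, ← moment_const_mul, ← moment_neg, ← moment_const_mul,
      ← hf.moment_add ht (by fun_prop) (by fun_prop)]
    congr 1
    funext u
    have := hj u
    field_simp
  have h11 : moment f (fun u => (A * u 0) * (A * u 0) / jap u) t r = A ^ 2 * pres f t r := by
    rw [pres_eq_moment, ← moment_const_mul]
    congr 1
    funext u
    ring
  have h22 : moment f (fun u => (r * u 1) * (r * u 1) / jap u) t r
      = r ^ 2 * presTan f t r / 2 := by
    rw [mul_div_assoc, ← (hf.moment_tangential_sq ht).1, ← moment_const_mul]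
    congr 1
    funext u
    ring
  have h33 : moment f (fun u => (r * Real.sin θ * u 2) * (r * Real.sin θ * u 2) / jap u) t r
      = r ^ 2 * presTan f t r / 2 * Real.sin θ ^ 2 := by
    rw [mul_div_assoc, ← (hf.moment_tangential_sq ht).2, mul_right_comm, ← moment_const_mul]
    congr 1
    funext u
    ring
  have h23 : moment f (fun u => (r * u 1) * (r * Real.sin θ * u 2) / jap u) t r = 0 := by
    rw [← mul_zero (r ^ 2 * Real.sin θ), ← hf.moment_tangential_mul ht (r := r),
      ← moment_const_mul]
    congr 1
    funext u
    ring
  have hsymm : ∀ φ ψ : E3 → ℝ, moment f (fun u => φ u * ψ u / jap u) t r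
      = moment f (fun u => ψ u * φ u / jap u) t r := fun φ ψ => by simp only [mul_comm]
  have h02 : moment f (fun u => (-jap u + B * (A * u 0)) * (r * u 1) / jap u) t r = 0 :=
    hf.moment_eq_zero_of_odd ht fun v => by rw [hrefl]; simp; ring
  have h03 : moment f (fun u => (-jap u + B * (A * u 0)) * (r * Real.sin θ * u 2) / jap u) t r
      = 0 := hf.moment_eq_zero_of_odd ht fun v => by rw [hrefl]; simp; ring
  have h12 : moment f (fun u => (A * u 0) * (r * u 1) / jap u) t r = 0 :=
    hf.moment_eq_zero_of_odd ht fun v => by rw [hrefl]; simp; ring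
  have h13 : moment f (fun u => (A * u 0) * (r * Real.sin θ * u 2) / jap u) t r = 0 :=
    hf.moment_eq_zero_of_odd ht fun v => by rw [hrefl]; simp; ring
  fin_cases μ <;> fin_cases ν <;> simp [frameMom, matterTab, metricAng]
  · exact h00
  · exact h01
  · exact h02
  · exact h03
  · rw [hsymm]; exact h01
  · exact h11
  · exact h12
  · exact h13
  · rw [hsymm]; exact h02
  · rw [hsymm]; exact h12
  · exact h22
  · exact h23
  · rw [hsymm]; exact h03
  · rw [hsymm]; exact h13
  · rw [hsymm]; exact h23
  · exact h33

theorem IsReducedSolution.einsteinEquations (hs : IsReducedSolution T f a β) :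
    EinsteinEquations (timeInterval T) f a β := fun X hX μ ν => by
  rw [hs.einstein_eq_matterTab hX, energyMomentum_eq_moment hs.regular_f.symmetric hX
    (hs.regular_a.pos _ hX.1 _ hX.2.1.le), hs.regular_f.moment_frameMom hX.1]

end EnergyMomentum

end PainleveGullstrand

end

theorem proposition3p3 (T : EReal) (hT : 0 < T)
    (f : ℝ → PainleveGullstrand.E3 → PainleveGullstrand.E3 → ℝ) (a β : ℝ → ℝ → ℝ)
    (hsol : PainleveGullstrand.IsReducedSolution T f a β) :
    -- `A = 1/a² - β²`
    (∀ t ∈ PainleveGullstrand.timeInterval T, ∀ r : ℝ, 0 ≤ r →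
      PainleveGullstrand.Afun f a β t r = 1 / a t r ^ 2 - β t r ^ 2) ∧
    -- `∂_t (r (1 - A)) = 8π r² (β (ρ + p) - (a β² + a⁻¹) j)`
    (∀ t ∈ PainleveGullstrand.timeInterval T, ∀ r : ℝ, 0 ≤ r →
      HasDerivWithinAt (fun s => r * (1 - PainleveGullstrand.Afun f a β s r))
        (8 * Real.pi * r ^ 2 *
          (β t r * (PainleveGullstrand.rho f t r + PainleveGullstrand.pres f t r)
            - (a t r * β t r ^ 2 + (a t r)⁻¹) * PainleveGullstrand.curr f t r))
        (PainleveGullstrand.timeInterval T) t) ∧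
    -- the original Vlasov equation
    PainleveGullstrand.Vlasov (PainleveGullstrand.timeInterval T) f a β ∧
    -- the Einstein equations, which contain second derivatives of `a`
    (ContDiffOn ℝ 2 (a 0) (Set.Ici 0) →
      PainleveGullstrand.IsCn 2 (PainleveGullstrand.timeInterval T) a ∧
      PainleveGullstrand.IsCn 2 (PainleveGullstrand.timeInterval T) β ∧
      PainleveGullstrand.EinsteinEquations (PainleveGullstrand.timeInterval T) f a β) := by
  exact ⟨fun t ht r hr => hsol.Afun_eq_metric ht hr,
    fun t ht r hr => hsol.hasDerivWithinAt_mass ht hr, hsol.original_vlasov,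
    fun _ => ⟨hsol.isCn_two_a, hsol.isCn_two_beta, hsol.einsteinEquations⟩⟩
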